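/- Theorem 2.1. Let $\mathcal{R}$ be an integral domain whose elements are encoded, injectively, by strings over a finite alphabet in such a way that addition and multiplication $\mathcal{R}\times\mathcal{R}\to\mathcal{R}$ are computable by Turing machines in polynomial time. A polynomial over $\mathcal{R}$ in variables $x_0,x_1,x_2,\dots$ is stored as a finite sum of monomials, every monomial being stored as a scalar in $\mathcal{R}$ together with a finite product of single variables (indices of variables are written in binary; the same monomial may be repeated). An order-three tensor over $\mathcal{R}$ is an array $\mathcal{T}\in\mathcal{R}^{a\times b\times c}$; it is stored as its size followed by the list of all its entries. For an integral domain $\mathcal{S}\supseteq\mathcal{R}$, let $\operatorname{rank}_{\mathcal{S}}\mathcal{T}$ be the smallest number of tensors of the form $(u_iv_jw_k)_{i,j,k}$ with $u\in\mathcal{S}^a$, $v\in\mathcal{S}^b$, $w\in\mathcal{S}^c$ that sum to $\mathcal{T}$. There is a Turing machine that, given a finite family of polynomials $f_1,\dots,f_p$ over $\mathcal{R}$, constructs in time polynomial in the length of the input an order-three tensor $\mathcal{T}$ over $\mathcal{R}$ and a non-negative integer $r$ (the size of $\mathcal{T}$ and $r$ being written in unary) such that for every integral domain $\mathcal{S}\supseteq\mathcal{R}$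 the following are equivalent: (1) the equations $f_1=0,\dots,f_p=0$ have a simultaneous solution in $\mathcal{S}$; (2) $\operatorname{rank}_{\mathcal{S}}\mathcal{T}\leq r$. In particular, $\mathcal{T}$ and $r$ depend only on the (stored) family $f_1,\dots,f_p$ and not on $\mathcal{S}$. -/

import Mathlib

universe u v

namespace TensorRankReduction

/-! ### Polynomial time on the Turing model -/

/-- The function `f : α → β`, with inputs written through `ea` over the alphabet `A` and outputs
written through `eb` over the alphabet `B`, is computed by a (multi-stack) Turing machine that, on
every input `x`, halts with output `eb (f x)` after at most `p (length of ea x)` steps, for a fixed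
polynomial `p`. This is Mathlib's `Turing.TM2ComputableInPolyTime` as a proposition, for types in
arbitrary universes. -/
def PolyTimeComputable {α : Type u} {β : Type v} {A B : Type}
    (ea : α → List A) (eb : β → List B) (f : α → β) : Prop :=
  ∃ (M : Turing.TM2ComputableAux A B) (p : Polynomial ℕ), ∀ x : α,
    Nonempty (Turing.TM2OutputsInTime M.tm
      ((ea x).map M.inputAlphabet.symm)
      (some ((eb (f x)).map M.outputAlphabet.symm))
      (p.eval (ea x).length))

/-! ### Systems of polynomials, stored as sums of monomials -/

/-- A stored monomial: a scalar in `R` and a list `[i₁, …, iₖ]` of variable indices (repetitions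
allowed), standing for the scalar times `X i₁ * ⋯ * X iₖ`. -/
structure Mono (R : Type u) where
  /-- the scalar -/
  scalar : R
  /-- the variables in the product, one by one -/
  vars : List ℕ

/-- A stored polynomial: a list of monomials, standing for their sum. -/
abbrev Poly (R : Type u) : Type u := List (Mono R)

/-- The monomial as a polynomial in variables `X 0, X 1, …`. -/
noncomputable def Mono.toMvPolynomial {R : Type u} [CommRing R] (m : Mono R) : MvPolynomial ℕ R :=
  MvPolynomial.C m.scalar * (m.vars.map MvPolynomial.X).prod

/-- The polynomial that is stored as a list of monomials. -/
noncomputable def Poly.toMvPolynomial {R : Type u} [CommRing R] (f : Poly R) : MvPolynomial ℕ R :=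
  (f.map Mono.toMvPolynomial).sum

/-- Alphabet for systems of polynomials whose scalars are written in the alphabet `Γ`: three
markers that announce a polynomial, a monomial and a variable, binary digits for the indices of
variables, and the letters of `Γ`. -/
inductive SystemSymbol (Γ : Type) : Type
  | poly : SystemSymbol Γ
  | mono : SystemSymbol Γ
  | var : SystemSymbol Γ
  | bit (b : Bool) : SystemSymbol Γ
  | letter (γ : Γ) : SystemSymbol Γ

/-- The string of a variable: a marker, then its index in binary. -/
def encodeVar {Γ : Type} (i : ℕ) : List (SystemSymbol Γ) :=
  SystemSymbol.var :: (Computability.encodeNat i).map SystemSymbol.bit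

/-- The string of a monomial: a marker, the string of its scalar, the strings of its variables. -/
def encodeMono {R : Type u} {Γ : Type} (enc : Computability.Encoding R Γ) (m : Mono R) :
    List (SystemSymbol Γ) :=
  SystemSymbol.mono :: ((enc.encode m.scalar).map SystemSymbol.letter ++ m.vars.flatMap encodeVar)

/-- The string of a polynomial: a marker, then the strings of its monomials. -/
def encodePoly {R : Type u} {Γ : Type} (enc : Computability.Encoding R Γ) (f : Poly R) :
    List (SystemSymbol Γ) :=
  SystemSymbol.poly :: f.flatMap (encodeMono enc)

/-- The string of a finite family of polynomials: the strings of its members, one after another. -/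
def encodeSystem {R : Type u} {Γ : Type} (enc : Computability.Encoding R Γ) (F : List (Poly R)) :
    List (SystemSymbol Γ) :=
  F.flatMap (encodePoly enc)

/-- The polynomials of the family `F` have a common zero with coordinates in the `R`-algebra `S`. -/
def HasCommonZero {R : Type u} [CommRing R] (F : List (Poly R))
    (S : Type v) [CommRing S] [Algebra R S] : Prop :=
  ∃ x : ℕ → S, ∀ f ∈ F, MvPolynomial.aeval x (Poly.toMvPolynomial f) = 0

/-! ### Order-three tensors and their rank -/

/-- An order-three tensor over `R`: a three-dimensional array of size `a × b × c`. -/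
structure Tensor3 (R : Type u) where
  /-- size in the first direction -/
  a : ℕ
  /-- size in the second direction -/
  b : ℕ
  /-- size in the third direction -/
  c : ℕ
  /-- the entries -/
  entry : Fin a → Fin b → Fin c → R

/-- The array `X` is simple with respect to `S`: it is `u ⊗ v ⊗ w` for vectors over `S`. -/
def IsSimple {S : Type v} [CommRing S] {a b c : ℕ} (X : Fin a → Fin b → Fin c → S) : Prop :=
  ∃ (x : Fin a → S) (y : Fin b → S) (z : Fin c → S), ∀ i j k, X i j k = x i * y j * z k

/-- `T` is the sum of `n` tensors that are simple with respect to `S`. -/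
def Tensor3.IsSumOfSimple {R : Type u} [CommRing R] (T : Tensor3 R)
    (S : Type v) [CommRing S] [Algebra R S] (n : ℕ) : Prop :=
  ∃ X : Fin n → Fin T.a → Fin T.b → Fin T.c → S,
    (∀ t, IsSimple (X t)) ∧ ∀ i j k, algebraMap R S (T.entry i j k) = ∑ t, X t i j k

/-- The set over which the minimum in the definition of the rank is taken is never empty. -/
theorem Tensor3.exists_isSumOfSimple {R : Type u} [CommRing R] (T : Tensor3 R)
    (S : Type v) [CommRing S] [Algebra R S] : ∃ n, T.IsSumOfSimple S n := by
  classical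
  let e := Fintype.equivFin (Fin T.a × Fin T.b × Fin T.c)
  refine ⟨Fintype.card (Fin T.a × Fin T.b × Fin T.c), fun t i j k =>
    (if i = (e.symm t).1 then algebraMap R S (T.entry i j k) else 0) *
      (if j = (e.symm t).2.1 then 1 else 0) * (if k = (e.symm t).2.2 then 1 else 0), ?_, ?_⟩
  · intro t
    refine ⟨fun i => if i = (e.symm t).1 then
        algebraMap R S (T.entry i (e.symm t).2.1 (e.symm t).2.2) else 0,
      fun j => if j = (e.symm t).2.1 then 1 else 0,
      fun k => if k = (e.symm t).2.2 then 1 else 0, fun i j k => ?_⟩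
    by_cases hj : j = (e.symm t).2.1 <;> by_cases hk : k = (e.symm t).2.2 <;> simp [hj, hk]
  · intro i j k
    rw [Finset.sum_eq_single (e (i, j, k))]
    · simp
    · intro t _ ht
      have h : (i, j, k) ≠ e.symm t := fun h => ht (by rw [h]; simp)
      by_cases hi : i = (e.symm t).1
      · by_cases hj : j = (e.symm t).2.1
        · by_cases hk : k = (e.symm t).2.2
          · exact absurd (Prod.ext hi (Prod.ext hj hk)) h
          · simp [hk]
        · simp [hj]
      · simp [hi]
    · simp

/-- The rank of `T` with respect to `S`: the smallest number of tensors that are simple with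
respect to `S` and sum to `T`. -/
noncomputable def Tensor3.rank {R : Type u} [CommRing R] (T : Tensor3 R)
    (S : Type v) [CommRing S] [Algebra R S] : ℕ :=
  sInf {n | T.IsSumOfSimple S n}

/-- Alphabet for pairs of a tensor and a number, the entries being written in the alphabet `Γ`:
unary digits, the end of a number, a marker that announces an entry, and the letters of `Γ`. -/
inductive InstanceSymbol (Γ : Type) : Type
  | one : InstanceSymbol Γ
  | endNum : InstanceSymbol Γ
  | entry : InstanceSymbol Γ
  | letter (γ : Γ) : InstanceSymbol Γ

/-- A number in unary. -/
def encodeUnary {Γ : Type} (n : ℕ) : List (InstanceSymbol Γ) :=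
  List.replicate n InstanceSymbol.one ++ [InstanceSymbol.endNum]

/-- The string of an instance `(T, r)` of the tensor rank problem: the three sizes and `r` in unary
(a machine that has to write unary has to do more than one that may write binary), then all the
entries of the array in lexicographic order. -/
def encodeInstance {R : Type u} {Γ : Type} (enc : Computability.Encoding R Γ)
    (I : Tensor3 R × ℕ) : List (InstanceSymbol Γ) :=
  encodeUnary I.1.a ++ encodeUnary I.1.b ++ encodeUnary I.1.c ++ encodeUnary I.2 ++
    (List.finRange I.1.a).flatMap fun i =>
      (List.finRange I.1.b).flatMap fun j =>
        (List.finRange I.1.c).flatMap fun k =>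
          InstanceSymbol.entry :: (enc.encode (I.1.entry i j k)).map InstanceSymbol.letter

end TensorRankReduction

namespace TensorRankReduction

/-! ### A structured programming language for stack machines -/

/-! A matrix with some entries left free becomes a tensor: slice `0` is the matrix with zeros in the
free places, and every free place contributes its matrix unit as a further slice. Suppose that the
rows `e l` and the columns `f l` meet in an identity block. If the matrix has a completion `Q` over
`S` with `Q i j = ∑ l, Q i (f l) * Q (e l) j`, then `card L` simple tensors put `Q` into slice `0`,
and one more for every free place supplies its matrix unit and corrects slice `0`. So the rank is at
most `card L` plus the number of free places. The converse is the core, and it has to produce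
entries in the domain `S`, not merely in its fraction field.

Take a decomposition with that many summands. The coefficient vectors that produce the matrix units
are independent and produce nothing inside the block, so the blocks of the rank-one matrices `u t ⊗
v t` span at most `card L` dimensions. They generate the identity, so they span exactly `card L`.
Two consequences follow. A combination whose block vanishes is supported on the free places; and
`card L` of the blocks form, up to scalars, a pair of dual bases, such that every other nonzero
block is a multiple of one of them (`exists_dual_bases`, `exists_proportional`). Let `Q` be the part
of slice `0` that comes from the summands with nonzero block. No division occurs, so `Q` has entries
in `S`, and it agrees with slice `0` outside the free places. If the free places in the block
columns are scarce (`IsRigid`), proportionality of two blocks forces the vectors `u` to be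
proportional on all rows, and `Q` factors through the block (`completion_of_rankOne_sum`).

A system is encoded by a rigid partial matrix with a block of size four, whatever the system. Read
the system as a list of tokens and evaluate it with the state (`cur`, `acc`): the value of the
current monomial and the sum of the earlier ones. A factored completion attaches to each row and
column a vector of length four, with coordinates `mul`, `tie`, `cur`, `acc`, and its entries are dot
products. The `state` column of a token is meant to be `(1, 1, cur, acc)` and the `fac` column of a
variable `(x, 1, cur * x, 0)`. A row with one unknown coordinate and two prescribed products
expresses one relation, after elimination of the unknown. A row `(*, 0, 1, 0)` orthogonal to `(1, 1,
c, a)` and `(x, 1, p, 0)` says `p = c * x`, the only nonlinear relation needed; a row with unknown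
`tie` coordinate equates two linear forms. Hence completions correspond to zeros of the system.

All entries are free, `0`, `1` or scalars of the input, and which of these occurs depends on the
kinds of two tokens, their relative position and the equality of two variable indices. The machine
therefore only copies, compares and counts. As its output is a stack, it writes the string of the
tensor from the last letter to the first. Its programs are written in a small structured language,
whose runs are simulated step by step by a stack machine. -/

/-- Programs over work stacks indexed by `W` with letters in `A`, and one write-only output stack
with letters in `B`. -/
inductive Prog (W A B : Type) : Type
  | skip : Prog W A B
  | push (w : W) (a : A) : Prog W A B
  | emit (b : B) : Prog W A B
  | seq (p q : Prog W A B) : Prog W A B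
  | pop (w : W) (e : Prog W A B) (f : A → Prog W A B) : Prog W A B
  | loop (w : W) (f : A → Prog W A B) : Prog W A B

variable {W A B : Type}

/-- `Runs p s o s' o' n`: started with work stacks `s` and output stack `o`, the program `p` ends
with work stacks `s'` and output stack `o'` after at most `n` steps. -/
inductive Runs [DecidableEq W] : Prog W A B → (W → List A) → List B → (W → List A) → List B →
    ℕ → Prop
  | skip (s o) : Runs .skip s o s o 1
  | push (w a s o) : Runs (.push w a) s o (Function.update s w (a :: s w)) o 1
  | emit (b s o) : Runs (.emit b) s o s (b :: o) 1
  | seq {p q s o s₁ o₁ s₂ o₂ n m} : Runs p s o s₁ o₁ n → Runs q s₁ o₁ s₂ o₂ m →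
      Runs (.seq p q) s o s₂ o₂ (n + m)
  | popNil {w e f s o s' o' n} : s w = [] → Runs e s o s' o' n →
      Runs (.pop w e f) s o s' o' (n + 1)
  | popCons {w e f s o s' o' n a l} : s w = a :: l →
      Runs (f a) (Function.update s w l) o s' o' n → Runs (.pop w e f) s o s' o' (n + 1)
  | loopNil {w f s o} : s w = [] → Runs (.loop w f) s o s o 1
  | loopCons {w f s o s₁ o₁ s₂ o₂ n m a l} : s w = a :: l →
      Runs (f a) (Function.update s w l) o s₁ o₁ n → Runs (.loop w f) s₁ o₁ s₂ o₂ m →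
      Runs (.loop w f) s o s₂ o₂ (n + m + 1)
  | mono {p s o s' o' n m} : Runs p s o s' o' n → n ≤ m → Runs p s o s' o' m

namespace Prog

/-- The control points of a program. -/
def Pos : Prog W A B → Type
  | skip => Unit
  | push _ _ => Unit
  | emit _ => Unit
  | seq p q => p.Pos ⊕ q.Pos
  | pop _ e f => Unit ⊕ (e.Pos ⊕ Σ a, (f a).Pos)
  | loop _ f => Unit ⊕ Σ a, (f a).Pos

theorem finite_pos [Finite A] : ∀ p : Prog W A B, Finite p.Pos
  | skip => inferInstanceAs (Finite Unit)
  | push _ _ => inferInstanceAs (Finite Unit)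
  | emit _ => inferInstanceAs (Finite Unit)
  | seq p q => by
    have := finite_pos p
    have := finite_pos q
    exact inferInstanceAs (Finite (p.Pos ⊕ q.Pos))
  | pop _ e f => by
    have := finite_pos e
    have := fun a => finite_pos (f a)
    exact inferInstanceAs (Finite (Unit ⊕ (e.Pos ⊕ Σ a, (f a).Pos)))
  | loop _ f => by
    have := fun a => finite_pos (f a)
    exact inferInstanceAs (Finite (Unit ⊕ Σ a, (f a).Pos))

/-- The control point at which a program starts. -/
def entry : ∀ p : Prog W A B, p.Pos
  | skip => ()
  | push _ _ => ()
  | emit _ => ()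
  | seq p _ => Sum.inl p.entry
  | pop _ _ _ => Sum.inl ()
  | loop _ _ => Sum.inl ()

/-- The stack alphabets of the machine: `none` is the output stack. -/
abbrev Alph (W A B : Type) : Option W → Type
  | none => B
  | some _ => A

/-- The machine statement at a control point of a program that is embedded through `ι` in a set of
labels and that has to continue at the label `exit`. -/
def stmt {Λ : Type} : ∀ p : Prog W A B, (p.Pos → Λ) → Λ → p.Pos →
    Turing.TM2.Stmt (Alph W A B) Λ (Option A)
  | skip, _, exit, _ => .goto fun _ => exit
  | push w a, _, exit, _ => .push (some w) (fun _ => a) (.goto fun _ => exit)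
  | emit b, _, exit, _ => .push none (fun _ => b) (.goto fun _ => exit)
  | seq p q, ι, _, Sum.inl l => p.stmt (fun l => ι (Sum.inl l)) (ι (Sum.inr q.entry)) l
  | seq _ q, ι, exit, Sum.inr l => q.stmt (fun l => ι (Sum.inr l)) exit l
  | pop w e f, ι, _, Sum.inl _ => .pop (some w) (fun _ o => o) (.goto fun v =>
      match v with
      | none => ι (Sum.inr (Sum.inl e.entry))
      | some a => ι (Sum.inr (Sum.inr ⟨a, (f a).entry⟩)))
  | pop _ e _, ι, exit, Sum.inr (Sum.inl l) => e.stmt (fun l => ι (Sum.inr (Sum.inl l))) exit l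
  | pop _ _ f, ι, exit, Sum.inr (Sum.inr ⟨a, l⟩) =>
      (f a).stmt (fun l => ι (Sum.inr (Sum.inr ⟨a, l⟩))) exit l
  | loop w f, ι, exit, Sum.inl _ => .pop (some w) (fun _ o => o) (.goto fun v =>
      match v with
      | none => exit
      | some a => ι (Sum.inr ⟨a, (f a).entry⟩))
  | loop _ f, ι, _, Sum.inr ⟨a, l⟩ =>
      (f a).stmt (fun l => ι (Sum.inr ⟨a, l⟩)) (ι (Sum.inl ())) l

theorem stmt_pop_entry {Λ : Type} (w : W) (e : Prog W A B) (f : A → Prog W A B)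
    (ι : (pop w e f).Pos → Λ) (exit : Λ) : (pop w e f).stmt ι exit (pop w e f).entry =
      .pop (some w) (fun _ o => o) (.goto fun v =>
        match v with
        | none => ι (Sum.inr (Sum.inl e.entry))
        | some a => ι (Sum.inr (Sum.inr ⟨a, (f a).entry⟩))) := rfl

theorem stmt_loop_entry {Λ : Type} (w : W) (f : A → Prog W A B)
    (ι : (loop w f).Pos → Λ) (exit : Λ) : (loop w f).stmt ι exit (loop w f).entry =
      .pop (some w) (fun _ o => o) (.goto fun v =>
        match v with
        | none => exit
        | some a => ι (Sum.inr ⟨a, (f a).entry⟩)) := rfl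

/-- The work stacks and the output stack together, as the stacks of the machine. -/
def stk (s : W → List A) (o : List B) : ∀ k, List (Alph W A B k)
  | none => o
  | some w => s w

theorem stk_update_some [DecidableEq W] (s : W → List A) (o : List B) (w : W) (l : List A) :
    Function.update (stk s o) (some w) l = stk (Function.update s w l) o := by
  funext k
  cases k with
  | none => rfl
  | some w' =>
    by_cases h : w' = w
    · subst h; simp [stk]
    · simp [stk, h]

theorem stk_update_none [DecidableEq W] (s : W → List A) (o o' : List B) :
    Function.update (stk s o) none o' = stk s o' := by
  funext k
  cases k with
  | none => simp [stk]
  | some w' => simp [stk]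

end Prog

open Prog Turing

/-- `ReachesIn M c c' n`: the machine `M` gets from `c` to `c'` in at most `n` steps. -/
def ReachesIn {K : Type} [DecidableEq K] {Γ : K → Type} {Λ σ : Type} (M : Λ → TM2.Stmt Γ Λ σ)
    (c c' : TM2.Cfg Γ Λ σ) (n : ℕ) : Prop :=
  ∃ m ≤ n, (flip bind (TM2.step M))^[m] (some c) = some c'

section ReachesIn

variable {K : Type} [DecidableEq K] {Γ : K → Type} {Λ σ : Type} {M : Λ → TM2.Stmt Γ Λ σ}

theorem ReachesIn.trans {c c' c'' : TM2.Cfg Γ Λ σ} {n m : ℕ} (h : ReachesIn M c c' n)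
    (h' : ReachesIn M c' c'' m) : ReachesIn M c c'' (n + m) := by
  obtain ⟨a, ha, ea⟩ := h
  obtain ⟨b, hb, eb⟩ := h'
  exact ⟨b + a, by omega, by rw [Function.iterate_add_apply, ea, eb]⟩

theorem ReachesIn.mono {c c' : TM2.Cfg Γ Λ σ} {n m : ℕ} (h : ReachesIn M c c' n) (hnm : n ≤ m) :
    ReachesIn M c c' m := by
  obtain ⟨a, ha, ea⟩ := h
  exact ⟨a, ha.trans hnm, ea⟩

theorem ReachesIn.single {l : Λ} {v : σ} {S : ∀ k, List (Γ k)} {c : TM2.Cfg Γ Λ σ}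
    (h : TM2.stepAux (M l) v S = c) : ReachesIn M ⟨some l, v, S⟩ c 1 :=
  ⟨1, le_rfl, by subst h; rfl⟩

end ReachesIn

/-- Induction on the run. The embedding `ι` and the label `exit` are arbitrary so that the induction
hypotheses apply to subprograms in place; the body of a loop exits to the control point of the loop
itself. The initial internal state is irrelevant, since a pop overwrites it before a jump reads it.
-/
theorem Runs.reachesIn [DecidableEq W] {p : Prog W A B} {s s' : W → List A} {o o' : List B}
    {n : ℕ} (h : Runs p s o s' o' n) : ∀ {Λ : Type} (ι : p.Pos → Λ) (exit : Λ)
      (M : Λ → TM2.Stmt (Alph W A B) Λ (Option A)), (∀ l, M (ι l) = p.stmt ι exit l) →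
      ∀ v, ∃ v', ReachesIn M ⟨some (ι p.entry), v, stk s o⟩ ⟨some exit, v', stk s' o'⟩ n := by
  induction h with
  | skip s o =>
    intro Λ ι exit M hM v
    exact ⟨v, .single (by rw [hM]; rfl)⟩
  | push w a s o =>
    intro Λ ι exit M hM v
    exact ⟨v, .single (by rw [hM, ← stk_update_some]; rfl)⟩
  | emit b s o =>
    intro Λ ι exit M hM v
    exact ⟨v, .single (by rw [hM, ← stk_update_none s o (b :: o)]; rfl)⟩
  | @seq p q s o s₁ o₁ s₂ o₂ n m _ _ ih₁ ih₂ =>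
    intro Λ ι exit M hM v
    obtain ⟨v₁, h₁⟩ := ih₁ (fun l => ι (Sum.inl l)) (ι (Sum.inr q.entry)) M
      (fun l => hM (Sum.inl l)) v
    obtain ⟨v₂, h₂⟩ := ih₂ (fun l => ι (Sum.inr l)) exit M (fun l => hM (Sum.inr l)) v₁
    exact ⟨v₂, h₁.trans h₂⟩
  | @popNil w e f s o s' o' n hw _ ih =>
    intro Λ ι exit M hM v
    obtain ⟨v₂, h₂⟩ := ih (fun l => ι (Sum.inr (Sum.inl l))) exit M
      (fun l => hM (Sum.inr (Sum.inl l))) none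
    refine ⟨v₂, (ReachesIn.trans (.single ?_) h₂).mono (Nat.add_comm 1 n).le⟩
    have hs : stk s o (some w) = [] := hw
    have hu : Function.update (stk s o) (some w) [] = stk s o := by
      rw [← hs]; exact Function.update_eq_self _ _
    rw [hM, stmt_pop_entry]
    simp only [ TM2.stepAux, hs, List.head?_nil, List.tail_nil, hu]
  | @popCons w e f s o s' o' n a l hw _ ih =>
    intro Λ ι exit M hM v
    obtain ⟨v₂, h₂⟩ := ih (fun l => ι (Sum.inr (Sum.inr ⟨a, l⟩))) exit M
      (fun l => hM (Sum.inr (Sum.inr ⟨a, l⟩))) (some a)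
    refine ⟨v₂, (ReachesIn.trans (.single ?_) h₂).mono (Nat.add_comm 1 n).le⟩
    have hs : stk s o (some w) = a :: l := hw
    rw [hM, stmt_pop_entry, ← stk_update_some]
    simp only [ TM2.stepAux, hs, List.head?_cons, List.tail_cons]
  | @loopNil w f s o hw =>
    intro Λ ι exit M hM v
    have hs : stk s o (some w) = [] := hw
    have hu : Function.update (stk s o) (some w) [] = stk s o := by
      rw [← hs]; exact Function.update_eq_self _ _
    refine ⟨none, .single ?_⟩
    rw [hM, stmt_loop_entry]
    simp only [ TM2.stepAux, hs, List.head?_nil, List.tail_nil, hu]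
  | @loopCons w f s o s₁ o₁ s₂ o₂ n m a l hw _ _ ih₁ ih₂ =>
    intro Λ ι exit M hM v
    obtain ⟨v₁, h₁⟩ := ih₁ (fun l => ι (Sum.inr ⟨a, l⟩)) (ι (Sum.inl ())) M
      (fun l => hM (Sum.inr ⟨a, l⟩)) (some a)
    obtain ⟨v₂, h₂⟩ := ih₂ ι exit M hM v₁
    refine ⟨v₂, (ReachesIn.trans (.single ?_) (h₁.trans h₂)).mono (by omega)⟩
    have hs : stk s o (some w) = a :: l := hw
    rw [hM, stmt_loop_entry, ← stk_update_some]
    simp only [ TM2.stepAux, hs, List.head?_cons, List.tail_cons]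
  | mono _ hnm ih =>
    intro Λ ι exit M hM v
    obtain ⟨v', h⟩ := ih ι exit M hM v
    exact ⟨v', h.mono hnm⟩

/-- The machine that runs a program with input on the stack `w`. -/
noncomputable def Prog.machine [DecidableEq W] [Fintype W] [Fintype A] (p : Prog W A B) (w : W) :
    FinTM2 where
  K := Option W
  k₀ := some w
  k₁ := none
  Γ := Alph W A B
  Λ := Option p.Pos
  main := some p.entry
  ΛFin := by
    have := p.finite_pos
    exact Fintype.ofFinite _
  σ := Option A
  initialState := none
  Γk₀Fin := inferInstanceAs (Fintype A)
  m
    -- The halting configuration `haltList` has the initial internal state, so the letter popped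
    -- last is erased first.
    | none => .load (fun _ => none) .halt
    | some l => p.stmt some none l

/-- A program that runs in polynomial time, and leaves its work stacks empty, shows that a function
is computable in polynomial time. -/
theorem PolyTimeComputable.of_runs {α : Type u} {β : Type v} [DecidableEq W] [Fintype W]
    [Fintype A] {ea : α → List A} {eb : β → List B} {f : α → β} (p : Prog W A B) (w : W)
    (P : Polynomial ℕ)
    (h : ∀ x, Runs p (Function.update (fun _ => []) w (ea x)) [] (fun _ => []) (eb (f x))
      (P.eval (ea x).length)) : PolyTimeComputable ea eb f := by
  -- The additional step is the one that halts.
  refine ⟨⟨p.machine w, Equiv.refl A, Equiv.refl B⟩, P + 1, fun x => ?_⟩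
  obtain ⟨v, hv⟩ := (h x).reachesIn (Λ := Option p.Pos) some none (p.machine w).m
    (fun _ => rfl) none
  have hlast : ReachesIn (p.machine w).m ⟨some none, v, stk (fun _ => []) (eb (f x))⟩
      ⟨none, none, stk (fun _ => []) (eb (f x))⟩ 1 := .single rfl
  obtain ⟨m, hm, e⟩ := hv.trans hlast
  refine ⟨⟨⟨m, ?_⟩, by simpa using hm⟩⟩
  have hi : initList (p.machine w) (List.map (Equiv.refl A).symm (ea x)) =
      ⟨some (some p.entry), none, stk (Function.update (fun _ => []) w (ea x)) []⟩ := by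
    unfold initList
    congr 1
    funext k
    cases k with
    | none => rfl
    | some w' =>
      by_cases hw : w' = w
      · subst hw
        simp [stk, Prog.machine]
        rfl
      · have : (some w' : Option W) ≠ some w := fun h => hw (Option.some.inj h)
        simp [stk, Prog.machine, hw]
  have ho : haltList (p.machine w) (List.map (Equiv.refl B).symm (eb (f x))) =
      ⟨none, none, stk (fun _ => []) (eb (f x))⟩ := by
    unfold haltList
    congr 1
    funext k
    cases k with
    | none =>
      simp [stk, Prog.machine]
      rfl
    | some w' => simp [stk, Prog.machine]
  have key : (flip bind (p.machine w).step)^[m]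
      (some (initList (p.machine w) (List.map (Equiv.refl A).symm (ea x)))) =
      some (haltList (p.machine w) (List.map (Equiv.refl B).symm (eb (f x)))) := by
    rw [hi, ho]
    exact e
  exact key

end TensorRankReduction

namespace TensorRankReduction

/-! ### Linear algebra: sums of rank-one matrices with a rigid pattern -/

section Field

variable {K : Type*} [Field K] {ι κ L τ : Type*} [Fintype τ]

/-- The linear map that sends coefficients `c` to the block with rows `e l` and columns `f l'`
of `∑ t, c t • u t ⊗ v t`. -/
def blockMap (u : τ → ι → K) (v : τ → κ → K) (e : L → ι) (f : L → κ) :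
    (τ → K) →ₗ[K] (L → L → K) where
  toFun c := fun l l' => ∑ t, c t * u t (e l) * v t (f l')
  map_add' c c' := by
    funext l l'
    simp [add_mul, Finset.sum_add_distrib]
  map_smul' a c := by
    funext l l'
    simp [Finset.mul_sum, mul_assoc]

theorem blockMap_apply (u : τ → ι → K) (v : τ → κ → K) (e : L → ι) (f : L → κ) (c : τ → K)
    (l l' : L) : blockMap u v e f c l l' = ∑ t, c t * u t (e l) * v t (f l') := rfl

theorem blockMap_single [DecidableEq τ] (u : τ → ι → K) (v : τ → κ → K) (e : L → ι) (f : L → κ)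
    (t : τ) (a : K) (l l' : L) :
    blockMap u v e f (Pi.single t a) l l' = a * u t (e l) * v t (f l') := by
  rw [blockMap_apply, Finset.sum_eq_single t]
  · simp
  · intro s _ hs
    simp [hs]
  · simp

/-- The matrix units sit outside the block, so their coefficient vectors have zero block. Together
with their independence this bounds the dimension spanned by the rank-one blocks. -/
theorem span_le_ker_blockMap {σ : Type*} [DecidableEq ι] [DecidableEq κ]
    {pos : σ → ι × κ} {u : τ → ι → K} {v : τ → κ → K} {e : L → ι} {f : L → κ} {w : σ → τ → K}
    (hw : ∀ x i j, ∑ t, w x t * u t i * v t j = if pos x = (i, j) then 1 else 0)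
    (hblock : ∀ x l l', pos x ≠ (e l, f l')) :
    Submodule.span K (Set.range w) ≤ LinearMap.ker (blockMap u v e f) := by
  rw [Submodule.span_le]
  rintro _ ⟨x, rfl⟩
  rw [SetLike.mem_coe, LinearMap.mem_ker]
  funext l l'
  rw [blockMap_apply, hw, if_neg (hblock x l l')]
  rfl

variable [Fintype L]

/-- Coefficient vectors that produce distinct matrix units are linearly independent. -/
theorem linearIndependent_of_matrixUnits {σ : Type*} [Fintype σ] [DecidableEq ι] [DecidableEq κ]
    {pos : σ → ι × κ} (hpos : pos.Injective) {u : τ → ι → K} {v : τ → κ → K} {w : σ → τ → K}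
    (hw : ∀ x i j, ∑ t, w x t * u t i * v t j = if pos x = (i, j) then 1 else 0) :
    LinearIndependent K w := by
  classical
  rw [Fintype.linearIndependent_iff]
  intro g hg x
  -- Evaluating the combination at the position of `x` isolates the coefficient `g x`.
  have h : ∑ y, g y * (∑ t, w y t * u t (pos x).1 * v t (pos x).2) = 0 := by
    simp only [Finset.mul_sum]
    rw [Finset.sum_comm]
    refine Finset.sum_eq_zero fun t _ => ?_
    have ht := congrFun hg t
    simp only [Finset.sum_apply, Pi.smul_apply, smul_eq_mul, Pi.zero_apply] at ht
    have : ∑ y, g y * (w y t * u t (pos x).1 * v t (pos x).2) =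
        (∑ y, g y * w y t) * (u t (pos x).1 * v t (pos x).2) := by
      rw [Finset.sum_mul]
      exact Finset.sum_congr rfl fun y _ => by ring
    rw [this, ht, zero_mul]
  rw [Finset.sum_eq_single x] at h
  · simpa [hw] using h
  · intro y _ hyx
    rw [hw, if_neg (fun h' => hyx (hpos h')), mul_zero]
  · simp

/-- A combination of rank-one matrices with vanishing block is supported on the free positions. -/
theorem sum_eq_zero_of_block_eq_zero {σ : Type*} [Fintype σ] [DecidableEq ι] [DecidableEq κ]
    {pos : σ → ι × κ} (hpos : pos.Injective)
    {u : τ → ι → K} {v : τ → κ → K} {e : L → ι} {f : L → κ} {w : σ → τ → K}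
    (hcard : Fintype.card τ ≤ Fintype.card L + Fintype.card σ)
    (hw : ∀ x i j, ∑ t, w x t * u t i * v t j = if pos x = (i, j) then 1 else 0)
    (hblock : ∀ x l l', pos x ≠ (e l, f l'))
    (hr : Fintype.card L ≤ Module.finrank K (LinearMap.range (blockMap u v e f)))
    {c : τ → K} (hc : blockMap u v e f c = 0) {i : ι} {j : κ} (hij : ∀ x, pos x ≠ (i, j)) :
    ∑ t, c t * u t i * v t j = 0 := by
  have hli := linearIndependent_of_matrixUnits hpos hw
  -- Rank-nullity: the range has dimension at least `card L`, so the kernel has dimension at most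
  -- `card σ` and is exhausted by the span of `w`.
  have hker : Module.finrank K (LinearMap.ker (blockMap u v e f)) ≤
      Module.finrank K (Submodule.span K (Set.range w)) := by
    have h1 := LinearMap.finrank_range_add_finrank_ker (blockMap u v e f)
    rw [Module.finrank_fintype_fun_eq_card] at h1
    rw [finrank_span_eq_card hli]
    omega
  have hmem : c ∈ Submodule.span K (Set.range w) := by
    rw [Submodule.eq_of_le_of_finrank_le (span_le_ker_blockMap hw hblock) hker]
    exact hc
  obtain ⟨g, rfl⟩ := (Submodule.mem_span_range_iff_exists_fun K).1 hmem
  have : ∑ t, (∑ x, g x • w x) t * u t i * v t j =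
      ∑ x, g x * ∑ t, w x t * u t i * v t j := by
    simp only [Finset.sum_apply, Pi.smul_apply, smul_eq_mul, Finset.sum_mul, Finset.mul_sum]
    rw [Finset.sum_comm]
    exact Finset.sum_congr rfl fun x _ => Finset.sum_congr rfl fun t _ => by ring
  rw [this]
  exact Finset.sum_eq_zero fun x _ => by rw [hw, if_neg (hij x), mul_zero]

variable [DecidableEq L]

/-- If the identity block is a combination of the blocks of the rank-one matrices, and these blocks
span a space of dimension at most `card L`, then some of them form a pair of dual bases. -/
theorem exists_dual_bases [DecidableEq τ] (u : τ → ι → K) (v : τ → κ → K) (e : L → ι) (f : L → κ)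
    (c : τ → K) (hc : ∀ l l', blockMap u v e f c l l' = if l = l' then 1 else 0)
    (hr : Module.finrank K (LinearMap.range (blockMap u v e f)) ≤ Fintype.card L) :
    ∃ (N : Finset τ) (α : τ → K), (∀ t, t ∉ N → α t = 0) ∧
      (∀ l l', blockMap u v e f α l l' = if l = l' then 1 else 0) ∧
      (∀ s ∈ N, ∀ t ∈ N, (∑ l, v s (f l) * u t (e l)) * α t = if s = t then 1 else 0) ∧
      (∀ s, ∃ γ : τ → K, (∀ t, t ∉ N → γ t = 0) ∧
        blockMap u v e f (Pi.single s 1) = blockMap u v e f γ) ∧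
      Module.finrank K (LinearMap.range (blockMap u v e f)) = Fintype.card L := by
  classical
  set T := blockMap u v e f with hT
  -- A basis of the span of the rank-one blocks, chosen among these blocks and indexed through `a`.
  obtain ⟨κ', a, ha, hspan, hli⟩ := exists_linearIndependent' K (fun t : τ => T (Pi.single t 1))
  have : Finite κ' := Finite.of_injective a ha
  have := Fintype.ofFinite κ'
  have hrange : LinearMap.range T = Submodule.span K (Set.range fun t : τ => T (Pi.single t 1)) := by
    apply le_antisymm
    · rintro _ ⟨c, rfl⟩
      have : c = ∑ t, c t • (Pi.single t 1 : τ → K) := by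
        funext t
        simp [Finset.sum_apply, Pi.single_apply]
      rw [this, map_sum]
      refine Submodule.sum_mem _ fun t _ => ?_
      rw [map_smul]
      exact Submodule.smul_mem _ _ (Submodule.subset_span ⟨t, rfl⟩)
    · rw [Submodule.span_le]
      rintro _ ⟨t, rfl⟩
      exact ⟨_, rfl⟩
  have hcard : Fintype.card κ' = Module.finrank K (LinearMap.range T) := by
    rw [hrange, ← hspan]
    exact (finrank_span_eq_card hli).symm
  have hlift : ∀ c : τ → K, ∃ β : κ' → K,
      T c = T (∑ k, β k • (Pi.single (a k) 1 : τ → K)) := by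
    intro c
    have hm : T c ∈ Submodule.span K (Set.range ((fun t : τ => T (Pi.single t 1)) ∘ a)) := by
      rw [hspan, ← hrange]
      exact ⟨c, rfl⟩
    obtain ⟨β, hβ⟩ := (Submodule.mem_span_range_iff_exists_fun K).1 hm
    exact ⟨β, by rw [← hβ, map_sum]; simp⟩
  let N : Finset τ := Finset.univ.image a
  have hval : ∀ (β : κ' → K) (k : κ'),
      (∑ k, β k • (Pi.single (a k) 1 : τ → K)) (a k) = β k := by
    intro β k
    simp only [Finset.sum_apply, Pi.smul_apply, Pi.single_apply, smul_eq_mul, mul_ite, mul_one,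
      mul_zero]
    rw [Finset.sum_eq_single k]
    · simp
    · intro k' _ hk
      rw [if_neg (fun h => hk (ha h).symm)]
    · simp
  have hsupp : ∀ (β : κ' → K) (t : τ), t ∉ N →
      (∑ k, β k • (Pi.single (a k) 1 : τ → K)) t = 0 := by
    intro β t ht
    simp only [Finset.sum_apply, Pi.smul_apply, Pi.single_apply, smul_eq_mul, mul_ite, mul_one,
      mul_zero]
    refine Finset.sum_eq_zero fun k _ => if_neg fun h => ht ?_
    rw [h]
    exact Finset.mem_image_of_mem a (Finset.mem_univ k)
  obtain ⟨β, hβ⟩ := hlift c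
  -- With the coefficients absorbed into `U`, the expansion of the identity block reads `U * V = 1`.
  -- This forces at least `card L` basis members, so the matrices are square, and `V * U = 1` is the
  -- duality.
  let U : Matrix L κ' K := fun l k => u (a k) (e l) * β k
  let V : Matrix κ' L K := fun k l => v (a k) (f l)
  have hTβ : ∀ l l', T (∑ k, β k • (Pi.single (a k) 1 : τ → K)) l l' =
      ∑ k, u (a k) (e l) * β k * v (a k) (f l') := by
    intro l l'
    rw [map_sum, Finset.sum_apply, Finset.sum_apply]
    refine Finset.sum_congr rfl fun k _ => ?_
    rw [map_smul, Pi.smul_apply, Pi.smul_apply, hT, blockMap_single, smul_eq_mul]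
    ring
  have hUV : U * V = 1 := by
    ext l l'
    rw [Matrix.mul_apply, Matrix.one_apply, ← hc l l', hβ, hTβ]
  have hle : Fintype.card L ≤ Fintype.card κ' := by
    have h1 : (U * V).rank = Fintype.card L := by rw [hUV, Matrix.rank_one]
    have h2 : (U * V).rank ≤ U.rank := Matrix.rank_mul_le_left U V
    have h3 := U.rank_le_card_width
    omega
  have hcards : Fintype.card L = Fintype.card κ' := le_antisymm hle (hcard ▸ hr)
  have hVU : V * U = 1 := (Matrix.mul_eq_one_comm_of_card_eq _ _ _ hcards).1 hUV
  refine ⟨N, ∑ k, β k • (Pi.single (a k) 1 : τ → K), hsupp β, ?_, ?_, ?_, ?_⟩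
  · intro l l'
    rw [← hβ, hc]
  · intro s hs t ht
    obtain ⟨k, -, rfl⟩ := Finset.mem_image.1 hs
    obtain ⟨k', -, rfl⟩ := Finset.mem_image.1 ht
    have := congrFun (congrFun hVU k) k'
    rw [Matrix.mul_apply, Matrix.one_apply] at this
    rw [hval, Finset.sum_mul]
    simp only [ha.eq_iff]
    rw [← this]
    exact Finset.sum_congr rfl fun l _ => by simp only [U, V]; ring
  · intro s
    obtain ⟨γ, hγ⟩ := hlift (Pi.single s 1)
    exact ⟨_, hsupp γ, hγ⟩
  · rw [hcards, hcard]

/-- Every rank-one matrix with a nonzero block has the same block, up to scalars, as a member of the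
dual bases. -/
theorem exists_proportional [DecidableEq τ] {u : τ → ι → K} {v : τ → κ → K} {e : L → ι}
    {f : L → κ} {N : Finset τ} {α : τ → K} (hα : ∀ t, t ∉ N → α t = 0)
    (hone : ∀ l l', blockMap u v e f α l l' = if l = l' then 1 else 0)
    (hdual : ∀ s ∈ N, ∀ t ∈ N, (∑ l, v s (f l) * u t (e l)) * α t = if s = t then 1 else 0)
    {s : τ} {γ : τ → K} (hγ : ∀ t, t ∉ N → γ t = 0)
    (hs : blockMap u v e f (Pi.single s 1) = blockMap u v e f γ)
    (hu : ∃ l, u s (e l) ≠ 0) (hv : ∃ l, v s (f l) ≠ 0) :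
    ∃ t ∈ N, ∃ x y : K, x ≠ 0 ∧ y ≠ 0 ∧ (∀ l, u s (e l) = x * u t (e l)) ∧
      ∀ l, v s (f l) = y * v t (f l) := by
  have hortho : ∀ s ∈ N, ∀ t ∈ N, s ≠ t → ∑ l, v s (f l) * u t (e l) = 0 := by
    intro s hs t ht hst
    have h := hdual s hs t ht
    have h' := hdual t ht t ht
    rw [if_neg hst] at h
    rw [if_pos rfl] at h'
    exact (mul_eq_zero.1 h).resolve_right fun h0 => by simp [h0] at h'
  have hsumN : ∀ (c : τ → K) (g : τ → K), (∀ t, t ∉ N → c t = 0) →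
      ∑ t, c t * g t = ∑ t ∈ N, c t * g t := by
    intro c g hc
    refine (Finset.sum_subset (Finset.subset_univ N) fun t _ ht => ?_).symm
    rw [hc t ht, zero_mul]
  -- Pair the block of `s` with `v t` on the left and `u t'` on the right. In the expansion over
  -- `N`, the term of `r` contains the pairings of `v t` with `u r` and of `v r` with `u t'`; as `t
  -- ≠ t'`, one of them has distinct indices and vanishes.
  have hprod : ∀ t ∈ N, ∀ t' ∈ N, t ≠ t' →
      (∑ l, v t (f l) * u s (e l)) * (∑ l, v s (f l) * u t' (e l)) = 0 := by
    intro t ht t' ht' htt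
    have key : ∀ c : τ → K,
        ∑ l, ∑ l', v t (f l) * blockMap u v e f c l l' * u t' (e l') =
        ∑ r, c r * ((∑ l, v t (f l) * u r (e l)) * (∑ l, v r (f l) * u t' (e l))) := by
      intro c
      simp only [blockMap_apply, Finset.sum_mul, Finset.mul_sum]
      rw [Finset.sum_congr rfl fun l _ => Finset.sum_comm, Finset.sum_comm]
      refine Finset.sum_congr rfl fun r _ => ?_
      rw [Finset.sum_comm]
      refine Finset.sum_congr rfl fun l _ => Finset.sum_congr rfl fun l' _ => ?_
      ring
    have h1 := key (Pi.single s 1)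
    have h2 := key γ
    rw [hs, h2, hsumN _ _ hγ] at h1
    have h3 : ∑ r, (Pi.single s 1 : τ → K) r *
        ((∑ l, v t (f l) * u r (e l)) * (∑ l, v r (f l) * u t' (e l))) =
        (∑ l, v t (f l) * u s (e l)) * (∑ l, v s (f l) * u t' (e l)) := by
      rw [Finset.sum_eq_single s]
      · simp
      · intro r _ hr
        simp [hr]
      · simp
    rw [← h3, ← h1]
    refine Finset.sum_eq_zero fun r hr => ?_
    by_cases htr : t = r
    · rw [hortho r hr t' ht' (htr ▸ htt)]
      simp
    · rw [hortho t ht r hr htr]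
      simp
  have hu_exp : ∀ l, u s (e l) = ∑ t ∈ N, α t * ((∑ l', v t (f l') * u s (e l')) * u t (e l)) := by
    intro l
    have h : ∑ l', blockMap u v e f α l l' * u s (e l') = u s (e l) := by
      simp [hone]
    rw [← h, ← hsumN _ _ hα]
    simp only [blockMap_apply, Finset.sum_mul, Finset.mul_sum]
    rw [Finset.sum_comm]
    exact Finset.sum_congr rfl fun t _ => Finset.sum_congr rfl fun l' _ => by ring
  have hv_exp : ∀ l, v s (f l) = ∑ t ∈ N, α t * ((∑ l', v s (f l') * u t (e l')) * v t (f l)) := by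
    intro l
    have h : ∑ l', v s (f l') * blockMap u v e f α l' l = v s (f l) := by
      simp [hone]
    rw [← h, ← hsumN _ _ hα]
    simp only [blockMap_apply, Finset.sum_mul, Finset.mul_sum]
    rw [Finset.sum_comm]
    exact Finset.sum_congr rfl fun t _ => Finset.sum_congr rfl fun l' _ => by ring
  -- Since `u s` is nonzero on the block, it pairs nontrivially with some `v t`. By `hprod`, `v s`
  -- then pairs to zero with all other `u t'`, so it is a multiple of `v t`; the symmetric argument
  -- applies to `u s`.
  obtain ⟨t, ht, htu⟩ : ∃ t ∈ N, ∑ l', v t (f l') * u s (e l') ≠ 0 := by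
    by_contra! h
    obtain ⟨l, hl⟩ := hu
    refine hl ?_
    rw [hu_exp l]
    exact Finset.sum_eq_zero fun t ht => by rw [h t ht]; simp
  have hv' : ∀ l, v s (f l) = α t * (∑ l', v s (f l') * u t (e l')) * v t (f l) := by
    intro l
    rw [hv_exp l, Finset.sum_eq_single_of_mem t ht, mul_assoc]
    intro t' ht' htt
    rw [(mul_eq_zero.1 (hprod t ht t' ht' htt.symm)).resolve_left htu]
    simp
  have hy : α t * (∑ l', v s (f l') * u t (e l')) ≠ 0 := by
    intro h0
    obtain ⟨l, hl⟩ := hv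
    exact hl (by rw [hv' l, h0, zero_mul])
  have hu' : ∀ l, u s (e l) = α t * (∑ l', v t (f l') * u s (e l')) * u t (e l) := by
    intro l
    rw [hu_exp l, Finset.sum_eq_single_of_mem t ht, mul_assoc]
    intro t' ht' htt
    rw [(mul_eq_zero.1 (hprod t' ht' t ht htt)).resolve_right (right_ne_zero_of_mul hy)]
    simp
  exact ⟨t, ht, _, _, mul_ne_zero (left_ne_zero_of_mul hy) htu, hy, hu', hv'⟩

open Classical in
/-- If a sum of few rank-one matrices has a rigid pattern, then those summands whose block does not
vanish sum to a completion of the pattern that factors through the block. -/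
theorem completion_of_rankOne_sum {σ : Type*} [Fintype σ] {pos : σ → ι × κ} (hpos : pos.Injective)
    {u : τ → ι → K} {v : τ → κ → K} {e : L → ι} {f : L → κ} {w : σ → τ → K} {c : τ → K}
    (hcard : Fintype.card τ ≤ Fintype.card L + Fintype.card σ)
    (hw : ∀ x i j, ∑ t, w x t * u t i * v t j = if pos x = (i, j) then 1 else 0)
    (hblock : ∀ x l l', pos x ≠ (e l, f l'))
    (hc : ∀ l l', ∑ t, c t * u t (e l) * v t (f l') = if l = l' then 1 else 0)
    (hrigid : ∀ i, ∃ l₀, (∀ l, l ≠ l₀ → ∀ x, pos x ≠ (i, f l)) ∧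
      ((∃ x, pos x = (i, f l₀)) → ∃ j, (∀ x, pos x ≠ (e l₀, j)) ∧ (∀ x, pos x ≠ (i, j)) ∧
        ∑ t, c t * u t (e l₀) * v t j ≠ 0))
    {Q : ι → κ → K} (hQ : ∀ i j, Q i j = ∑ t, if (∃ l, u t (e l) ≠ 0) ∧ (∃ l, v t (f l) ≠ 0) then
      c t * u t i * v t j else 0) :
    (∀ i j, (∀ x, pos x ≠ (i, j)) → Q i j = ∑ t, c t * u t i * v t j) ∧
      ∀ i j, Q i j = ∑ l, Q i (f l) * Q (e l) j := by
  -- The kernel contains the `card σ` independent vectors `w`, which leaves at most `card L`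
  -- dimensions for the range.
  have hr : Module.finrank K (LinearMap.range (blockMap u v e f)) ≤ Fintype.card L := by
    have h1 := LinearMap.finrank_range_add_finrank_ker (blockMap u v e f)
    have h2 := Submodule.finrank_mono (span_le_ker_blockMap (e := e) (f := f) hw hblock)
    rw [Module.finrank_fintype_fun_eq_card] at h1
    rw [finrank_span_eq_card (linearIndependent_of_matrixUnits hpos hw)] at h2
    omega
  obtain ⟨N, α, hα, hone, hdual, hγ, hfin⟩ := exists_dual_bases u v e f c hc hr
  have hzero : ∀ {c' : τ → K}, blockMap u v e f c' = 0 → ∀ {i j}, (∀ x, pos x ≠ (i, j)) →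
      ∑ t, c' t * u t i * v t j = 0 := fun h _ _ hij =>
    sum_eq_zero_of_block_eq_zero hpos hcard hw hblock hfin.ge h hij
  have heq : ∀ {c' c'' : τ → K}, blockMap u v e f c' = blockMap u v e f c'' → ∀ {i j},
      (∀ x, pos x ≠ (i, j)) → ∑ t, c' t * u t i * v t j = ∑ t, c'' t * u t i * v t j := by
    intro c' c'' h i j hij
    have h' := hzero (c' := c' - c'') (by rw [map_sub, h, sub_self]) hij
    simpa [sub_mul, sub_eq_zero] using h'
  -- The summands whose block is nonzero. Dropping the others does not change the block, hence
  -- changes the sum at free positions only.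
  let good : τ → Prop := fun t => (∃ l, u t (e l) ≠ 0) ∧ (∃ l, v t (f l) ≠ 0)
  let c₁ : τ → K := fun t => if good t then c t else 0
  have hQ₁ : ∀ i j, Q i j = ∑ t, c₁ t * u t i * v t j := by
    intro i j
    rw [hQ]
    refine Finset.sum_congr rfl fun t _ => ?_
    by_cases h : good t
    · simp only [c₁, if_pos h]
      exact if_pos h
    · simp only [c₁, if_neg h, zero_mul]
      exact if_neg h
  have hbad : ∀ t, ¬ good t → ∀ l l', u t (e l) * v t (f l') = 0 := by
    intro t h l l'
    by_contra h0
    exact h ⟨⟨l, left_ne_zero_of_mul h0⟩, ⟨l', right_ne_zero_of_mul h0⟩⟩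
  have hc₁ : blockMap u v e f c₁ = blockMap u v e f c := by
    funext l l'
    rw [blockMap_apply, blockMap_apply]
    refine Finset.sum_congr rfl fun t _ => ?_
    by_cases h : good t
    · simp only [c₁, if_pos h]
    · rw [mul_assoc, mul_assoc, hbad t h, mul_zero, mul_zero]
  have hαc : blockMap u v e f α = blockMap u v e f c := by
    funext l l'
    rw [hone, blockMap_apply, hc]
  refine ⟨fun i j hij => by rw [hQ₁, heq hc₁ hij], ?_⟩
  -- The columns `f l` of `∑ t, α t * u t ⊗ v t` recover all of `u s` from its values in the rows `e
  -- l`. For members of the dual bases this is duality; a general good `s` is compared with the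
  -- member `t` that has a proportional block.
  have hrow : ∀ i s, good s →
      ∑ l, (∑ t, α t * u t i * v t (f l)) * u s (e l) = u s i := by
    intro i s hs
    obtain ⟨γ, hγN, hγs⟩ := hγ s
    obtain ⟨t, ht, x, y, hx, hy, hux, hvy⟩ :=
      exists_proportional hα hone hdual hγN hγs hs.1 hs.2
    have hblk : blockMap u v e f (Pi.single s 1) = blockMap u v e f (Pi.single t (x * y)) := by
      funext l l'
      rw [blockMap_single, blockMap_single, hux, hvy]
      ring
    have hprop : ∀ {i j}, (∀ x, pos x ≠ (i, j)) → u s i * v s j = x * y * u t i * v t j := by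
      intro i j hij
      have h := heq hblk hij
      rw [Finset.sum_eq_single s (fun b _ hb => by simp [hb]) (by simp),
        Finset.sum_eq_single t (fun b _ hb => by simp [hb]) (by simp)] at h
      simpa using h
    have hαt := hdual t ht t ht
    rw [if_pos rfl] at hαt
    -- To extend proportionality to the row `i`, a position `(i, j)` that is not free is needed with
    -- `v s j = y * v t j` nonzero. A block column serves, unless `v t` is supported within the
    -- block on the one column `f l₀` that is free in row `i`; then the controlling column takes its
    -- place.
    have hui : u s i = x * u t i := by
      by_cases hfree : ∃ l, (∀ z, pos z ≠ (i, f l)) ∧ v t (f l) ≠ 0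
      · obtain ⟨l, hl, hl0⟩ := hfree
        have h := hprop hl
        rw [hvy] at h
        have h' : u s i * (y * v t (f l)) = x * u t i * (y * v t (f l)) := by rw [h]; ring
        exact mul_right_cancel₀ (mul_ne_zero hy hl0) h'
      · push Not at hfree
        obtain ⟨l₀, hl₀, hex⟩ := hrigid i
        have hvt : ∀ l, l ≠ l₀ → v t (f l) = 0 := fun l hl => hfree l (hl₀ l hl)
        have hsum : ∀ g : L → K, ∑ l, v t (f l) * g l = v t (f l₀) * g l₀ := by
          intro g
          exact Finset.sum_eq_single l₀ (fun l _ hl => by rw [hvt l hl, zero_mul]) (by simp)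
        rw [hsum] at hαt
        have hvt0 : v t (f l₀) ≠ 0 := fun h => by simp [h] at hαt
        have hut0 : u t (e l₀) ≠ 0 := fun h => by simp [h] at hαt
        have hstar : ∃ z, pos z = (i, f l₀) := by
          by_contra! h
          exact hvt0 (hfree l₀ h)
        obtain ⟨j, hj₀, hj, hne⟩ := hex hstar
        -- By duality `v t j` is the pairing of `v t` with the entries of the column `j` in the rows
        -- `e l`. Only `l₀` contributes, and its entry is nonzero by rigidity.
        have hvj : v t j ≠ 0 := by
          intro h0
          apply hne
          rw [← heq hαc hj₀]
          have h1 : v t (f l₀) * ∑ r, α r * u r (e l₀) * v r j =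
              ∑ l, v t (f l) * ∑ r, α r * u r (e l) * v r j :=
            (hsum fun l => ∑ r, α r * u r (e l) * v r j).symm
          have h2 : ∑ l, v t (f l) * ∑ r, α r * u r (e l) * v r j =
              ∑ r, ((∑ l, v t (f l) * u r (e l)) * α r) * v r j := by
            simp only [Finset.mul_sum, Finset.sum_mul]
            rw [Finset.sum_comm]
            exact Finset.sum_congr rfl fun r _ => Finset.sum_congr rfl fun l _ => by ring
          have h3 : ∑ r, ((∑ l, v t (f l) * u r (e l)) * α r) * v r j = 0 := by
            refine Finset.sum_eq_zero fun r _ => ?_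
            by_cases hr : r ∈ N
            · rw [hdual t ht r hr]
              by_cases htr : t = r
              · rw [← htr, h0, mul_zero]
              · rw [if_neg htr, zero_mul]
            · rw [hα r hr, mul_zero, zero_mul]
          rw [h2, h3] at h1
          exact (mul_eq_zero.1 h1).resolve_left hvt0
        have hvsj : v s j = y * v t j := by
          have h := hprop hj₀
          rw [hux] at h
          have h' : (x * u t (e l₀)) * v s j = (x * u t (e l₀)) * (y * v t j) := by rw [h]; ring
          exact mul_left_cancel₀ (mul_ne_zero hx hut0) h'
        have h := hprop hj
        rw [hvsj] at h
        have h' : u s i * (y * v t j) = x * u t i * (y * v t j) := by rw [h]; ring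
        exact mul_right_cancel₀ (mul_ne_zero hy hvj) h'
    have h1 : ∑ l, (∑ r, α r * u r i * v r (f l)) * u s (e l) =
        ∑ r, u r i * x * ((∑ l, v r (f l) * u t (e l)) * α r) := by
      simp only [Finset.mul_sum, Finset.sum_mul]
      rw [Finset.sum_comm]
      exact Finset.sum_congr rfl fun r _ => Finset.sum_congr rfl fun l _ => by rw [hux]; ring
    rw [h1, Finset.sum_eq_single t]
    · rw [hdual t ht t ht, if_pos rfl, hui]
      ring
    · intro r _ hr
      by_cases hrN : r ∈ N
      · have h := hdual r hrN t ht
        rw [if_neg hr] at h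
        rw [(mul_eq_zero.1 h).resolve_right (right_ne_zero_of_mul (a := ∑ l, v t (f l) * u t (e l))
          (by rw [hαt]; exact one_ne_zero))]
        ring
      · rw [hα r hrN]
        ring
    · simp
  have hfac : ∀ i j, Q i j = ∑ l, (∑ t, α t * u t i * v t (f l)) * Q (e l) j := by
    intro i j
    have h1 : ∑ l, (∑ t, α t * u t i * v t (f l)) * Q (e l) j =
        ∑ s, c₁ s * (∑ l, (∑ t, α t * u t i * v t (f l)) * u s (e l)) * v s j := by
      have h2 : ∀ q : L → K, ∑ l, q l * Q (e l) j =
          ∑ s, c₁ s * (∑ l, q l * u s (e l)) * v s j := by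
        intro q
        simp only [hQ₁, Finset.mul_sum, Finset.sum_mul]
        rw [Finset.sum_comm]
        exact Finset.sum_congr rfl fun r _ => Finset.sum_congr rfl fun l _ => by ring
      exact h2 _
    rw [h1, hQ₁]
    refine Finset.sum_congr rfl fun s _ => ?_
    by_cases h : good s
    · rw [hrow i s h]
    · simp only [c₁, if_neg h, zero_mul]
  -- In the column `f l`, where `Q` has an identity block, `hfac` identifies its coefficients with
  -- the entries `Q i (f l)`.
  intro i j
  rw [hfac i j]
  refine Finset.sum_congr rfl fun l _ => ?_
  congr 1
  rw [hfac i (f l)]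
  have h1 : ∀ l', Q (e l') (f l) = if l' = l then 1 else 0 := by
    intro l'
    rw [hQ₁, ← blockMap_apply, hc₁, blockMap_apply, hc]
  simp [h1]

end Field

end TensorRankReduction

namespace TensorRankReduction

/-! ### The tensor of a partial matrix -/

section Pattern

variable {R : Type u} {a b : ℕ}

/-- The free positions of a partial matrix. -/
def freePositions (A : Fin a → Fin b → Option R) : Finset (Fin a × Fin b) :=
  Finset.univ.filter fun p => (A p.1 p.2).isNone = true

theorem mem_freePositions {A : Fin a → Fin b → Option R} {p : Fin a × Fin b} :
    p ∈ freePositions A ↔ A p.1 p.2 = none := by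
  simp [freePositions]

variable [CommRing R]

/-- The entries of the tensor whose slice `0` is the partial matrix, with zeros in the free positions, and whose
other slices are the matrix units of the free positions, and zeros. -/
def patternEntry (A : Fin a → Fin b → Option R) (i : Fin a) (j : Fin b) (k : Fin (a * b + 1)) :
    R :=
  if k.val = 0 then (A i j).getD 0
  else if (A i j).isNone = true ∧ k.val = i.val * b + j.val + 1 then 1 else 0

/-- The tensor of a partial matrix. -/
def patternTensor (A : Fin a → Fin b → Option R) : Tensor3 R where
  a := a
  b := b
  -- There is a slice for every position, free or not, so that the size does not depend on the
  -- pattern.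
  c := a * b + 1
  entry := patternEntry A

theorem cell_index_lt (i : Fin a) (j : Fin b) : i.val * b + j.val + 1 < a * b + 1 := by
  have h : (i.val + 1) * b ≤ a * b := Nat.mul_le_mul_right _ i.isLt
  have := j.isLt
  rw [Nat.add_mul] at h
  omega

theorem cell_index_inj {i i' : Fin a} {j j' : Fin b}
    (h : i.val * b + j.val = i'.val * b + j'.val) : i = i' ∧ j = j' := by
  have hb : 0 < b := j.pos
  have h1 : i.val = i'.val := by
    have h2 : (i.val * b + j.val) / b = i.val := by
      rw [Nat.mul_comm, Nat.mul_add_div hb, Nat.div_eq_of_lt j.isLt, Nat.add_zero]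
    have h3 : (i'.val * b + j'.val) / b = i'.val := by
      rw [Nat.mul_comm, Nat.mul_add_div hb, Nat.div_eq_of_lt j'.isLt, Nat.add_zero]
    rw [← h2, ← h3, h]
  have h2 : j.val = j'.val := by rw [h1] at h; omega
  exact ⟨Fin.ext h1, Fin.ext h2⟩

/-- A partial matrix is rigid with respect to the rows `e l` and the columns `f l` if they meet in
an identity block, and every row has at most one free position in the columns `f l`, at which it is
controlled by another column. -/
structure IsRigid {L : Type} [DecidableEq L] (A : Fin a → Fin b → Option R) (e : L → Fin a)
    (f : L → Fin b) : Prop where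
  block : ∀ l l', A (e l) (f l') = some (if l = l' then 1 else 0)
  row : ∀ i, ∃ l₀, (∀ l, l ≠ l₀ → A i (f l) ≠ none) ∧ (A i (f l₀) = none →
    ∃ j r, A (e l₀) j = some r ∧ r ≠ 0 ∧ A i j ≠ none)

/-- `Q` is a completion of the partial matrix over `S` that factors through the rows `e l` and the
columns `f l`. -/
def IsFactoredCompletion {L : Type} [Fintype L] (A : Fin a → Fin b → Option R) (e : L → Fin a)
    (f : L → Fin b) {S : Type v} [CommRing S] [Algebra R S] (Q : Fin a → Fin b → S) : Prop :=
  (∀ i j r, A i j = some r → Q i j = algebraMap R S r) ∧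
    ∀ i j, Q i j = ∑ l, Q i (f l) * Q (e l) j

theorem Tensor3.rank_le_of_fintype (T : Tensor3 R) {S : Type v} [CommRing S] [Algebra R S]
    {τ : Type*} [Fintype τ] (X : τ → Fin T.a → Fin T.b → Fin T.c → S) (hX : ∀ t, IsSimple (X t))
    (h : ∀ i j k, algebraMap R S (T.entry i j k) = ∑ t, X t i j k) :
    T.rank S ≤ Fintype.card τ := by
  refine Nat.sInf_le ⟨fun t => X ((Fintype.equivFin τ).symm t), fun t => hX _, fun i j k => ?_⟩
  rw [h, ← Equiv.sum_comp (Fintype.equivFin τ).symm]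

theorem Tensor3.isSumOfSimple_rank (T : Tensor3 R) (S : Type v) [CommRing S] [Algebra R S] :
    T.IsSumOfSimple S (T.rank S) :=
  Nat.sInf_mem (T.exists_isSumOfSimple S)

variable {L : Type} [Fintype L] {A : Fin a → Fin b → Option R} {e : L → Fin a}
  {f : L → Fin b} {S : Type v} [CommRing S] [Algebra R S]

/-- `card L` simple tensors fill slice `0` with `Q`. Each free position takes one further simple
tensor, supported on its line in the third direction, with `1` in its own slice and `-Q` in slice
`0`, which restores the zero there. -/
theorem IsFactoredCompletion.rank_le {Q : Fin a → Fin b → S}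
    (hQ : IsFactoredCompletion A e f Q) :
    (patternTensor A).rank S ≤ Fintype.card L + (freePositions A).card := by
  have hcard : Fintype.card (L ⊕ freePositions A) =
      Fintype.card L + (freePositions A).card := by
    rw [Fintype.card_sum, Fintype.card_coe]
  rw [← hcard]
  let X : L ⊕ freePositions A → Fin a → Fin b → Fin (a * b + 1) → S := fun t (i : Fin a) (j : Fin b) k =>
    match t with
    | Sum.inl l => Q i (f l) * Q (e l) j * (if k.val = 0 then 1 else 0)
    | Sum.inr p => (if i = (p : Fin a × Fin b).1 then 1 else 0) *
        (if j = (p : Fin a × Fin b).2 then 1 else 0) *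
        (if k.val = 0 then -Q p.1.1 p.1.2 else
          if k.val = p.1.1.val * b + p.1.2.val + 1 then 1 else 0)
  refine (patternTensor A).rank_le_of_fintype X ?_ ?_
  · rintro (l | p)
    · exact ⟨_, _, _, fun i j k => rfl⟩
    · exact ⟨fun i : Fin a => if i = (p : Fin a × Fin b).1 then 1 else 0,
        fun j : Fin b => if j = (p : Fin a × Fin b).2 then 1 else 0, _,
        fun i j k => rfl⟩
  · intro (i : Fin a) (j : Fin b) (k : Fin (a * b + 1))
    change algebraMap R S (patternEntry A i j k) = _
    have hinl : ∑ l, X (Sum.inl l) i j k = if k.val = 0 then Q i j else 0 := by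
      simp only [X]
      rw [← Finset.sum_mul, ← hQ.2]
      split_ifs <;> simp
    rw [Fintype.sum_sum_type, hinl]
    cases hA : A i j with
    | none =>
      have hp : (i, j) ∈ freePositions A := mem_freePositions.2 hA
      rw [Finset.sum_eq_single ⟨(i, j), hp⟩]
      · simp only [patternEntry, X, hA]
        split_ifs <;> simp_all
      · rintro ⟨⟨i', j'⟩, hp'⟩ - hne
        by_cases hi : i = i'
        · by_cases hj : j = j'
          · subst hi hj
            exact absurd rfl hne
          · simp [X, hj]
        · simp [X, hi]
      · simp
    | some r =>
      rw [Finset.sum_eq_zero, hQ.1 i j r hA]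
      · simp only [patternEntry, hA]
        split_ifs <;> simp_all
      · rintro ⟨⟨i', j'⟩, hp'⟩ -
        by_cases hi : i = i'
        · by_cases hj : j = j'
          · subst hi hj
            have := mem_freePositions.1 hp'
            simp [hA] at this
          · simp [X, hj]
        · simp [X, hi]

theorem exists_of_patternTensor_isSumOfSimple {A : Fin a → Fin b → Option R} {S : Type v}
    [CommRing S] [Algebra R S] {n : ℕ} (h : (patternTensor A).IsSumOfSimple S n) :
    ∃ (x : Fin n → Fin a → S) (y : Fin n → Fin b → S) (z : Fin n → Fin (a * b + 1) → S),
      ∀ i j k, algebraMap R S (patternEntry A i j k) = ∑ t, z t k * x t i * y t j := by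
  obtain ⟨X, hX, hT⟩ := h
  choose x y z hxyz using hX
  refine ⟨x, y, z, fun i j k => (hT i j k).trans ?_⟩
  exact Finset.sum_congr rfl fun t _ => (hxyz t i j k).trans (by ring)

variable [DecidableEq L]

-- The sum that defines `Q` involves no division, so its entries lie in `S`. Its properties are
-- verified in the fraction field, where `completion_of_rankOne_sum` applies.
open Classical in
theorem IsRigid.exists_isFactoredCompletion [IsDomain S]
    (hinj : Function.Injective (algebraMap R S)) (hA : IsRigid A e f)
    (hr : (patternTensor A).rank S ≤ Fintype.card L + (freePositions A).card) :
    ∃ Q : Fin a → Fin b → S, IsFactoredCompletion A e f Q := by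
  obtain ⟨x, y, z, hT⟩ := exists_of_patternTensor_isSumOfSimple
    ((patternTensor A).isSumOfSimple_rank S)
  let φ := algebraMap S (FractionRing S)
  have hφ : Function.Injective φ := IsFractionRing.injective S (FractionRing S)
  let k₀ : Fin (a * b + 1) := ⟨0, Nat.succ_pos _⟩
  have hT₀ : ∀ (i : Fin a) (j : Fin b) (r : R), A i j = some r →
      ∑ t, z t k₀ * x t i * y t j = algebraMap R S r := by
    intro i j r h
    rw [← hT]
    simp [patternEntry, k₀, h]
  let Q : Fin a → Fin b → S := fun i j => ∑ t, if (∃ l, x t (e l) ≠ 0) ∧ (∃ l, y t (f l) ≠ 0) then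
    z t k₀ * x t i * y t j else 0
  have hfree : ∀ {i j}, A i j ≠ none → ∀ p : freePositions A, (p : Fin a × Fin b) ≠ (i, j) := by
    rintro i j h ⟨p, hp⟩ rfl
    exact h (mem_freePositions.1 hp)
  have key := completion_of_rankOne_sum (K := FractionRing S) (L := L)
    (pos := fun p : freePositions A => (p : Fin a × Fin b)) Subtype.coe_injective
    (u := fun t i => φ (x t i)) (v := fun t j => φ (y t j)) (e := e) (f := f)
    (w := fun p t => φ (z t ⟨_, cell_index_lt p.1.1 p.1.2⟩)) (c := fun t => φ (z t k₀))
    (by rw [Fintype.card_fin, Fintype.card_coe]; exact hr)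
    (by
      rintro ⟨⟨i', j'⟩, hp⟩ i j
      simp only [← map_mul, ← map_sum]
      rw [← hT]
      simp only [patternEntry, Nat.add_one_ne_zero, if_false, Nat.add_right_cancel_iff,
        Prod.mk.injEq]
      by_cases h : i' = i ∧ j' = j
      · obtain ⟨rfl, rfl⟩ := h
        have := mem_freePositions.1 hp
        simp_all
      · rw [if_neg h, if_neg]
        · simp
        · rintro ⟨-, h'⟩
          exact h (cell_index_inj h'))
    (fun p l l' => hfree (by rw [hA.block]; simp) p)
    (by
      intro l l'
      simp only [← map_mul, ← map_sum]
      rw [hT₀ _ _ _ (hA.block l l')]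
      split_ifs <;> simp)
    (by
      intro i
      obtain ⟨l₀, h₀, h₁⟩ := hA.row i
      refine ⟨l₀, fun l hl => hfree (h₀ l hl), ?_⟩
      rintro ⟨⟨p, hp⟩, h⟩
      simp only at h
      subst h
      obtain ⟨j, r, hj, hr0, hij⟩ := h₁ (mem_freePositions.1 hp)
      refine ⟨j, hfree (by rw [hj]; simp), hfree hij, ?_⟩
      simp only [← map_mul, ← map_sum]
      rw [hT₀ _ _ _ hj]
      exact fun h => hr0 (hinj (by rw [hφ (h.trans (map_zero φ).symm), map_zero])))
    (Q := fun i j => φ (Q i j))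
    (by
      intro i j
      simp only [Q, map_sum, ne_eq, map_eq_zero_iff φ hφ]
      exact Finset.sum_congr rfl fun t _ => by split_ifs <;> simp)
  refine ⟨Q, ?_, ?_⟩
  · intro i j r h
    apply hφ
    rw [key.1 i j (hfree (by rw [h]; simp))]
    simp only [← map_mul, ← map_sum]
    rw [hT₀ _ _ _ h]
  · intro i j
    apply hφ
    rw [key.2 i j]
    simp

/-- The rank of the tensor of a rigid partial matrix decides whether the matrix has a completion
that factors through its identity block. -/
theorem IsRigid.rank_le_iff [IsDomain S] (hinj : Function.Injective (algebraMap R S))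
    (hA : IsRigid A e f) :
    (patternTensor A).rank S ≤ Fintype.card L + (freePositions A).card ↔
      ∃ Q : Fin a → Fin b → S, IsFactoredCompletion A e f Q :=
  ⟨hA.exists_isFactoredCompletion hinj, fun ⟨_, hQ⟩ => hQ.rank_le⟩

end Pattern

end TensorRankReduction

namespace TensorRankReduction

/-! ### Systems of polynomials as lists of tokens -/

/-- The tokens of a stored system: the start of a polynomial, the start of a monomial with its
scalar, a variable. -/
inductive Token (R : Type u) : Type u
  | poly : Token R
  | mono (r : R) : Token R
  | var (i : ℕ) : Token R

/-- The tokens of a monomial. -/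
def monoTokens {R : Type u} (m : Mono R) : List (Token R) :=
  Token.mono m.scalar :: m.vars.map Token.var

/-- The tokens of a polynomial. -/
def polyTokens {R : Type u} (f : Poly R) : List (Token R) :=
  Token.poly :: f.flatMap monoTokens

/-- The tokens of a system of polynomials; a further start of a polynomial marks the end. -/
def systemTokens {R : Type u} (F : List (Poly R)) : List (Token R) :=
  F.flatMap polyTokens ++ [Token.poly]

/-! ### Evaluation of a system along its tokens. -/

section Semantics

variable {R : Type u}

theorem systemTokens_getElem?_zero (F : List (Poly R)) :
    (systemTokens F)[0]? = some Token.poly := by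
  cases F <;> simp [systemTokens, polyTokens]

variable [CommRing R] {S : Type v} [CommRing S] [Algebra R S]

/-- The value of the current monomial and the sum of the preceding monomials of the current
polynomial, after reading a token. -/
def evalStep (x : ℕ → S) (s : S × S) : Token R → S × S
  | .poly => (0, 0)
  | .mono r => (algebraMap R S r, s.1 + s.2)
  | .var i => (s.1 * x i, s.2)

/-- Whenever a polynomial ends, its value is zero. -/
def Vanishes (x : ℕ → S) : S × S → List (Token R) → Prop
  | _, [] => True
  | s, .poly :: l => s.1 + s.2 = 0 ∧ Vanishes x (0, 0) l
  | s, t :: l => Vanishes x (evalStep x s t) l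

/-- Unfolds the recursion into one condition for every position, since the rows and columns of the
partial matrix refer to positions of tokens. -/
theorem vanishes_iff_getElem? (x : ℕ → S) (s : S × S) (l : List (Token R)) :
    Vanishes x s l ↔ ∀ n, l[n]? = some Token.poly →
      ((l.take n).foldl (evalStep x) s).1 + ((l.take n).foldl (evalStep x) s).2 = 0 := by
  induction l generalizing s with
  | nil => simp [Vanishes]
  | cons t l ih =>
    cases t with
    | poly =>
      rw [Vanishes, ih]
      constructor
      · rintro ⟨h0, h⟩ n hn
        cases n with
        | zero => simpa using h0
        | succ n => exact h n (by simpa using hn)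
      · intro h
        exact ⟨by simpa using h 0 (by simp), fun n hn => h (n + 1) (by simpa using hn)⟩
    | mono r =>
      rw [Vanishes, ih]
      · constructor
        · intro h n hn
          cases n with
          | zero => simp at hn
          | succ n => exact h n (by simpa using hn)
        · exact fun h n hn => h (n + 1) (by simpa using hn)
      · simp
    | var i =>
      rw [Vanishes, ih]
      · constructor
        · intro h n hn
          cases n with
          | zero => simp at hn
          | succ n => exact h n (by simpa using hn)
        · exact fun h n hn => h (n + 1) (by simpa using hn)
      · simp

theorem vanishes_vars (x : ℕ → S) (p s : S) (vars : List ℕ) (l : List (Token R)) :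
    Vanishes x (p, s) (vars.map Token.var ++ l) ↔ Vanishes x (p * (vars.map x).prod, s) l := by
  induction vars generalizing p with
  | nil => simp
  | cons i vars ih =>
    rw [List.map_cons, List.cons_append, Vanishes, evalStep, ih, List.map_cons, List.prod_cons,
      mul_assoc]
    simp

theorem aeval_toMvPolynomial (x : ℕ → S) (m : Mono R) :
    MvPolynomial.aeval x m.toMvPolynomial = algebraMap R S m.scalar * (m.vars.map x).prod := by
  rw [Mono.toMvPolynomial, map_mul, MvPolynomial.aeval_C, map_list_prod, List.map_map]
  congr 3
  funext i
  simp

/-- A `mono` token adds the finished monomial to the accumulated sum, so `s.1 + s.2` plus the value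
of the unread monomials is invariant, and this is what the next `poly` token tests. -/
theorem vanishes_monomials (x : ℕ → S) (s : S × S) (f : Poly R) (l : List (Token R)) :
    Vanishes x s (f.flatMap monoTokens ++ .poly :: l) ↔
      s.1 + s.2 + MvPolynomial.aeval x f.toMvPolynomial = 0 ∧ Vanishes x (0, 0) l := by
  induction f generalizing s with
  | nil => simp [Vanishes, Poly.toMvPolynomial]
  | cons m f ih =>
    rw [List.flatMap_cons, monoTokens, List.append_assoc, List.cons_append, Vanishes, evalStep,
      vanishes_vars, ih]
    · have h : MvPolynomial.aeval x (Poly.toMvPolynomial (m :: f)) =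
          algebraMap R S m.scalar * (m.vars.map x).prod +
            MvPolynomial.aeval x (Poly.toMvPolynomial f) := by
        rw [Poly.toMvPolynomial, List.map_cons, List.sum_cons, map_add, aeval_toMvPolynomial,
          Poly.toMvPolynomial]
      rw [h]
      have h' : algebraMap R S m.scalar * (m.vars.map x).prod + (s.1 + s.2) +
          MvPolynomial.aeval x (Poly.toMvPolynomial f) = s.1 + s.2 +
          (algebraMap R S m.scalar * (m.vars.map x).prod +
            MvPolynomial.aeval x (Poly.toMvPolynomial f)) := by ring
      rw [h']
    · simp

/-- The first `poly` token tests the state `(0, 0)`, every later one tests the polynomial before it,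
and the token added at the end tests the last polynomial. -/
theorem vanishes_systemTokens (x : ℕ → S) (F : List (Poly R)) :
    Vanishes x (0, 0) (systemTokens F) ↔
      ∀ f ∈ F, MvPolynomial.aeval x (Poly.toMvPolynomial f) = 0 := by
  have key : ∀ (f : Poly R) (F : List (Poly R)),
      Vanishes x (0, 0) (f.flatMap monoTokens ++ systemTokens F) ↔
        ∀ g ∈ f :: F, MvPolynomial.aeval x (Poly.toMvPolynomial g) = 0 := by
    intro f F
    induction F generalizing f with
    | nil =>
      rw [systemTokens, List.flatMap_nil, List.nil_append, vanishes_monomials]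
      simp [Vanishes]
    | cons g F ih =>
      have h : systemTokens (g :: F) = .poly :: (g.flatMap monoTokens ++ systemTokens F) := by
        simp [systemTokens, polyTokens]
      rw [h, vanishes_monomials, ih]
      simp
  cases F with
  | nil => simp [systemTokens, Vanishes]
  | cons f F =>
    have h : systemTokens (f :: F) = .poly :: (f.flatMap monoTokens ++ systemTokens F) := by
      simp [systemTokens, polyTokens]
    rw [h, Vanishes, key]
    simp

end Semantics

/-! ### The partial matrix of a list of tokens -/

/-- The kinds of tokens. -/
inductive Kind : Type
  | poly | mono | var

/-- The rows and columns of the identity block. -/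
inductive Lab : Type
  | mul | tie | cur | acc
  deriving DecidableEq

instance : Fintype Lab where
  elems := {.mul, .tie, .cur, .acc}
  complete x := by cases x <;> decide

theorem card_lab : Fintype.card Lab = 4 := rfl

/-- The rows that belong to a token. -/
inductive RowType : Type
  | tie | mul | out | sum

/-- The columns that belong to a token. -/
inductive ColType : Type
  | fac | state

/-- The position of the token of a column relative to the token of a row. -/
inductive Rel : Type
  | far | same | prev

/-- The possible entries of the partial matrix: free, zero, one, or the scalar of the token to which
the column belongs. -/
inductive Code : Type
  | star | zero | one | scalar

/-- The entries of the rows of the identity block. -/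
def headCode : Lab → Kind → ColType → Code
  -- In the order `mul`, `tie`, `cur`, `acc`, the intended columns are `(x, 1, cur * x, 0)` for the
  -- `fac` of a variable and `(1, 1, cur, acc)` for `state`. The `fac` columns of other tokens are
  -- zero and serve uniformity only.
  | .mul, .var, .fac => .star
  | .tie, .var, .fac => .one
  | .cur, .var, .fac => .star
  | _, _, .fac => .zero
  | .mul, _, .state => .one
  | .tie, _, .state => .one
  | _, .poly, .state => .zero
  | .cur, .mono, .state => .scalar
  | _, _, .state => .star

/-- The entries of the columns of the identity block. -/
def sideCode : Kind → RowType → Lab → Code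
  -- With `*` for the unknown, the rows of a variable are `(1, *, 0, 0)`, `(*, 0, 1, 0)`, `(0, *, 1,
  -- 0)`, `(0, *, 0, 1)`. Other tokens have the `sum` row `(0, *, 1, 1)` and three zero rows, so
  -- that all tokens have four rows.
  | .var, .tie, .mul => .one
  | .var, .tie, .tie => .star
  | .var, .mul, .mul => .star
  | .var, .mul, .cur => .one
  | .var, .out, .tie => .star
  | .var, .out, .cur => .one
  | .var, .sum, .tie => .star
  | .var, .sum, .acc => .one
  | _, .sum, .mul => .zero
  | .var, .sum, _ => .zero
  | _, .sum, .tie => .star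
  | _, .sum, _ => .one
  | _, _, _ => .zero

/-- The entries outside the rows and columns of the identity block. The last argument tells whether
both tokens are the same variable. -/
def innerCode : Kind → RowType → Kind → ColType → Rel → Bool → Code
  -- Two prescribed products in a row eliminate its unknown. The `tie` rows make the values of one
  -- variable agree, `mul` multiplies the preceding `cur` by the variable, and `out` copies the
  -- product to the `state` column. A `sum` row keeps `acc` at a variable, adds the preceding `cur`
  -- to it at a monomial (its own scalar appears on both sides and cancels), and requires `cur + acc
  -- = 0` at the start of a polynomial.
  | .var, .tie, .var, .fac, _, true => .zero
  | .var, .mul, _, .fac, .same, _ => .zero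
  | .var, .mul, _, .state, .prev, _ => .zero
  | .var, .out, _, .fac, .same, _ => .zero
  | .var, .out, _, .state, .same, _ => .zero
  | .mono, .sum, _, .state, .same, _ => .scalar
  | _, .sum, _, .state, .same, _ => .zero
  | _, .sum, _, .state, .prev, _ => .zero
  | _, _, _, _, _, _ => .star

/-- A free entry in a column of the identity block is the only one of its row, and it is controlled
by a column of the same token or, for the product rows of variables, by the preceding token. -/
theorem sideCode_star (k : Kind) (y : RowType) : ∃ x₀, (∀ x, x ≠ x₀ → sideCode k y x ≠ .star) ∧
    (sideCode k y x₀ = .star →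
      (∃ z, headCode x₀ k z = .one ∧
        ∀ b, (k = .var → b = true) → innerCode k y k z .same b ≠ .star) ∨
      (k = .var ∧ y = .mul ∧ x₀ = .mul)) := by
  by_cases h : k = .var ∧ y = .mul
  · obtain ⟨rfl, rfl⟩ := h
    exact ⟨.mul, fun x hx => by cases x <;> simp_all [sideCode], fun _ => by simp⟩
  · refine ⟨.tie, fun x hx => ?_, fun h' => Or.inl ?_⟩
    · cases k <;> cases y <;> cases x <;> simp_all [sideCode]
    · by_cases h2 : k = .var ∧ y = .tie
      · obtain ⟨rfl, rfl⟩ := h2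
        exact ⟨.fac, rfl, fun b hb => by rw [hb rfl]; simp [innerCode]⟩
      · refine ⟨.state, by cases k <;> rfl, fun b _ => ?_⟩
        cases k <;> cases y <;> simp_all [innerCode, sideCode]

/-- A row of the partial matrix, for tokens together with their positions. -/
inductive Row (R : Type u) : Type u
  | base (l : Lab) : Row R
  | tok (t : Token R) (n : ℕ) (y : RowType) : Row R

/-- A column of the partial matrix, for tokens together with their positions. -/
inductive Col (R : Type u) : Type u
  | base (l : Lab) : Col R
  | tok (t : Token R) (n : ℕ) (y : ColType) : Col R

section Matrix

variable {R : Type u}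

/-- The kind of a token. -/
def Token.kind : Token R → Kind
  | .poly => .poly
  | .mono _ => .mono
  | .var _ => .var

/-- Whether two tokens are the same variable. -/
def Token.sameVar : Token R → Token R → Bool
  | .var i, .var j => i == j
  | _, _ => false

/-- The relative position of the token number `m` to the token number `n`. -/
def relation (n m : ℕ) : Rel :=
  if m = n then .same else if m + 1 = n then .prev else .far

/-- The entries of the partial matrix, as codes. -/
def cellCode : Row R → Col R → Code
  | .base l, .base l' => if l = l' then .one else .zero
  | .base l, .tok t _ y => headCode l t.kind y
  | .tok t _ y, .base l => sideCode t.kind y l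
  | .tok t n y, .tok t' m y' => innerCode t.kind y t'.kind y' (relation n m) (t.sameVar t')

/-- The scalar of the token of a column. -/
def Col.scalar [Zero R] : Col R → R
  | .tok (.mono r) _ _ => r
  | _ => 0

/-- The meaning of a code in a column. -/
def Code.value [Zero R] [One R] (c : Col R) : Code → Option R
  | .star => none
  | .zero => some 0
  | .one => some 1
  | .scalar => some c.scalar

/-- The entries of the partial matrix. -/
def cell [Zero R] [One R] (r : Row R) (c : Col R) : Option R := (cellCode r c).value c

/-- The rows of the partial matrix of a list of tokens. -/
def rows (l : List (Token R)) : List (Row R) :=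
  [.base .mul, .base .tie, .base .cur, .base .acc] ++ l.zipIdx.flatMap fun t =>
    [.tok t.1 t.2 .tie, .tok t.1 t.2 .mul, .tok t.1 t.2 .out, .tok t.1 t.2 .sum]

/-- The columns of the partial matrix of a list of tokens. -/
def cols (l : List (Token R)) : List (Col R) :=
  [.base .mul, .base .tie, .base .cur, .base .acc] ++ l.zipIdx.flatMap fun t =>
    [.tok t.1 t.2 .fac, .tok t.1 t.2 .state]

/-- The partial matrix of a list of tokens. -/
def tokenMatrix [Zero R] [One R] (l : List (Token R)) (i : Fin (rows l).length)
    (j : Fin (cols l).length) : Option R :=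
  cell (rows l)[i] (cols l)[j]

theorem base_mem_rows (l : List (Token R)) (x : Lab) : Row.base x ∈ rows l := by
  cases x <;> simp [rows]

theorem base_mem_cols (l : List (Token R)) (x : Lab) : Col.base x ∈ cols l := by
  cases x <;> simp [cols]

theorem tok_mem_rows {l : List (Token R)} {t : Token R} {n : ℕ} {y : RowType} :
    Row.tok t n y ∈ rows l ↔ l[n]? = some t := by
  rw [← List.mk_mem_zipIdx_iff_getElem?]
  simp only [rows, List.mem_append, List.mem_flatMap]
  constructor
  · rintro (h | ⟨⟨t', n'⟩, h, h'⟩)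
    · simp at h
    · simp only [List.mem_cons, Row.tok.injEq, List.not_mem_nil, or_false] at h'
      obtain ⟨rfl, rfl, -⟩ | ⟨rfl, rfl, -⟩ | ⟨rfl, rfl, -⟩ | ⟨rfl, rfl, -⟩ := h' <;> exact h
  · intro h
    exact Or.inr ⟨_, h, by cases y <;> simp⟩

theorem tok_mem_cols {l : List (Token R)} {t : Token R} {n : ℕ} {y : ColType} :
    Col.tok t n y ∈ cols l ↔ l[n]? = some t := by
  rw [← List.mk_mem_zipIdx_iff_getElem?]
  simp only [cols, List.mem_append, List.mem_flatMap]
  constructor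
  · rintro (h | ⟨⟨t', n'⟩, h, h'⟩)
    · simp at h
    · simp only [List.mem_cons, Col.tok.injEq, List.not_mem_nil, or_false] at h'
      obtain ⟨rfl, rfl, -⟩ | ⟨rfl, rfl, -⟩ := h' <;> exact h
  · intro h
    exact Or.inr ⟨_, h, by cases y <;> simp⟩

/-- The position of a row. -/
noncomputable def rowIndex (l : List (Token R)) (r : Row R) (h : r ∈ rows l) :
    Fin (rows l).length := (List.mem_iff_get.1 h).choose

theorem rows_rowIndex {l : List (Token R)} {r : Row R} (h : r ∈ rows l) :
    (rows l)[rowIndex l r h] = r := (List.mem_iff_get.1 h).choose_spec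

/-- The position of a column. -/
noncomputable def colIndex (l : List (Token R)) (c : Col R) (h : c ∈ cols l) :
    Fin (cols l).length := (List.mem_iff_get.1 h).choose

theorem cols_colIndex {l : List (Token R)} {c : Col R} (h : c ∈ cols l) :
    (cols l)[colIndex l c h] = c := (List.mem_iff_get.1 h).choose_spec

/-- The position of a row of the identity block. -/
noncomputable def baseRow (l : List (Token R)) (x : Lab) : Fin (rows l).length :=
  rowIndex l _ (base_mem_rows l x)

/-- The position of a column of the identity block. -/
noncomputable def baseCol (l : List (Token R)) (x : Lab) : Fin (cols l).length :=
  colIndex l _ (base_mem_cols l x)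

variable [CommRing R]

/-- A row has at most one unknown coordinate, and some column with a `1` in that coordinate has a
prescribed product with the row. For the `mul` row of a variable this is the `state` column of the
preceding token, which exists because the first token is `poly`. -/
theorem tokenMatrix_rigid [Nontrivial R] {l : List (Token R)} (hl : l[0]? = some Token.poly) :
    IsRigid (tokenMatrix l) (baseRow l) (baseCol l) := by
  have hcell : ∀ i x, tokenMatrix l i (baseCol l x) = cell (rows l)[i] (.base x) := by
    intro i x
    rw [tokenMatrix, baseCol, cols_colIndex]
  have hhead : ∀ x c (hc : c ∈ cols l), tokenMatrix l (baseRow l x) (colIndex l c hc) =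
      cell (.base x) c := by
    intro x c hc
    rw [tokenMatrix, baseRow, rows_rowIndex, cols_colIndex]
  have hcol : ∀ i c (hc : c ∈ cols l), tokenMatrix l i (colIndex l c hc) =
      cell (rows l)[i] c := by
    intro i c hc
    rw [tokenMatrix, cols_colIndex]
  constructor
  · intro x x'
    rw [hcell, baseRow, rows_rowIndex]
    simp only [cell, cellCode]
    split_ifs <;> rfl
  · intro i
    have hmem : (rows l)[i] ∈ rows l := List.getElem_mem _
    simp only [hcell]
    have hfin : ∀ c (hc : c ∈ cols l) (x : Lab), cell (Row.base x) c = some (1 : R) →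
        cell (rows l)[i] c ≠ none → ∃ j r, tokenMatrix l (baseRow l x) j = some r ∧ r ≠ 0 ∧
          tokenMatrix l i j ≠ none := by
      intro c hc x h1 h2
      exact ⟨colIndex l c hc, 1, by rw [hhead, h1], one_ne_zero, by rw [hcol]; exact h2⟩
    generalize (rows l)[i] = r at hmem hfin ⊢
    cases r with
    | base x =>
      refine ⟨x, fun y hy => ?_, fun h => ?_⟩
      · simp [cell, cellCode, hy.symm, Code.value]
      · simp [cell, cellCode, Code.value] at h
    | tok t n y =>
      rw [tok_mem_rows] at hmem
      have hval : ∀ (c : Col R) (d : Code), d.value c = none ↔ d = .star := by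
        rintro c (_ | _ | _ | _) <;> simp [Code.value]
      obtain ⟨x₀, h₀, h₁⟩ := sideCode_star t.kind y
      refine ⟨x₀, fun x hx h => h₀ x hx ((hval _ _).1 h), fun h => ?_⟩
      obtain ⟨z, hz, hz'⟩ | ⟨hk, rfl, rfl⟩ := h₁ ((hval _ _).1 h)
      · refine hfin (.tok t n z) (tok_mem_cols.2 hmem) x₀ ?_ ?_
        · simp [cell, cellCode, hz, Code.value]
        · rw [ne_eq, cell, hval, cellCode, relation, if_pos rfl]
          refine hz' _ fun hk => ?_
          cases t <;> simp_all [Token.kind, Token.sameVar]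
      · have hpos : n ≠ 0 := by
          rintro rfl
          rw [hl] at hmem
          cases hmem
          cases hk
        obtain ⟨m, rfl⟩ := Nat.exists_eq_succ_of_ne_zero hpos
        have hlen : m < l.length := by
          have := (List.getElem?_eq_some_iff.1 hmem).1
          omega
        refine hfin (.tok l[m] m .state) (tok_mem_cols.2 (by simp [hlen])) _ ?_ ?_
        · cases h' : l[m].kind <;> simp [cell, cellCode, headCode, Code.value, h']
        · simp [cell, cellCode, innerCode, Code.value, relation, hk]

end Matrix

end TensorRankReduction

namespace TensorRankReduction

/-! ### Completions of the token matrix and common zeros. -/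

section Completion

variable {R : Type u} [CommRing R] {S : Type v} [CommRing S] [Algebra R S]

theorem sum_lab (g : Lab → S) : ∑ x, g x = g .mul + g .tie + g .cur + g .acc := by
  have h : (Finset.univ : Finset Lab) = {.mul, .tie, .cur, .acc} := rfl
  rw [h, Finset.sum_insert (by decide), Finset.sum_insert (by decide),
    Finset.sum_insert (by decide), Finset.sum_singleton]
  ring

/-- The state before the token number `n`. -/
def stateAt (x : ℕ → S) (l : List (Token R)) (n : ℕ) : S × S :=
  (l.take n).foldl (evalStep x) (0, 0)

theorem stateAt_succ (x : ℕ → S) {l : List (Token R)} {n : ℕ} {t : Token R}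
    (h : l[n]? = some t) : stateAt x l (n + 1) = evalStep x (stateAt x l n) t := by
  obtain ⟨hn, rfl⟩ := List.getElem?_eq_some_iff.1 h
  rw [stateAt, List.take_add_one, List.getElem?_eq_getElem hn, Option.toList_some,
    List.foldl_append]
  rfl

/-- The entries in the rows of the identity block of the completion that belongs to a zero of the
system. -/
def headValue (x : ℕ → S) (l : List (Token R)) (y : Lab) : Col R → S
  | .base y' => if y = y' then 1 else 0
  | .tok t n .state =>
    match y with
    | .mul => 1
    | .tie => 1
    | .cur => (evalStep x (stateAt x l n) t).1
    | .acc => (evalStep x (stateAt x l n) t).2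
  | .tok (.var i) n .fac =>
    match y with
    | .mul => x i
    | .tie => 1
    | .cur => (stateAt x l n).1 * x i
    | .acc => 0
  | .tok _ _ .fac => 0

/-- The entries in the columns of the identity block of the completion that belongs to a zero of the
system. -/
def sideValue (x : ℕ → S) (l : List (Token R)) (y : Lab) : Row R → S
  | .base y' => if y' = y then 1 else 0
  | .tok (.var i) n z =>
    match z, y with
    | .tie, .mul => 1
    | .tie, .tie => -x i
    | .mul, .mul => -(stateAt x l n).1
    | .mul, .cur => 1
    | .out, .tie => -((stateAt x l n).1 * x i)
    | .out, .cur => 1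
    | .sum, .tie => -(stateAt x l n).2
    | .sum, .acc => 1
    | _, _ => 0
  | .tok _ n .sum =>
    match y with
    | .mul => 0
    | .tie => -((stateAt x l n).1 + (stateAt x l n).2)
    | .cur => 1
    | .acc => 1
  | .tok _ _ _ => 0

theorem headValue_of_cell (x : ℕ → S) (l : List (Token R)) (y : Lab) (c : Col R) :
    ∀ r, cell (.base y) c = some r → headValue x l y c = algebraMap R S r := by
  cases c with
  | base y' =>
    simp only [cell, cellCode, headValue]
    split_ifs <;> simp [Code.value]
  | tok t n z =>
    cases z <;> cases t <;> cases y <;>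
      simp [cell, cellCode, Token.kind, headCode, Code.value, headValue, evalStep, Col.scalar]

theorem sideValue_of_cell (x : ℕ → S) (l : List (Token R)) (y : Lab) (t : Row R) :
    ∀ r, cell t (.base y) = some r → sideValue x l y t = algebraMap R S r := by
  cases t with
  | base y' =>
    simp only [cell, cellCode, sideValue]
    split_ifs <;> simp [Code.value]
  | tok t n z =>
    cases z <;> cases t <;> cases y <;>
      simp [cell, cellCode, Token.kind, sideCode, Code.value, sideValue]

theorem relation_same {n m : ℕ} (h : relation n m = .same) : m = n := by
  unfold relation at h
  split_ifs at h with h1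
  exact h1

theorem relation_prev {n m : ℕ} (h : relation n m = .prev) : m + 1 = n := by
  unfold relation at h
  split_ifs at h with h1 h2
  exact h2

/-- Each prescribed entry outside the block is one of the relations that hold along the evaluation.
Only the `sum` row of a `poly` token uses that the polynomials vanish, at its own `state` column. -/
theorem inner_of_cell {x : ℕ → S} {l : List (Token R)} (hx : Vanishes x (0, 0) l)
    {t t' : Token R} {n m : ℕ} (ht : l[n]? = some t) (ht' : l[m]? = some t') (z : RowType)
    (z' : ColType) : ∀ r, cell (.tok t n z) (.tok t' m z') = some r →
    ∑ y, sideValue x l y (.tok t n z) * headValue x l y (.tok t' m z') = algebraMap R S r := by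
  have hsame : relation n m = .same → m = n ∧ t' = t := by
    intro h
    have := relation_same h
    subst this
    rw [ht] at ht'
    exact ⟨rfl, (Option.some.inj ht').symm⟩
  have hprev : relation n m = .prev → evalStep x (stateAt x l m) t' = stateAt x l n := by
    intro h
    have := relation_prev h
    subst this
    rw [stateAt_succ x ht']
  have hpoly : t = .poly → (stateAt x l n).1 + (stateAt x l n).2 = 0 := by
    rintro rfl
    exact (vanishes_iff_getElem? x (0, 0) l).1 hx n ht
  have hvar : ∀ i j, (Token.var i : Token R).sameVar (.var j) = true → i = j := by
    intro i j h
    simpa [Token.sameVar] using h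
  have htie : ∀ i j, t = .var i → t' = .var j → ∀ b, t.sameVar t' = b → ∀ r,
      (innerCode .var .tie .var .fac (relation n m) b).value (Col.tok t' m .fac) = some r →
      x j - x i = algebraMap R S r := by
    rintro i j rfl rfl (_ | _) hb r
    · simp [innerCode, Code.value]
    · rw [hvar i j hb, sub_self]
      simp only [innerCode, Code.value, Option.some.injEq]
      rintro rfl
      rw [map_zero]
  rw [sum_lab]
  simp only [cell, cellCode]
  by_cases hfac : z = .tie ∧ z' = .fac
  · obtain ⟨rfl, rfl⟩ := hfac
    cases t with
    | poly => simp [Token.kind, innerCode, Code.value]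
    | mono r => simp [Token.kind, innerCode, Code.value]
    | var i =>
      cases t' with
      | poly => simp [Token.kind, innerCode, Code.value]
      | mono r => simp [Token.kind, innerCode, Code.value]
      | var j =>
        intro r h
        rw [← htie i j rfl rfl _ rfl r h]
        simp [sideValue, headValue, sub_eq_add_neg]
  · generalize relation n m = rel at *
    generalize t.sameVar t' = b
    cases rel with
    | far =>
      cases t <;> cases z <;> cases z' <;> simp_all [Token.kind, innerCode, Code.value]
    | same =>
      obtain ⟨rfl, rfl⟩ := hsame rfl
      clear hsame hprev htie hvar ht ht' hx
      cases t' <;> cases z <;> cases z' <;>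
        simp [Token.kind, innerCode, Code.value, sideValue, headValue, evalStep, Col.scalar] at *
      · linear_combination -hpoly
      · ring
    | prev =>
      have hp := hprev rfl
      clear hsame hprev htie hvar ht ht' hx
      cases t <;> cases z <;> cases z' <;>
        simp [Token.kind, innerCode, Code.value, sideValue, headValue, hp] at *

/-- A common zero of the system yields a completion of its partial matrix. -/
theorem exists_isFactoredCompletion_of_vanishes {x : ℕ → S} {l : List (Token R)}
    (hx : Vanishes x (0, 0) l) :
    ∃ Q : Fin (rows l).length → Fin (cols l).length → S,
      IsFactoredCompletion (tokenMatrix l) (baseRow l) (baseCol l) Q := by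
  let q : Row R → Col R → S := fun r c => ∑ y, sideValue x l y r * headValue x l y c
  have hside : ∀ r y, q r (.base y) = sideValue x l y r := by
    intro r y
    simp [q, headValue]
  have hhead : ∀ y c, q (.base y) c = headValue x l y c := by
    intro y c
    simp [q, sideValue]
  have hq : ∀ r ∈ rows l, ∀ c ∈ cols l, ∀ v, cell r c = some v → q r c = algebraMap R S v := by
    intro r hr c hc v hv
    cases r with
    | base y =>
      rw [hhead]
      exact headValue_of_cell x l y c v hv
    | tok t n z =>
      cases c with
      | base y =>
        rw [hside]
        exact sideValue_of_cell x l y _ v hv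
      | tok t' m z' =>
        exact inner_of_cell hx (tok_mem_rows.1 hr) (tok_mem_cols.1 hc) z z' v hv
  refine ⟨fun i j => q (rows l)[i] (cols l)[j], fun i j v hv => ?_, fun i j => ?_⟩
  · exact hq _ (List.getElem_mem _) _ (List.getElem_mem _) v hv
  · simp only [baseRow, baseCol, rows_rowIndex, cols_colIndex, hside, hhead]
    rfl

/-- A completion of the partial matrix of a system yields a common zero. -/
theorem exists_vanishes_of_isFactoredCompletion {l : List (Token R)}
    (hl : l[0]? = some Token.poly) {Q : Fin (rows l).length → Fin (cols l).length → S}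
    (hQ : IsFactoredCompletion (tokenMatrix l) (baseRow l) (baseCol l) Q) :
    ∃ x : ℕ → S, Vanishes x (0, 0) l := by
  classical
  -- The entries of `Q` by row and column instead of index; the value `0` outside the matrix plays
  -- no role.
  let q : Row R → Col R → S := fun r c =>
    if h : r ∈ rows l ∧ c ∈ cols l then Q (rowIndex l r h.1) (colIndex l c h.2) else 0
  have hq : ∀ r ∈ rows l, ∀ c ∈ cols l, ∀ v, cell r c = some v → q r c = algebraMap R S v := by
    intro r hr c hc v hv
    simp only [q, dif_pos (And.intro hr hc)]
    refine hQ.1 _ _ v ?_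
    rw [tokenMatrix, rows_rowIndex, cols_colIndex, hv]
  have hmul : ∀ r ∈ rows l, ∀ c ∈ cols l, q r c = q r (.base .mul) * q (.base .mul) c +
      q r (.base .tie) * q (.base .tie) c + q r (.base .cur) * q (.base .cur) c +
      q r (.base .acc) * q (.base .acc) c := by
    intro r hr c hc
    rw [← sum_lab (fun y => q r (.base y) * q (.base y) c)]
    simp only [q, dif_pos (And.intro hr hc), dif_pos (And.intro hr (base_mem_cols l _)),
      dif_pos (And.intro (base_mem_rows l _) hc)]
    exact hQ.2 _ _
  have hhead : ∀ {m t'}, l[m]? = some t' → ∀ y z', ∀ v,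
      (headCode y t'.kind z').value (.tok t' m z') = some v →
      q (.base y) (.tok t' m z') = algebraMap R S v := by
    intro m t' ht' y z' v hv
    exact hq _ (base_mem_rows l y) _ (tok_mem_cols.2 ht') v hv
  have hinner : ∀ {n t m t'}, l[n]? = some t → l[m]? = some t' → ∀ z z', ∀ v,
      (innerCode t.kind z t'.kind z' (relation n m) (t.sameVar t')).value (.tok t' m z') = some v →
      q (.tok t n z) (.base .mul) * q (.base .mul) (.tok t' m z') +
        q (.tok t n z) (.base .tie) * q (.base .tie) (.tok t' m z') +
        q (.tok t n z) (.base .cur) * q (.base .cur) (.tok t' m z') +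
        q (.tok t n z) (.base .acc) * q (.base .acc) (.tok t' m z') = algebraMap R S v := by
    intro n t m t' ht ht' z z' v hv
    rw [← hmul _ (tok_mem_rows.2 ht) _ (tok_mem_cols.2 ht')]
    exact hq _ (tok_mem_rows.2 ht) _ (tok_mem_cols.2 ht') v hv
  have hside : ∀ {n t}, l[n]? = some t → ∀ z y, ∀ v,
      (sideCode t.kind z y).value (.base y) = some v →
      q (.tok t n z) (.base y) = algebraMap R S v := by
    intro n t ht z y v hv
    exact hq _ (tok_mem_rows.2 ht) _ (base_mem_cols l y) v hv
  have hsame : ∀ n, relation n n = .same := fun n => if_pos rfl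
  have hprev : ∀ n, relation (n + 1) n = .prev := fun n => by simp [relation]
  let fac : ℕ → ℕ → S := fun i n => q (.base .mul) (.tok (.var i) n .fac)
  -- The `tie` row of the occurrence `n` is orthogonal to the `fac` columns of both occurrences, and
  -- its unknown cancels in the difference.
  have hfac : ∀ i n m, l[n]? = some (Token.var i) → l[m]? = some (Token.var i) → fac i n = fac i m := by
    intro i n m hn hm
    have h1 := hinner hn hn .tie .fac 0 (by simp [Token.kind, Token.sameVar, innerCode, Code.value])
    have h2 := hinner hn hm .tie .fac 0 (by simp [Token.kind, Token.sameVar, innerCode, Code.value])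
    rw [hhead hn .tie .fac 1 rfl, hside hn .tie .mul 1 rfl, hside hn .tie .cur 0 rfl,
      hside hn .tie .acc 0 rfl] at h1
    rw [hhead hm .tie .fac 1 rfl, hside hn .tie .mul 1 rfl, hside hn .tie .cur 0 rfl,
      hside hn .tie .acc 0 rfl] at h2
    simp only [map_one, map_zero] at h1 h2
    linear_combination h1 - h2
  -- Any occurrence may be chosen, by `hfac`; a variable that does not occur gets the value `0`.
  let x : ℕ → S := fun i => if h : ∃ n, l[n]? = some (Token.var i) then fac i h.choose else 0
  have hx : ∀ i n, l[n]? = some (Token.var i) → x i = fac i n := by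
    intro i n hn
    have h : ∃ n, l[n]? = some (Token.var i) := ⟨n, hn⟩
    simp only [x, dif_pos h]
    exact hfac i _ _ h.choose_spec hn
  -- By induction along the tokens, the `state` columns are forced to carry the evaluation at `x`,
  -- and each `poly` token forces its test.
  have hstate : ∀ n t, l[n]? = some t → stateAt x l (n + 1) =
      (q (.base .cur) (.tok t n .state), q (.base .acc) (.tok t n .state)) ∧
      (t = .poly → (stateAt x l n).1 + (stateAt x l n).2 = 0) := by
    intro n
    induction n with
    | zero =>
      intro t ht
      rw [hl] at ht
      obtain rfl := Option.some.inj ht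
      rw [stateAt_succ x hl, hhead hl .cur .state 0 rfl, hhead hl .acc .state 0 rfl]
      simp [evalStep, stateAt]
    | succ n ih =>
      intro t ht
      obtain ⟨hlt, -⟩ := List.getElem?_eq_some_iff.1 ht
      obtain ⟨p, hp⟩ : ∃ p, l[n]? = some p :=
        ⟨_, List.getElem?_eq_getElem (Nat.lt_of_succ_lt hlt)⟩
      have hpmul := hhead hp .mul .state 1 (by cases p <;> rfl)
      have hptie := hhead hp .tie .state 1 (by cases p <;> rfl)
      have htmul := hhead ht .mul .state 1 (by cases t <;> rfl)
      have httie := hhead ht .tie .state 1 (by cases t <;> rfl)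
      rw [stateAt_succ x ht, (ih p hp).1]
      cases t with
      | poly =>
        have h1 := hinner ht hp .sum .state 0 (by rw [hprev]; rfl)
        have h2 := hinner ht ht .sum .state 0 (by rw [hsame]; rfl)
        rw [hpmul, hptie, hside ht .sum .mul 0 rfl, hside ht .sum .cur 1 rfl,
          hside ht .sum .acc 1 rfl] at h1
        rw [htmul, httie, hside ht .sum .mul 0 rfl, hside ht .sum .cur 1 rfl,
          hside ht .sum .acc 1 rfl, hhead ht .cur .state 0 rfl, hhead ht .acc .state 0 rfl] at h2
        rw [hhead ht .cur .state 0 rfl, hhead ht .acc .state 0 rfl]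
        simp only [map_one, map_zero] at h1 h2 ⊢
        exact ⟨rfl, fun _ => by linear_combination h1 - h2⟩
      | mono r =>
        have h1 := hinner ht hp .sum .state 0 (by rw [hprev]; rfl)
        have h2 := hinner ht ht .sum .state r (by rw [hsame]; rfl)
        rw [hpmul, hptie, hside ht .sum .mul 0 rfl, hside ht .sum .cur 1 rfl,
          hside ht .sum .acc 1 rfl] at h1
        rw [htmul, httie, hside ht .sum .mul 0 rfl, hside ht .sum .cur 1 rfl,
          hside ht .sum .acc 1 rfl, hhead ht .cur .state r rfl] at h2
        rw [hhead ht .cur .state r rfl]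
        simp only [map_one, map_zero] at h1 h2 ⊢
        refine ⟨Prod.ext rfl ?_, nofun⟩
        simp only [evalStep]
        linear_combination h1 - h2
      | var i =>
        have h1 := hinner ht hp .sum .state 0 (by rw [hprev]; rfl)
        have h2 := hinner ht ht .sum .state 0 (by rw [hsame]; rfl)
        have h3 := hinner ht hp .mul .state 0 (by rw [hprev]; rfl)
        have h4 := hinner ht ht .mul .fac 0 (by rw [hsame]; rfl)
        have h5 := hinner ht ht .out .fac 0 (by rw [hsame]; rfl)
        have h6 := hinner ht ht .out .state 0 (by rw [hsame]; rfl)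
        rw [hpmul, hptie, hside ht .sum .mul 0 rfl, hside ht .sum .cur 0 rfl,
          hside ht .sum .acc 1 rfl] at h1
        rw [htmul, httie, hside ht .sum .mul 0 rfl, hside ht .sum .cur 0 rfl,
          hside ht .sum .acc 1 rfl] at h2
        rw [hpmul, hptie, hside ht .mul .tie 0 rfl, hside ht .mul .cur 1 rfl,
          hside ht .mul .acc 0 rfl] at h3
        rw [hhead ht .tie .fac 1 rfl, hhead ht .acc .fac 0 rfl, hside ht .mul .tie 0 rfl,
          hside ht .mul .cur 1 rfl, hside ht .mul .acc 0 rfl] at h4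
        rw [hhead ht .tie .fac 1 rfl, hhead ht .acc .fac 0 rfl, hside ht .out .mul 0 rfl,
          hside ht .out .cur 1 rfl, hside ht .out .acc 0 rfl] at h5
        rw [htmul, httie, hside ht .out .mul 0 rfl,
          hside ht .out .cur 1 rfl, hside ht .out .acc 0 rfl] at h6
        simp only [map_one, map_zero] at h1 h2 h3 h4 h5 h6 ⊢
        refine ⟨Prod.ext ?_ ?_, nofun⟩
        · simp only [evalStep]
          rw [hx i _ ht]
          simp only [fac]
          -- `h3` shows that the unknown of the `mul` row is minus the preceding `cur`. In `h4` this
          -- yields the product in the `fac` column, and `h5` and `h6` carry it to the `state`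
          -- column.
          linear_combination h3 * q (.base .mul) (.tok (.var i) (n + 1) .fac) - h4 + h5 - h6
        · simp only [evalStep]
          linear_combination h1 - h2
  exact ⟨x, (vanishes_iff_getElem? x (0, 0) l).2 fun n hn => (hstate n _ hn).2 rfl⟩

end Completion

end TensorRankReduction

namespace TensorRankReduction

/-! ### The reduction and its output as a string -/

section Reduction

variable {R : Type u} [CommRing R]

/-- The reduction from systems of polynomials to tensor rank. -/
def reduction (F : List (Poly R)) : Tensor3 R × ℕ :=
  (patternTensor (tokenMatrix (systemTokens F)),
    4 + (freePositions (tokenMatrix (systemTokens F))).card)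

theorem reduction_correct [IsDomain R] (F : List (Poly R)) {S : Type v} [CommRing S] [IsDomain S]
    [Algebra R S] (hinj : Function.Injective (algebraMap R S)) :
    HasCommonZero F S ↔ (reduction F).1.rank S ≤ (reduction F).2 := by
  have hl := systemTokens_getElem?_zero F
  have h := (tokenMatrix_rigid hl).rank_le_iff hinj
  rw [card_lab] at h
  rw [reduction, h]
  constructor
  · rintro ⟨x, hx⟩
    exact exists_isFactoredCompletion_of_vanishes ((vanishes_systemTokens x F).2 hx)
  · rintro ⟨Q, hQ⟩
    obtain ⟨x, hx⟩ := exists_vanishes_of_isFactoredCompletion hl hQ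
    exact ⟨x, (vanishes_systemTokens x F).1 hx⟩

end Reduction

/-! ### The string of the tensor, cell by cell. -/

section Blocks

variable {B : Type}

/-- The string of a cell, of which `n` cells precede and `m` cells follow: the string of its value,
and then as many copies of `zs` as there are other cells, with `os` or `zs` at its own position. -/
def blockString (zs os : List B) (c : Bool × List B) (n m : ℕ) : List B :=
  c.2 ++ (List.replicate n zs).flatten ++ (if c.1 then os else zs) ++
    (List.replicate m zs).flatten

/-- The strings of a list of cells, of which `n` cells precede and `m` cells follow. -/
def blockStrings (zs os : List B) : ℕ → ℕ → List (Bool × List B) → List B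
  | _, _, [] => []
  | n, m, c :: l => blockString zs os c n (m + l.length) ++ blockStrings zs os (n + 1) m l

theorem blockStrings_append (zs os : List B) (n m : ℕ) (l l' : List (Bool × List B)) :
    blockStrings zs os n m (l ++ l') =
      blockStrings zs os n (m + l'.length) l ++ blockStrings zs os (n + l.length) m l' := by
  induction l generalizing n with
  | nil => simp [blockStrings]
  | cons c l ih =>
    rw [List.cons_append, blockStrings, ih, blockStrings, List.append_assoc, List.length_append,
      List.length_cons]
    congr 2
    · omega
    · congr 1
      omega

theorem blockStrings_eq_flatMap (zs os : List B) (n m : ℕ) {b : ℕ} (g : Fin b → Bool × List B) :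
    blockStrings zs os n m ((List.finRange b).map g) =
      (List.finRange b).flatMap fun j => blockString zs os (g j) (n + j) (m + (b - 1 - j)) := by
  induction b generalizing n with
  | zero => rfl
  | succ b ih =>
    rw [List.finRange_succ, List.map_cons, blockStrings, List.flatMap_cons, List.map_map, ih,
      List.flatMap_map]
    simp only [List.length_map, List.length_finRange, Fin.val_zero, Fin.val_succ]
    congr 2
    funext j
    have h1 : n + 1 + j.val = n + (j.val + 1) := by omega
    have h2 : b - 1 - j.val = b + 1 - 1 - (j.val + 1) := by omega
    rw [h1, h2]
    rfl

/-- In row-major order the cell `(i, j)` has `i * b + j` predecessors, which is also the number of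
its slice, up to the shift by slice `0`. -/
theorem blockStrings_grid (zs os : List B) (n m : ℕ) {a b : ℕ} (g : Fin a → Fin b → Bool × List B) :
    blockStrings zs os n m ((List.finRange a).flatMap fun i => (List.finRange b).map (g i)) =
      (List.finRange a).flatMap fun i => (List.finRange b).flatMap fun j =>
        blockString zs os (g i j) (n + (i * b + j)) (m + (a * b - 1 - (i * b + j))) := by
  induction a generalizing n with
  | zero => rfl
  | succ a ih =>
    rw [List.finRange_succ, List.flatMap_cons, blockStrings_append, List.flatMap_cons,
      List.flatMap_map, List.flatMap_map, ih, blockStrings_eq_flatMap]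
    have hlen : ((List.finRange a).flatMap fun i => (List.finRange b).map (g i.succ)).length =
        a * b := by
      simp [List.length_flatMap]
    rw [hlen]
    congr 1
    · congr 1
      funext j
      have h2 : m + a * b + (b - 1 - j.val) =
          m + ((a + 1) * b - 1 - ((0 : Fin (a + 1)).val * b + j.val)) := by
        have := j.isLt
        rw [Nat.add_mul, Fin.val_zero, Nat.zero_mul]
        omega
      rw [h2]
      simp
    · congr 1
      funext i
      congr 1
      funext j
      have h1 : n + ((List.finRange b).map (g 0)).length + (i.val * b + j.val) =
          n + (i.succ.val * b + j.val) := by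
        rw [Fin.val_succ, Nat.add_mul, List.length_map, List.length_finRange]
        omega
      have h2 : m + (a * b - 1 - (i.val * b + j.val)) =
          m + ((a + 1) * b - 1 - (i.succ.val * b + j.val)) := by
        rw [Fin.val_succ, Nat.add_mul, Nat.add_mul]
        omega
      rw [h1, h2]

theorem flatMap_finRange_single {n m : ℕ} (zs os : List B) :
    ((List.finRange (n + 1 + m)).flatMap fun k => if k.val = n then os else zs) =
      (List.replicate n zs).flatten ++ os ++ (List.replicate m zs).flatten := by
  have hr : ∀ m, ((List.finRange m).flatMap fun _ => zs) = (List.replicate m zs).flatten := by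
    intro m
    rw [List.flatMap_def, List.map_const', List.length_finRange]
  induction n with
  | zero =>
    have h : 0 + 1 + m = m + 1 := by omega
    rw [h, List.finRange_succ, List.flatMap_cons, List.flatMap_map]
    simp [hr]
  | succ n ih =>
    have h : n + 1 + 1 + m = (n + 1 + m) + 1 := by omega
    rw [h, List.finRange_succ, List.flatMap_cons, List.flatMap_map]
    simp only [Fin.val_succ, Nat.add_right_cancel_iff, ih, Fin.val_zero, List.replicate_succ,
      List.flatten_cons]
    simp

end Blocks

section Output

variable {R : Type u} [CommRing R] {Γ : Type} (enc : Computability.Encoding R Γ)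

/-- The string of an entry of a tensor. -/
def entryString (r : R) : List (InstanceSymbol Γ) :=
  InstanceSymbol.entry :: (enc.encode r).map InstanceSymbol.letter

/-- Whether a cell is free, and the string of its value. -/
def cellData (r : Row R) (c : Col R) : Bool × List (InstanceSymbol Γ) :=
  ((cell r c).isNone, entryString enc ((cell r c).getD 0))

/-- All the cells of the partial matrix of a list of tokens. -/
def allCells (l : List (Token R)) : List (Bool × List (InstanceSymbol Γ)) :=
  (rows l).flatMap fun r => (cols l).map (cellData enc r)

/-- In the third direction a cell is its value followed by one entry for every cell of the matrix,
all of them zero except for a one at its own number if it is free. So the counts of cells before and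
after it determine the string. -/
theorem flatMap_patternEntry {a b : ℕ} (A : Fin a → Fin b → Option R) (i : Fin a) (j : Fin b) :
    ((List.finRange (a * b + 1)).flatMap fun k => entryString enc (patternEntry A i j k)) =
      blockString (entryString enc 0) (entryString enc 1)
        ((A i j).isNone, entryString enc ((A i j).getD 0)) (i * b + j)
        (a * b - 1 - (i * b + j)) := by
  have hlt := cell_index_lt i j
  generalize hN : i.val * b + j.val = N at hlt ⊢
  rw [List.finRange_succ, List.flatMap_cons, List.flatMap_map, blockString]
  simp only [List.append_assoc]
  congr 1
  have h1 : ∀ k : Fin (a * b), entryString enc (patternEntry A i j k.succ) =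
      if k.val = N then (if (A i j).isNone then entryString enc 1 else entryString enc 0)
      else entryString enc 0 := by
    intro k
    simp only [patternEntry, Fin.val_succ, Nat.add_one_ne_zero, if_false, hN,
      Nat.add_right_cancel_iff]
    split_ifs <;> simp_all
  simp only [h1]
  have h2 : a * b = N + 1 + (a * b - 1 - N) := by omega
  have h3 := flatMap_finRange_single (n := N) (m := a * b - 1 - N) (entryString enc 0)
    (if (A i j).isNone then entryString enc 1 else entryString enc 0)
  rw [← h2] at h3
  rw [h3]
  simp

theorem flatMap_finRange_getElem {α β : Type*} (l : List α) (f : α → List β) :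
    ((List.finRange l.length).flatMap fun i => f l[i]) = l.flatMap f := by
  conv_rhs => rw [← List.map_getElem_finRange l]
  rw [List.flatMap_map]
  rfl

theorem allCells_eq_grid (l : List (Token R)) :
    allCells enc l = (List.finRange (rows l).length).flatMap fun i =>
      (List.finRange (cols l).length).map fun j => cellData enc (rows l)[i] (cols l)[j] := by
  rw [allCells, ← flatMap_finRange_getElem]
  congr 1
  funext i
  conv_lhs => rw [← List.map_getElem_finRange (cols l)]
  rw [List.map_map]
  rfl

theorem encodeInstance_patternTensor (l : List (Token R)) (r : ℕ) :
    encodeInstance enc (patternTensor (tokenMatrix l), r) =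
      encodeUnary (rows l).length ++ (encodeUnary (cols l).length ++
        (encodeUnary ((rows l).length * (cols l).length + 1) ++ (encodeUnary r ++
          blockStrings (entryString enc 0) (entryString enc 1) 0 0 (allCells enc l)))) := by
  rw [allCells_eq_grid, blockStrings_grid, encodeInstance]
  simp only [List.append_assoc]
  congr 4
  change ((List.finRange (rows l).length).flatMap fun i =>
    (List.finRange (cols l).length).flatMap fun j =>
      (List.finRange ((rows l).length * (cols l).length + 1)).flatMap fun k =>
        entryString enc (patternEntry (tokenMatrix l) i j k)) = _
  congr 1
  funext i
  congr 1
  funext j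
  rw [flatMap_patternEntry]
  simp only [Nat.zero_add]
  rfl

/-- Lets the machine obtain the number by counting the free cells as it writes them. -/
theorem card_freePositions (l : List (Token R)) :
    (freePositions (tokenMatrix l)).card = (allCells enc l).countP Prod.fst := by
  have h1 : ∀ i, (List.countP Prod.fst ∘ fun i : Fin (rows l).length =>
      (List.finRange (cols l).length).map fun j => cellData enc (rows l)[i] (cols l)[j]) i =
      ∑ j, if (tokenMatrix l i j).isNone = true then 1 else 0 := by
    intro i
    rw [Function.comp_apply, List.countP_map, Fin.sum_univ_def]
    induction List.finRange (cols l).length with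
    | nil => rfl
    | cons j t ih =>
      rw [List.countP_cons, ih, List.map_cons, List.sum_cons, Nat.add_comm]
      rfl
  rw [allCells_eq_grid, List.countP_flatMap, funext h1, ← Fin.sum_univ_def, freePositions,
    Finset.card_filter, Fintype.sum_prod_type]

end Output

end TensorRankReduction

namespace TensorRankReduction

/-! ### Programs for the reduction: stacks and basic operations -/

/-- The work stacks. -/
inductive Stk : Type
  | todo | full | scan | tmp | rowPay | colPay | aux | diff | script | rels | after | before | free
  | numRows | numCols
  deriving DecidableEq

instance : Fintype Stk where
  elems := {.todo, .full, .scan, .tmp, .rowPay, .colPay, .aux, .diff, .script, .rels, .after,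
    .before, .free, .numRows, .numCols}
  complete x := by cases x <;> decide

/-- The contents of the work stacks. -/
structure Mem (A : Type) where
  /-- the input, and later the tokens whose rows have to be written, from right to left -/
  todo : List A
  /-- the whole system, from right to left -/
  full : List A
  /-- the tokens whose columns have to be written, from right to left -/
  scan : List A
  /-- a buffer -/
  tmp : List A
  /-- the payload of the token of the current row -/
  rowPay : List A
  /-- the payload of the token of the current column -/
  colPay : List A
  /-- a buffer -/
  aux : List A
  /-- one letter for every difference between two payloads -/
  diff : List A
  /-- the relative positions of the tokens of all columns to the token of the current row -/
  script : List A
  /-- the relative positions of the tokens of the remaining columns -/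
  rels : List A
  /-- the number of cells that have been written -/
  after : List A
  /-- the number of cells that have to be written -/
  before : List A
  /-- the number of free cells that have been written -/
  free : List A
  /-- the number of rows -/
  numRows : List A
  /-- the number of columns -/
  numCols : List A

namespace Mem

variable {A : Type}

/-- Look up a stack. -/
def get (s : Mem A) : Stk → List A
  | .todo => s.todo
  | .full => s.full
  | .scan => s.scan
  | .tmp => s.tmp
  | .rowPay => s.rowPay
  | .colPay => s.colPay
  | .aux => s.aux
  | .diff => s.diff
  | .script => s.script
  | .rels => s.rels
  | .after => s.after
  | .before => s.before
  | .free => s.free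
  | .numRows => s.numRows
  | .numCols => s.numCols

/-- Replace a stack. -/
def set (s : Mem A) (w : Stk) (l : List A) : Mem A :=
  match w with
  | .todo => { s with todo := l }
  | .full => { s with full := l }
  | .scan => { s with scan := l }
  | .tmp => { s with tmp := l }
  | .rowPay => { s with rowPay := l }
  | .colPay => { s with colPay := l }
  | .aux => { s with aux := l }
  | .diff => { s with diff := l }
  | .script => { s with script := l }
  | .rels => { s with rels := l }
  | .after => { s with after := l }
  | .before => { s with before := l }
  | .free => { s with free := l }
  | .numRows => { s with numRows := l }
  | .numCols => { s with numCols := l }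

/-- Reduces identities between memories to identities between iterated `Function.update`. -/
theorem get_injective : Function.Injective (get (A := A)) := by
  intro s s' h
  have h' := fun w => congrFun h w
  cases s
  cases s'
  congr 1
  exacts [h' .todo, h' .full, h' .scan, h' .tmp, h' .rowPay, h' .colPay, h' .aux, h' .diff,
    h' .script, h' .rels, h' .after, h' .before, h' .free, h' .numRows, h' .numCols]

theorem get_set (s : Mem A) (w : Stk) (l : List A) :
    (s.set w l).get = Function.update s.get w l := by
  funext w'
  by_cases h : w' = w
  · subst h
    rw [Function.update_self]
    cases w' <;> rfl
  · rw [Function.update_of_ne h]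
    cases w <;> cases w' <;> first | rfl | exact absurd rfl h

theorem get_set_self (s : Mem A) (w : Stk) (l : List A) : (s.set w l).get w = l := by
  rw [get_set, Function.update_self]

theorem get_set_of_ne (s : Mem A) {w w' : Stk} (l : List A) (h : w' ≠ w) :
    (s.set w l).get w' = s.get w' := by
  rw [get_set, Function.update_of_ne h]

theorem set_get (s : Mem A) (w : Stk) : s.set w (s.get w) = s :=
  get_injective (by rw [get_set, Function.update_eq_self])

theorem set_set (s : Mem A) (w : Stk) (l l' : List A) : (s.set w l).set w l' = s.set w l' :=
  get_injective (by simp only [get_set, Function.update_idem])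

theorem set_comm (s : Mem A) {w w' : Stk} (l l' : List A) (h : w ≠ w') :
    (s.set w l).set w' l' = (s.set w' l').set w l :=
  get_injective (by simp only [get_set, Function.update_comm h])

end Mem

section Exec

variable {A B : Type}

/-- A program runs from one memory and output to another in at most `n` steps. -/
def Exec (p : Prog Stk A B) (s : Mem A) (o : List B) (s' : Mem A) (o' : List B) (n : ℕ) : Prop :=
  Runs p s.get o s'.get o' n

variable {p q : Prog Stk A B} {s s₁ s₂ : Mem A} {o o₁ o₂ : List B} {n m : ℕ} {w : Stk}

theorem Exec.skip : Exec (.skip : Prog Stk A B) s o s o 1 := Runs.skip _ _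

theorem Exec.push (a : A) : Exec (.push w a) s o (s.set w (a :: s.get w)) o 1 := by
  rw [Exec, Mem.get_set]
  exact Runs.push _ _ _ _

theorem Exec.emit (b : B) : Exec (.emit b) s o s (b :: o) 1 := Runs.emit _ _ _

theorem Exec.seq (h : Exec p s o s₁ o₁ n) (h' : Exec q s₁ o₁ s₂ o₂ m) :
    Exec (.seq p q) s o s₂ o₂ (n + m) := Runs.seq h h'

theorem Exec.mono (h : Exec p s o s₁ o₁ n) (hnm : n ≤ m) : Exec p s o s₁ o₁ m := Runs.mono h hnm

theorem Exec.popNil {f : A → Prog Stk A B} (hw : s.get w = []) (h : Exec p s o s₁ o₁ n) :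
    Exec (.pop w p f) s o s₁ o₁ (n + 1) := Runs.popNil hw h

theorem Exec.popCons {f : A → Prog Stk A B} {a : A} {l : List A} (hw : s.get w = a :: l)
    (h : Exec (f a) (s.set w l) o s₁ o₁ n) : Exec (.pop w p f) s o s₁ o₁ (n + 1) := by
  rw [Exec, Mem.get_set] at h
  exact Runs.popCons hw h

theorem Exec.loopNil {f : A → Prog Stk A B} (hw : s.get w = []) : Exec (.loop w f) s o s o 1 :=
  Runs.loopNil hw

theorem Exec.loopCons {f : A → Prog Stk A B} {a : A} {l : List A} (hw : s.get w = a :: l)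
    (h : Exec (f a) (s.set w l) o s₁ o₁ n) (h' : Exec (.loop w f) s₁ o₁ s₂ o₂ m) :
    Exec (.loop w f) s o s₂ o₂ (n + m + 1) := by
  rw [Exec, Mem.get_set] at h
  exact Runs.loopCons hw h h'

/-- Write a string in front of the output. -/
def emitList : List B → Prog Stk A B
  | [] => .skip
  | b :: l => .seq (emitList l) (.emit b)

theorem exec_emitList (l : List B) :
    Exec (emitList l : Prog Stk A B) s o s (l ++ o) (l.length + 1) := by
  induction l with
  | nil => exact Exec.skip
  | cons b l ih => exact ih.seq (Exec.emit b)

/-- Empty a stack. -/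
def clear (w : Stk) : Prog Stk A B := .loop w fun _ => .skip

theorem exec_clear (w : Stk) :
    Exec (clear w : Prog Stk A B) s o (s.set w []) o (2 * (s.get w).length + 1) := by
  generalize hl : s.get w = l
  induction l generalizing s with
  | nil =>
    have h : s.set w [] = s := by rw [← hl, Mem.set_get]
    rw [h]
    exact Exec.loopNil hl
  | cons a l ih =>
    have h := ih (s := s.set w l) (Mem.get_set_self _ _ _)
    rw [Mem.set_set] at h
    exact (Exec.loopCons hl Exec.skip h).mono (by rw [List.length_cons]; omega)

/-- Move the contents of a stack to another stack, which reverses them. -/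
def move (w w' : Stk) : Prog Stk A B := .loop w fun a => .push w' a

theorem exec_move {w w' : Stk} (hw : w ≠ w') : Exec (move w w' : Prog Stk A B) s o
    ((s.set w' ((s.get w).reverse ++ s.get w')).set w []) o (2 * (s.get w).length + 1) := by
  generalize hl : s.get w = l
  induction l generalizing s with
  | nil =>
    have h : (s.set w' (([] : List A).reverse ++ s.get w')).set w [] = s := by
      rw [List.reverse_nil, List.nil_append, Mem.set_get, ← hl, Mem.set_get]
    rw [h]
    exact Exec.loopNil hl
  | cons a l ih =>
    have h1 := Exec.push (B := B) (w := w') (s := s.set w l) (o := o) a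
    rw [Mem.get_set_of_ne _ _ hw.symm] at h1
    have h2 := ih (s := (s.set w l).set w' (a :: s.get w'))
      (by rw [Mem.get_set_of_ne _ _ hw, Mem.get_set_self])
    rw [Mem.get_set_self] at h2
    have h3 : (((s.set w l).set w' (a :: s.get w')).set w' (l.reverse ++ a :: s.get w')).set w [] =
        (s.set w' ((a :: l).reverse ++ s.get w')).set w [] := by
      rw [Mem.set_set, Mem.set_comm s _ _ hw, Mem.set_set]
      simp
    rw [h3] at h2
    exact (Exec.loopCons hl h1 h2).mono (by rw [List.length_cons]; omega)

/-- Push the contents of a stack onto two other stacks, which reverses them. -/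
def fork (t w w' : Stk) : Prog Stk A B := .loop t fun a => .seq (.push w a) (.push w' a)

theorem exec_fork {t w w' : Stk} (htw : t ≠ w) (htw' : t ≠ w') (hww : w ≠ w') :
    Exec (fork t w w' : Prog Stk A B) s o
      (((s.set w ((s.get t).reverse ++ s.get w)).set w' ((s.get t).reverse ++ s.get w')).set t [])
      o (3 * (s.get t).length + 1) := by
  generalize hl : s.get t = l
  induction l generalizing s with
  | nil =>
    have h : ((s.set w (([] : List A).reverse ++ s.get w)).set w'
        (([] : List A).reverse ++ s.get w')).set t [] = s := by
      rw [List.reverse_nil, List.nil_append, List.nil_append, Mem.set_get, Mem.set_get, ← hl,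
        Mem.set_get]
    rw [h]
    exact Exec.loopNil hl
  | cons a l ih =>
    have h1 := (Exec.push (B := B) (w := w) (s := s.set t l) (o := o) a).seq (Exec.push (w := w') a)
    rw [Mem.get_set_of_ne _ _ hww.symm, Mem.get_set_of_ne _ _ htw.symm,
      Mem.get_set_of_ne _ _ htw'.symm] at h1
    have h2 := ih (s := ((s.set t l).set w (a :: s.get w)).set w' (a :: s.get w'))
      (by rw [Mem.get_set_of_ne _ _ htw', Mem.get_set_of_ne _ _ htw, Mem.get_set_self])
    rw [Mem.get_set_self, Mem.get_set_of_ne _ _ hww, Mem.get_set_self] at h2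
    have h3 : (((((s.set t l).set w (a :: s.get w)).set w' (a :: s.get w')).set w
        (l.reverse ++ a :: s.get w)).set w' (l.reverse ++ a :: s.get w')).set t [] =
        ((s.set w ((a :: l).reverse ++ s.get w)).set w' ((a :: l).reverse ++ s.get w')).set t [] := by
      rw [Mem.set_comm _ _ _ hww.symm, Mem.set_set, Mem.set_set, Mem.set_comm s _ _ htw,
        Mem.set_comm _ _ _ htw', Mem.set_set]
      simp
    rw [h3] at h2
    exact (Exec.loopCons hl h1 h2).mono (by rw [List.length_cons]; omega)

/-- Copy the contents of a stack onto another stack. -/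
def copy (w w' : Stk) : Prog Stk A B := .seq (move w .tmp) (fork .tmp w w')

theorem exec_copy {w w' : Stk} (hw : w ≠ .tmp) (hw' : w' ≠ .tmp) (hww : w ≠ w')
    (htmp : s.get .tmp = []) : Exec (copy w w' : Prog Stk A B) s o
      (s.set w' (s.get w ++ s.get w')) o (5 * (s.get w).length + 2) := by
  have h1 := exec_move (s := s) (B := B) (o := o) hw
  rw [htmp, List.append_nil] at h1
  have h2 := exec_fork (s := (s.set .tmp (s.get w).reverse).set w []) (B := B) (o := o)
    hw.symm hw'.symm hww
  rw [Mem.get_set_of_ne _ _ hw.symm, Mem.get_set_self, Mem.get_set_self,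
    Mem.get_set_of_ne _ _ hww.symm, Mem.get_set_of_ne _ _ hw', List.reverse_reverse,
    List.append_nil, List.length_reverse] at h2
  have h3 : ((((s.set .tmp (s.get w).reverse).set w []).set w (s.get w)).set w'
      (s.get w ++ s.get w')).set .tmp [] = s.set w' (s.get w ++ s.get w') := by
    rw [Mem.set_set, Mem.set_comm _ _ _ hw', Mem.set_comm _ _ _ hw, Mem.set_set, ← htmp,
      Mem.set_get, Mem.set_get]
  rw [h3] at h2
  exact (h1.seq h2).mono (by omega)

end Exec

end TensorRankReduction

namespace TensorRankReduction

/-! ### Writing the cells of a tensor from right to left -/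

section Emits

variable {A B : Type}

theorem Exec.congr {p : Prog Stk A B} {s s₁ s₂ : Mem A} {o o₁ o₂ : List B} {n m : ℕ}
    (h : Exec p s o s₁ o₁ n) (hs : s₁ = s₂) (ho : o₁ = o₂) (hnm : n ≤ m) :
    Exec p s o s₂ o₂ m := by
  subst hs ho
  exact h.mono hnm

/-- Write as many copies of a string as a stack has letters, while moving the stack. -/
def emitMany (w w' : Stk) (l : List B) : Prog Stk A B :=
  .loop w fun a => .seq (.push w' a) (emitList l)

theorem exec_emitMany {w w' : Stk} (hw : w ≠ w') (l : List B) {s : Mem A} {o : List B} :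
    Exec (emitMany w w' l) s o ((s.set w' ((s.get w).reverse ++ s.get w')).set w [])
      ((List.replicate (s.get w).length l).flatten ++ o)
      ((l.length + 3) * (s.get w).length + 1) := by
  generalize ht : s.get w = t
  induction t generalizing s o with
  | nil =>
    have h : (s.set w' (([] : List A).reverse ++ s.get w')).set w [] = s := by
      rw [List.reverse_nil, List.nil_append, Mem.set_get, ← ht, Mem.set_get]
    rw [h]
    exact Exec.loopNil ht
  | cons a t ih =>
    have h1 := (Exec.push (B := B) (w := w') (s := s.set w t) (o := o) a).seq (exec_emitList l)
    rw [Mem.get_set_of_ne _ _ hw.symm] at h1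
    have h2 := ih (s := (s.set w t).set w' (a :: s.get w')) (o := l ++ o)
      (by rw [Mem.get_set_of_ne _ _ hw, Mem.get_set_self])
    rw [Mem.get_set_self] at h2
    have h3 : (((s.set w t).set w' (a :: s.get w')).set w' (t.reverse ++ a :: s.get w')).set w [] =
        (s.set w' ((a :: t).reverse ++ s.get w')).set w [] := by
      rw [Mem.set_set, Mem.set_comm s _ _ hw, Mem.set_set]
      simp
    refine (Exec.loopCons ht h1 h2).congr h3 ?_ ?_
    · rw [List.length_cons, List.replicate_succ', List.flatten_append]
      simp
    · rw [List.length_cons, Nat.mul_add]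
      omega

/-- Write as many copies of a string as a stack has letters. -/
def repeatEmit (w : Stk) (l : List B) : Prog Stk A B := .seq (emitMany w .tmp l) (move .tmp w)

theorem exec_repeatEmit {w : Stk} (hw : w ≠ .tmp) (l : List B) {s : Mem A} {o : List B}
    (htmp : s.get .tmp = []) : Exec (repeatEmit w l) s o s
      ((List.replicate (s.get w).length l).flatten ++ o)
      ((l.length + 5) * (s.get w).length + 2) := by
  have h1 := exec_emitMany hw l (s := s) (o := o)
  rw [htmp, List.append_nil] at h1
  have h2 := exec_move (s := (s.set .tmp (s.get w).reverse).set w []) (B := B)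
    (o := (List.replicate (s.get w).length l).flatten ++ o) hw.symm
  rw [Mem.get_set_self, Mem.get_set_of_ne _ _ hw.symm, Mem.get_set_self, List.reverse_reverse,
    List.append_nil, List.length_reverse] at h2
  refine (h1.seq h2).congr ?_ rfl ?_
  · rw [Mem.set_set, Mem.set_comm _ _ _ hw, Mem.set_set, Mem.set_comm _ _ _ hw.symm, ← htmp,
      Mem.set_get, Mem.set_get]
  · rw [Nat.add_mul, Nat.add_mul]
    omega

/-- The stacks that are not counters of cells. -/
def Stk.quiet : Stk → Bool
  | .before => false
  | .after => false
  | .free => false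
  | _ => true

/-- Set the counters of cells. -/
def Mem.counters (s : Mem A) (a : A) (n m c : ℕ) : Mem A :=
  { s with
    before := List.replicate n a
    after := List.replicate m a
    free := List.replicate c a }

theorem Mem.get_counters (s : Mem A) (a : A) (n m c : ℕ) {w : Stk} (hw : w.quiet = true) :
    (s.counters a n m c).get w = s.get w := by
  cases w <;> first | rfl | exact absurd hw Bool.false_ne_true

theorem Mem.counters_set (s : Mem A) (a : A) (n m c : ℕ) {w : Stk} (hw : w.quiet = true)
    (l : List A) : (s.counters a n m c).set w l = (s.set w l).counters a n m c := by
  cases w <;> first | rfl | exact absurd hw Bool.false_ne_true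

variable (a : A) (zs os : List B) (M : ℕ)

/-- The program writes the strings of a list of cells and updates the counters, whenever the total
number of cells is `M`. -/
def Emits (p : Prog Stk A B) (s s' : Mem A) (cells : List (Bool × List B)) (k : ℕ) : Prop :=
  -- Here `n` cells are still unwritten at the end and `m` were written at the start. The fixed
  -- total `M` bounds both counters, hence the time for a cell.
  ∀ n m c o, n + cells.length + m = M →
    Exec p (s.counters a (n + cells.length) m c) o
      (s'.counters a n (m + cells.length) (c + cells.countP Prod.fst))
      (blockStrings zs os n m cells ++ o) k

variable {a zs os M} {p q : Prog Stk A B} {s s₁ s₂ : Mem A} {l l' : List (Bool × List B)} {j k : ℕ}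
  {w : Stk}

theorem Emits.mono (h : Emits a zs os M p s s₁ l k) (hk : k ≤ j) : Emits a zs os M p s s₁ l j :=
  fun n m c o e => (h n m c o e).mono hk

theorem Emits.quiet (h : ∀ n m c o, Exec p (s.counters a n m c) o (s₁.counters a n m c) o k) :
    Emits a zs os M p s s₁ [] k := fun n m c o _ => h n m c o

theorem Emits.push (hw : w.quiet = true) (b : A) :
    Emits a zs os M (.push w b) s (s.set w (b :: s.get w)) [] 1 := .quiet fun n m c o => by
  have h := Exec.push (B := B) (w := w) (s := s.counters a n m c) (o := o) b
  rwa [Mem.get_counters _ _ _ _ _ hw, Mem.counters_set _ _ _ _ _ hw] at h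

/-- The output grows to the left, so the cells written by the second program precede those of the
first. -/
theorem Emits.seq (h : Emits a zs os M p s s₁ l j) (h' : Emits a zs os M q s₁ s₂ l' k) :
    Emits a zs os M (.seq p q) s s₂ (l' ++ l) (j + k) := by
  intro n m c o e
  rw [List.length_append] at e
  have h1 := h (n + l'.length) m c o (by omega)
  have h2 := h' n (m + l.length) (c + l.countP Prod.fst)
    (blockStrings zs os (n + l'.length) m l ++ o) (by omega)
  rw [← List.append_assoc, ← blockStrings_append] at h2
  have h3 := h1.seq h2
  have e1 : n + l'.length + l.length = n + (l' ++ l).length := by rw [List.length_append]; omega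
  have e2 : m + l.length + l'.length = m + (l' ++ l).length := by rw [List.length_append]; omega
  have e3 : c + l.countP Prod.fst + l'.countP Prod.fst = c + (l' ++ l).countP Prod.fst := by
    rw [List.countP_append]; omega
  rwa [e1, e2, e3] at h3

theorem Emits.seq_quiet (h : Emits a zs os M p s s₁ l j) (h' : Emits a zs os M q s₁ s₂ [] k) :
    Emits a zs os M (.seq p q) s s₂ l (j + k) := h.seq h'

theorem Emits.quiet_seq (h : Emits a zs os M p s s₁ [] j) (h' : Emits a zs os M q s₁ s₂ l k) :
    Emits a zs os M (.seq p q) s s₂ l (j + k) := by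
  have h'' := h.seq h'
  rwa [List.append_nil] at h''

theorem Emits.popNil {f : A → Prog Stk A B} (hq : w.quiet = true) (hw : s.get w = [])
    (h : Emits a zs os M p s s₁ l k) : Emits a zs os M (.pop w p f) s s₁ l (k + 1) :=
  fun n m c o e => Exec.popNil (by rw [Mem.get_counters _ _ _ _ _ hq, hw]) (h n m c o e)

theorem Emits.popCons {f : A → Prog Stk A B} {b : A} {t : List A} (hq : w.quiet = true)
    (hw : s.get w = b :: t) (h : Emits a zs os M (f b) (s.set w t) s₁ l k) :
    Emits a zs os M (.pop w p f) s s₁ l (k + 1) :=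
  fun n m c o e => Exec.popCons ((Mem.get_counters _ _ _ _ _ hq).trans hw)
    (by rw [Mem.counters_set _ _ _ _ _ hq]; exact h n m c o e)

theorem Emits.loopNil {f : A → Prog Stk A B} (hq : w.quiet = true) (hw : s.get w = []) :
    Emits a zs os M (.loop w f) s s [] 1 :=
  .quiet fun _ _ _ _ => Exec.loopNil (by rw [Mem.get_counters _ _ _ _ _ hq, hw])

theorem Emits.loopCons {f : A → Prog Stk A B} {b : A} {t : List A} (hq : w.quiet = true)
    (hw : s.get w = b :: t) (h : Emits a zs os M (f b) (s.set w t) s₁ l j)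
    (h' : Emits a zs os M (.loop w f) s₁ s₂ l' k) :
    Emits a zs os M (.loop w f) s s₂ (l' ++ l) (j + k + 1) := by
  intro n m c o e
  rw [List.length_append] at e
  have h1 := h (n + l'.length) m c o (by omega)
  rw [← Mem.counters_set _ _ _ _ _ hq] at h1
  have h2 := h' n (m + l.length) (c + l.countP Prod.fst)
    (blockStrings zs os (n + l'.length) m l ++ o) (by omega)
  rw [← List.append_assoc, ← blockStrings_append] at h2
  have h3 := Exec.loopCons ((Mem.get_counters _ _ _ _ _ hq).trans hw) h1 h2
  have e1 : n + l'.length + l.length = n + (l' ++ l).length := by rw [List.length_append]; omega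
  have e2 : m + l.length + l'.length = m + (l' ++ l).length := by rw [List.length_append]; omega
  have e3 : c + l.countP Prod.fst + l'.countP Prod.fst = c + (l' ++ l).countP Prod.fst := by
    rw [List.countP_append]; omega
  rwa [e1, e2, e3] at h3

theorem Emits.clear (hq : w.quiet = true) :
    Emits a zs os M (clear w) s (s.set w []) [] (2 * (s.get w).length + 1) :=
  .quiet fun n m c o => by
    have h := exec_clear (B := B) (s := s.counters a n m c) (o := o) w
    rwa [Mem.get_counters _ _ _ _ _ hq, Mem.counters_set _ _ _ _ _ hq] at h

theorem Emits.copy {w' : Stk} (hq : w.quiet = true) (hq' : w'.quiet = true) (hw : w ≠ .tmp)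
    (hw' : w' ≠ .tmp) (hww : w ≠ w') (htmp : s.get .tmp = []) :
    Emits a zs os M (copy w w') s (s.set w' (s.get w ++ s.get w')) []
      (5 * (s.get w).length + 2) :=
  .quiet fun n m c o => by
    have h := exec_copy (B := B) (s := s.counters a n m c) (o := o) hw hw' hww
      ((Mem.get_counters _ _ _ _ _ rfl).trans htmp)
    rwa [Mem.get_counters _ _ _ _ _ hq, Mem.get_counters _ _ _ _ _ hq',
      Mem.counters_set _ _ _ _ _ hq'] at h

theorem Emits.congr (h : Emits a zs os M p s s₁ l j) (hs : s₁ = s₂) (hl : l = l') (hjk : j ≤ k) :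
    Emits a zs os M p s s₂ l' k := by
  subst hs hl
  exact h.mono hjk

end Emits

/-! ### Writing a single cell. -/

section Cells

variable {Γ : Type}

/-- The letters of a string of a system. -/
def letters (l : List (SystemSymbol Γ)) : List (InstanceSymbol Γ) :=
  l.flatMap fun
    | .letter γ => [.letter γ]
    | _ => []

/-- Write a letter, ignore other symbols. -/
def emitLetter : SystemSymbol Γ → Prog Stk (SystemSymbol Γ) (InstanceSymbol Γ)
  | .letter γ => .emit (.letter γ)
  | _ => .skip

theorem exec_emitLetter (x : SystemSymbol Γ) {s : Mem (SystemSymbol Γ)}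
    {o : List (InstanceSymbol Γ)} : Exec (emitLetter x) s o s (letters [x] ++ o) 1 := by
  cases x <;> first | exact Exec.skip | exact Exec.emit _

/-- Write the payload of the token of the current column as an entry of a tensor. -/
def emitPayload : Prog Stk (SystemSymbol Γ) (InstanceSymbol Γ) :=
  .seq (move .colPay .tmp) (.seq (.loop .tmp fun x => .seq (.push .colPay x) (emitLetter x))
    (.emit .entry))

theorem exec_emitPayload {s : Mem (SystemSymbol Γ)} {o : List (InstanceSymbol Γ)}
    (htmp : s.tmp = []) :
    Exec emitPayload s o s (.entry :: letters s.colPay ++ o) (5 * s.colPay.length + 3) := by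
  have key : ∀ (l : List (SystemSymbol Γ)) (r : List (SystemSymbol Γ))
      (o : List (InstanceSymbol Γ)), Exec
      (.loop .tmp fun x => .seq (.push .colPay x) (emitLetter x))
      { s with tmp := l, colPay := r } o { s with tmp := [], colPay := l.reverse ++ r }
      (letters l.reverse ++ o) (3 * l.length + 1) := by
    intro l
    induction l with
    | nil => exact fun r o => Exec.loopNil rfl
    | cons x l ih =>
      intro r o
      refine (Exec.loopCons rfl ((Exec.push x).seq (exec_emitLetter x))
        (ih (x :: r) (letters [x] ++ o))).congr ?_ ?_ ?_
      · simp
      · simp [letters]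
      · rw [List.length_cons]
        omega
  have h1 := exec_move (B := InstanceSymbol Γ) (s := s) (o := o) (w := .colPay) (w' := .tmp)
    (by decide)
  have h2 := key s.colPay.reverse [] o
  have e : (s.set .tmp ((s.get .colPay).reverse ++ s.get .tmp)).set .colPay [] =
      { s with tmp := s.colPay.reverse, colPay := [] } := by
    change { s with tmp := s.colPay.reverse ++ s.tmp, colPay := [] } = _
    rw [htmp, List.append_nil]
  rw [e] at h1
  refine (h1.seq (h2.seq (Exec.emit _))).congr ?_ ?_ ?_
  · cases s
    simp_all
  · simp
  · change 2 * s.colPay.length + 1 + _ ≤ _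
    rw [List.length_reverse]
    omega

variable (zs os : List (InstanceSymbol Γ))

/-- The string that a code stands for, in a column whose token has a given payload. -/
def Code.string (w : List (SystemSymbol Γ)) : Code → List (InstanceSymbol Γ)
  | .star => zs
  | .zero => zs
  | .one => os
  | .scalar => .entry :: letters w

/-- Whether a code stands for a free entry. -/
def Code.isStar : Code → Bool
  | .star => true
  | _ => false

/-- A cell of the tensor as it is written. -/
def codeData (w : List (SystemSymbol Γ)) (d : Code) : Bool × List (InstanceSymbol Γ) :=
  (d.isStar, d.string zs os w)

/-- Write the value of a cell. -/
def emitValue : Code → Prog Stk (SystemSymbol Γ) (InstanceSymbol Γ)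
  | .star => emitList zs
  | .zero => emitList zs
  | .one => emitList os
  | .scalar => emitPayload

/-- Write a cell. -/
def emitCell (d : Code) : Prog Stk (SystemSymbol Γ) (InstanceSymbol Γ) :=
  .seq (.pop .before .skip fun _ => .skip) <| .seq (repeatEmit .after zs) <|
  .seq (emitList (if d.isStar then os else zs)) <| .seq (repeatEmit .before zs) <|
  .seq (emitValue zs os d) <| .seq (.push .after .poly) <|
  if d.isStar then .push .free .poly else .skip

/-- A bound for the time to write a cell. -/
def cellCost (X : ℕ) : ℕ := (2 * (zs.length + os.length) + 20) * (X + 1)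

variable {zs os} {M X : ℕ} {s : Mem (SystemSymbol Γ)}

theorem exec_emitValue (d : Code) {o : List (InstanceSymbol Γ)} (htmp : s.tmp = []) :
    Exec (emitValue zs os d) s o s (d.string zs os s.colPay ++ o)
      (zs.length + os.length + 5 * s.colPay.length + 3) := by
  cases d with
  | star => exact (exec_emitList zs).mono (by omega)
  | zero => exact (exec_emitList zs).mono (by omega)
  | one => exact (exec_emitList os).mono (by omega)
  | scalar => exact (exec_emitPayload htmp).mono (by omega)

/-- The string of the cell is written backwards: entries for the `m` cells on its right, its own
entry, entries for the `n` cells on its left, then its value. The cell leaves `before` at the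
beginning and enters `after` at the end, so in between neither counter includes it. -/
theorem emits_emitCell (d : Code) (htmp : s.tmp = []) (hM : M ≤ X) (hX : s.colPay.length ≤ X) :
    Emits .poly zs os M (emitCell zs os d) s s [codeData zs os s.colPay d]
      (cellCost zs os X) := by
  intro n m c o e
  have h1 : Exec (.pop .before .skip fun _ => .skip) (s.counters .poly (n + 1) m c) o
      (s.counters .poly n m c) o 2 := Exec.popCons rfl Exec.skip
  have h2 := exec_repeatEmit (s := s.counters .poly n m c) (w := .after) (o := o) (by decide) zs
    htmp
  have h3 := exec_emitList (A := SystemSymbol Γ) (s := s.counters .poly n m c)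
    (o := (List.replicate ((s.counters .poly n m c).get .after).length zs).flatten ++ o)
    (if d.isStar then os else zs)
  have h4 := exec_repeatEmit (s := s.counters .poly n m c) (w := .before)
    (o := (if d.isStar then os else zs) ++
      ((List.replicate ((s.counters .poly n m c).get .after).length zs).flatten ++ o))
    (by decide) zs htmp
  have h5 := exec_emitValue (zs := zs) (os := os) (s := s.counters .poly n m c)
    (o := (List.replicate ((s.counters .poly n m c).get .before).length zs).flatten ++
      ((if d.isStar then os else zs) ++
      ((List.replicate ((s.counters .poly n m c).get .after).length zs).flatten ++ o))) d htmp
  have h6 := Exec.push (B := InstanceSymbol Γ) (w := .after) (s := s.counters .poly n m c)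
    (o := d.string zs os s.colPay ++
      ((List.replicate ((s.counters .poly n m c).get .before).length zs).flatten ++
      ((if d.isStar then os else zs) ++
      ((List.replicate ((s.counters .poly n m c).get .after).length zs).flatten ++ o))))
    SystemSymbol.poly
  have h7 : ∀ o : List (InstanceSymbol Γ), Exec (if d.isStar then .push .free .poly else .skip)
      (s.counters .poly n (m + 1) c) o
      (s.counters .poly n (m + 1) (c + if d.isStar then 1 else 0)) o 1 := by
    intro o
    cases d.isStar
    · exact Exec.skip
    · exact Exec.push _
  refine (h1.seq (h2.seq (h3.seq (h4.seq (h5.seq (h6.seq (h7 _))))))).congr ?_ ?_ ?_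
  · cases hd : d.isStar <;> simp [codeData, hd]
  · have e1 : ((s.counters .poly n m c).get .before).length = n := List.length_replicate
    have e2 : ((s.counters .poly n m c).get .after).length = m := List.length_replicate
    rw [e1, e2]
    simp [blockStrings, blockString, codeData]
    rfl
  · have e1 : ((s.counters .poly n m c).get .before).length = n := List.length_replicate
    have e2 : ((s.counters .poly n m c).get .after).length = m := List.length_replicate
    have e3 : (s.counters .poly n m c).colPay = s.colPay := rfl
    have e4 : (if d.isStar then os else zs).length ≤ zs.length + os.length := by
      split <;> omega
    rw [e1, e2, e3, cellCost]
    simp only [List.length_singleton] at e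
    have e5 : m + n ≤ X := by omega
    have e6 : (zs.length + 5) * m + (zs.length + 5) * n ≤ (zs.length + 5) * X := by
      rw [← Nat.mul_add]
      exact Nat.mul_le_mul_left _ e5
    nlinarith [Nat.zero_le (zs.length * X), Nat.zero_le (os.length * X)]

end Cells

end TensorRankReduction

namespace TensorRankReduction

/-! ### Comparing payloads -/

section Compare

variable {A B : Type} (a : A)

open Classical in
/-- Compare the payload of the row with the payload of the column, which is consumed. -/
noncomputable def comparePayloads : Prog Stk A B :=
  .seq (.loop .colPay fun y => .pop .rowPay (.push .diff a) fun x =>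
    .seq (.push .aux x) (if x = y then .skip else .push .diff a)) <|
  .seq (.loop .rowPay fun x => .seq (.push .aux x) (.push .diff a)) (move .aux .rowPay)

-- The loop consumes the column payload, shifts the letters it reads of the row payload to `aux`,
-- and records mismatched and missing letters in `diff`. The exact leftovers are irrelevant, as
-- `x'.reverse ++ z'` still determines the row payload.
open Classical in
theorem exec_compare_common (y x z d : List A) : ∃ x' z' d',
    (∀ (s : Mem A) (o : List B), Exec (.loop .colPay fun y => .pop .rowPay (.push .diff a) fun x =>
      .seq (.push .aux x) (if x = y then .skip else .push .diff a))
      { s with rowPay := x, colPay := y, aux := z, diff := d } o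
      { s with rowPay := x', colPay := [], aux := z', diff := d' } o (4 * y.length + 1)) ∧
    x'.reverse ++ z' = x.reverse ++ z ∧ (x' = [] ∧ d' = [] ↔ x = y ∧ d = []) ∧
    d'.length ≤ d.length + y.length := by
  induction y generalizing x z d with
  | nil => exact ⟨x, z, d, fun s o => Exec.loopNil rfl, rfl, Iff.rfl, Nat.le_refl _⟩
  | cons b y ih =>
    cases x with
    | nil =>
      obtain ⟨x', z', d', h1, h2, h3, h4⟩ := ih [] z (a :: d)
      refine ⟨x', z', d', fun s o =>
        (Exec.loopCons rfl (Exec.popNil rfl (Exec.push a)) (h1 s o)).mono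
        (by rw [List.length_cons]; omega), h2, by rw [h3]; simp, ?_⟩
      rw [List.length_cons] at h4 ⊢
      omega
    | cons c x =>
      by_cases hcb : c = b
      · obtain ⟨x', z', d', h1, h2, h3, h4⟩ := ih x (c :: z) d
        have h5 : ∀ (s : Mem A) (o : List B), Exec (if c = b then .skip else .push .diff a)
            { s with rowPay := x, colPay := y, aux := c :: z, diff := d } o
            { s with rowPay := x, colPay := y, aux := c :: z, diff := d } o 1 := by
          intro s o
          rw [if_pos hcb]
          exact Exec.skip
        refine ⟨x', z', d', fun s o =>
          (Exec.loopCons rfl (Exec.popCons rfl ((Exec.push c).seq (h5 s o))) (h1 s o)).mono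
          (by rw [List.length_cons]; omega), by rw [h2]; simp, by rw [h3, hcb]; simp, ?_⟩
        rw [List.length_cons]
        omega
      · obtain ⟨x', z', d', h1, h2, h3, h4⟩ := ih x (c :: z) (a :: d)
        have h5 : ∀ (s : Mem A) (o : List B), Exec (if c = b then .skip else .push .diff a)
            { s with rowPay := x, colPay := y, aux := c :: z, diff := d } o
            { s with rowPay := x, colPay := y, aux := c :: z, diff := a :: d } o 1 := by
          intro s o
          rw [if_neg hcb]
          exact Exec.push a
        refine ⟨x', z', d', fun s o =>
          (Exec.loopCons rfl (Exec.popCons rfl ((Exec.push c).seq (h5 s o))) (h1 s o)).mono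
          (by rw [List.length_cons]; omega), by rw [h2]; simp, by rw [h3]; simp [hcb], ?_⟩
        rw [List.length_cons] at h4 ⊢
        omega

theorem exec_compare_rest (x z d : List A) {s : Mem A} {o : List B} :
    Exec (.loop .rowPay fun x => .seq (.push .aux x) (.push .diff a))
      { s with rowPay := x, aux := z, diff := d } o
      { s with rowPay := [], aux := x.reverse ++ z, diff := List.replicate x.length a ++ d } o
      (3 * x.length + 1) := by
  induction x generalizing z d with
  | nil => exact Exec.loopNil rfl
  | cons b x ih =>
    refine (Exec.loopCons rfl ((Exec.push b).seq (Exec.push a)) (ih (b :: z) (a :: d))).congr ?_ rfl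
      (by rw [List.length_cons]; omega)
    rw [List.length_cons, List.replicate_succ', List.reverse_cons, List.append_assoc,
      List.append_assoc]
    rfl

/-- What is left of the row payload counts as a difference too, so `diff` stays empty exactly for
equal payloads. The row payload is rebuilt from `aux`, since it is compared with every column. -/
theorem exec_compare (x y : List A) : ∃ d : List A,
    (∀ (s : Mem A) (o : List B),
      Exec (comparePayloads a) { s with rowPay := x, colPay := y, aux := [], diff := [] } o
        { s with rowPay := x, colPay := [], aux := [], diff := d } o
        (4 * y.length + 5 * x.length + 3)) ∧
    (d = [] ↔ x = y) ∧ d.length ≤ x.length + y.length := by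
  obtain ⟨x', z', d', h1, h2, h3, h4⟩ := exec_compare_common (B := B) a y x [] []
  have hlen : x'.length + z'.length = x.length := by
    have := congrArg List.length h2
    simpa using this
  rw [List.append_nil] at h2
  refine ⟨List.replicate x'.length a ++ d', fun s o => ?_, ?_, ?_⟩
  · have h5 := exec_compare_rest (s := { s with colPay := [] }) (o := o) a x' z' d'
    rw [h2] at h5
    have h6 := exec_move (o := o) (w := .aux) (w' := .rowPay) (by decide)
      (s := { s with
        rowPay := [], colPay := [], aux := x.reverse, diff := List.replicate x'.length a ++ d' })
    refine ((h1 s o).seq (h5.seq h6)).congr ?_ rfl ?_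
    · change ({ s with
        rowPay := x.reverse.reverse ++ []
        colPay := []
        aux := []
        diff := List.replicate x'.length a ++ d' } : Mem A) = _
      rw [List.reverse_reverse, List.append_nil]
    · change 4 * y.length + 1 + (3 * x'.length + 1 + (2 * x.reverse.length + 1)) ≤ _
      rw [List.length_reverse]
      omega
  · rw [List.append_eq_nil_iff, List.replicate_eq_nil_iff, List.length_eq_zero_iff, h3]
    simp
  · rw [List.length_append, List.length_replicate]
    simp only [List.length_nil] at h4
    omega

end Compare

/-! ### The strings of tokens -/

section Tokens

variable {R : Type u} {Γ : Type} (enc : Computability.Encoding R Γ)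

/-- The marker of a token. -/
def Kind.marker : Kind → SystemSymbol Γ
  | .poly => .poly
  | .mono => .mono
  | .var => .var

/-- The part of the string of a token that follows its marker. -/
def Token.payload : Token R → List (SystemSymbol Γ)
  | .poly => []
  | .mono r => (enc.encode r).map SystemSymbol.letter
  | .var i => (Computability.encodeNat i).map SystemSymbol.bit

/-- The string of a token. -/
def Token.string (t : Token R) : List (SystemSymbol Γ) := t.kind.marker :: t.payload enc

/-- The string of a list of tokens. -/
def tokenString (l : List (Token R)) : List (SystemSymbol Γ) := l.flatMap (Token.string enc)

/-- Whether a symbol announces a token. -/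
def SystemSymbol.isMarker : SystemSymbol Γ → Bool
  | .poly => true
  | .mono => true
  | .var => true
  | _ => false

/-- The reason why markers separate the string of a system into tokens unambiguously. -/
theorem not_isMarker_of_mem_payload {t : Token R} {x : SystemSymbol Γ}
    (hx : x ∈ t.payload enc) : x.isMarker = false := by
  cases t with
  | poly => exact absurd hx List.not_mem_nil
  | mono r =>
    obtain ⟨γ, -, rfl⟩ := List.mem_map.1 hx
    rfl
  | var i =>
    obtain ⟨b, -, rfl⟩ := List.mem_map.1 hx
    rfl

theorem letters_map_letter (l : List Γ) :
    letters (l.map SystemSymbol.letter) = l.map InstanceSymbol.letter := by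
  induction l with
  | nil => rfl
  | cons γ l ih =>
    rw [List.map_cons, List.map_cons, ← ih]
    rfl

theorem tokenString_reverse_append (l : List (Token R)) (t : Token R) :
    (tokenString enc (l ++ [t])).reverse =
      (t.payload enc).reverse ++ t.kind.marker :: (tokenString enc l).reverse := by
  simp [tokenString, Token.string]

theorem tokenString_length_append (l : List (Token R)) (t : Token R) :
    (tokenString enc (l ++ [t])).length =
      (tokenString enc l).length + (t.payload enc).length + 1 := by
  simp [tokenString, Token.string, Nat.add_assoc]

theorem payload_length_le {l : List (Token R)} {t : Token R} (ht : t ∈ l) :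
    (t.payload enc).length ≤ (tokenString enc l).length := by
  obtain ⟨l₁, l₂, rfl⟩ := List.append_of_mem ht
  simp only [tokenString, List.flatMap_append, List.flatMap_cons, List.length_append, Token.string,
    List.length_cons]
  omega

theorem length_le_tokenString (l : List (Token R)) : l.length ≤ (tokenString enc l).length := by
  induction l with
  | nil => exact Nat.zero_le _
  | cons t l ih =>
    simp only [tokenString, List.flatMap_cons, List.length_append, Token.string,
      List.length_cons] at ih ⊢
    omega

theorem encodeNat_injective : Function.Injective Computability.encodeNat :=
  Function.LeftInverse.injective Computability.decode_encodeNat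

theorem sameVar_eq_true_iff {i j : ℕ} : (Token.var i : Token R).sameVar (.var j) = true ↔
    (Token.var i : Token R).payload enc = (Token.var j : Token R).payload enc := by
  have h : Function.Injective (SystemSymbol.bit : Bool → SystemSymbol Γ) := fun a b h => by
    injection h
  change (i == j) = true ↔ List.map _ _ = List.map _ _
  rw [beq_iff_eq, (List.map_injective_iff.2 h).eq_iff, encodeNat_injective.eq_iff]

/-- The payload of the token of a column. -/
def Col.payload : Col R → List (SystemSymbol Γ)
  | .base _ => []
  | .tok t _ _ => t.payload enc

/-- The payload of the token of a row. -/
def Row.payload : Row R → List (SystemSymbol Γ)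
  | .base _ => []
  | .tok t _ _ => t.payload enc

/-- A scalar is prescribed only in the `cur` row of the block or in the `sum` row of the same
monomial. In the second case positions coincide, and `hrc` turns this into equality of tokens. -/
theorem exists_mono_of_cellCode_eq_scalar {r : Row R} {c : Col R}
    (hrc : ∀ t t' n y y', r = .tok t n y → c = .tok t' n y' → t = t')
    (h : cellCode r c = .scalar) : ∃ x n y, c = .tok (.mono x) n y := by
  cases r with
  | base l =>
    cases c with
    | base l' =>
      rw [cellCode] at h
      split at h <;> cases h
    | tok t n y =>
      cases t with
      | mono x => exact ⟨x, n, y, rfl⟩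
      | poly => cases l <;> cases y <;> cases h
      | var i => cases l <;> cases y <;> cases h
  | tok t n y =>
    cases c with
    | base l' => cases t <;> cases y <;> cases l' <;> cases h
    | tok t' m y' =>
      have hk : t.kind = .mono ∧ relation n m = .same := by
        rw [cellCode] at h
        generalize t.kind = k at h
        generalize t'.kind = k' at h
        generalize relation n m = ρ at h
        generalize Token.sameVar t t' = b at h
        cases k <;> cases y <;> cases k' <;> cases y' <;> cases ρ <;> cases b <;>
          first | exact ⟨rfl, rfl⟩ | cases h
      have hm : m = n := by
        have h' := hk.2
        rw [relation] at h'
        split at h'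
        · assumption
        · split at h' <;> cases h'
      subst hm
      obtain rfl := hrc t t' m y y' rfl rfl
      cases t with
      | mono x => exact ⟨x, m, y', rfl⟩
      | poly => cases hk.1
      | var i => cases hk.1

/-- A scalar is written by copying the payload of the column, which is correct because the token of
such a column is a monomial. -/
theorem cellData_eq [CommRing R] {r : Row R} {c : Col R}
    (hrc : ∀ t t' n y y', r = .tok t n y → c = .tok t' n y' → t = t') : cellData enc r c =
    codeData (entryString enc 0) (entryString enc 1) (c.payload enc) (cellCode r c) := by
  rw [cellData, cell, codeData]
  cases h : cellCode r c with
  | star => rfl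
  | zero => rfl
  | one => rfl
  | scalar =>
    obtain ⟨x, n, y, rfl⟩ := exists_mono_of_cellCode_eq_scalar hrc h
    change (false, entryString enc x) = (false, _ :: letters (List.map _ _))
    rw [letters_map_letter]
    rfl

/-- The Boolean matters only between two variables, and there equality of payloads is equality of
indices, by injectivity of the binary encoding. -/
theorem innerCode_compare {t t' : Token R} {b : Bool}
    (hb : b = true ↔ t.payload enc = t'.payload enc) (y' : ColType) (ρ : Rel) :
    innerCode t.kind .tie t'.kind y' ρ b = innerCode t.kind .tie t'.kind y' ρ (t.sameVar t') := by
  cases t with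
  | poly => rfl
  | mono x => rfl
  | var i =>
    cases t' with
    | poly => rfl
    | mono x => rfl
    | var j =>
      have h : b = (Token.var i : Token R).sameVar (.var j) := by
        rw [Bool.eq_iff_iff, hb, sameVar_eq_true_iff enc]
      rw [h]

end Tokens

/-! ### Writing a row -/

/-- What the program has to know about a row. -/
inductive RowHead : Type
  | base (l : Lab)
  | tok (k : Kind) (y : RowType)

/-- What the program has to know about a row. -/
def Row.head {R : Type u} : Row R → RowHead
  | .base l => .base l
  | .tok t _ y => .tok t.kind y

section RowPrograms

variable {R : Type u} [CommRing R] {Γ : Type} (zs os : List (InstanceSymbol Γ))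

/-- Write the two cells of a token. -/
def cellPair (d d' : Code) : Prog Stk (SystemSymbol Γ) (InstanceSymbol Γ) :=
  .seq (emitCell zs os d') (.seq (emitCell zs os d) (clear .colPay))

/-- Write the two cells of the token of a column. -/
noncomputable def tokenCells : RowHead → Kind → Rel → Prog Stk (SystemSymbol Γ) (InstanceSymbol Γ)
  | .base l, k', _ => cellPair zs os (headCode l k' .fac) (headCode l k' .state)
  | .tok k .tie, k', ρ => .seq (comparePayloads .poly) <| .pop .diff
      (cellPair zs os (innerCode k .tie k' .fac ρ true) (innerCode k .tie k' .state ρ true))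
      fun _ => .seq (clear .diff)
        (cellPair zs os (innerCode k .tie k' .fac ρ false) (innerCode k .tie k' .state ρ false))
  | .tok k y, k', ρ =>
      cellPair zs os (innerCode k y k' .fac ρ false) (innerCode k y k' .state ρ false)

/-- The relative position that a symbol stands for. -/
def symbolRel : Option (SystemSymbol Γ) → Rel
  | some .mono => .same
  | some .var => .prev
  | _ => .far

/-- Write the two cells of the token of a column whose relative position is found on a stack. -/
noncomputable def tokenStep (h : RowHead) (k : Kind) :
    Prog Stk (SystemSymbol Γ) (InstanceSymbol Γ) :=
  .pop .rels (tokenCells zs os h k (symbolRel (none : Option (SystemSymbol Γ))))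
    fun x => tokenCells zs os h k (symbolRel (some x))

/-- Read the tokens on a stack, and run a program for each of them. -/
def forTokens (w pay : Stk) (f : Kind → Prog Stk (SystemSymbol Γ) (InstanceSymbol Γ)) :
    Prog Stk (SystemSymbol Γ) (InstanceSymbol Γ) :=
  .loop w fun
    | .poly => f .poly
    | .mono => f .mono
    | .var => f .var
    | .bit b => .push pay (.bit b)
    | .letter γ => .push pay (.letter γ)

/-- The entries of a row in the columns of the identity block. -/
def baseCode : RowHead → Lab → Code
  | .base l, l' => if l = l' then .one else .zero
  | .tok k y, l => sideCode k y l

/-- Write a row. -/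
noncomputable def writeRow (h : RowHead) : Prog Stk (SystemSymbol Γ) (InstanceSymbol Γ) :=
  .seq (copy .full .scan) <| .seq (copy .script .rels) <|
  .seq (forTokens .scan .colPay (tokenStep zs os h)) <| .seq (clear .rels) <|
  .seq (emitCell zs os (baseCode h .acc)) <| .seq (emitCell zs os (baseCode h .cur)) <|
  .seq (emitCell zs os (baseCode h .tie)) (emitCell zs os (baseCode h .mul))

/-- A bound for the time to write a row. -/
def rowCost (X : ℕ) : ℕ := 5 * cellCost zs os X * (X + 1)

variable {zs os} {M X : ℕ} {s s' : Mem (SystemSymbol Γ)}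

theorem emits_cellPair {d d' : Code} (htmp : s.tmp = []) (hM : M ≤ X)
    (hX : s.colPay.length ≤ X) : Emits .poly zs os M (cellPair zs os d d') s
      { s with colPay := [] } [codeData zs os s.colPay d, codeData zs os s.colPay d']
      (2 * cellCost zs os X + 2 * X + 1) := by
  have h1 := emits_emitCell (zs := zs) (os := os) d' htmp hM hX
  have h2 := emits_emitCell (zs := zs) (os := os) d htmp hM hX
  have h3 : Emits .poly zs os M (clear .colPay) s { s with colPay := [] } []
    (2 * s.colPay.length + 1) := Emits.clear rfl
  exact (h1.seq (h2.seq_quiet h3)).mono (by omega)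

theorem emits_compare (haux : s.aux = []) (hdiff : s.diff = []) : ∃ d,
    Emits .poly zs os M (comparePayloads .poly) s { s with colPay := [], diff := d } []
      (4 * s.colPay.length + 5 * s.rowPay.length + 3) ∧
    (d = [] ↔ s.rowPay = s.colPay) ∧ d.length ≤ s.rowPay.length + s.colPay.length := by
  obtain ⟨d, h1, h2⟩ := exec_compare (B := InstanceSymbol Γ) SystemSymbol.poly s.rowPay s.colPay
  refine ⟨d, .quiet fun n m c o => ?_, h2⟩
  have h3 := h1 (s.counters .poly n m c) o
  have e : ({ s.counters .poly n m c with
      rowPay := s.rowPay, colPay := s.colPay, aux := [], diff := [] } : Mem (SystemSymbol Γ)) =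
      s.counters .poly n m c := by
    cases s
    simp_all [Mem.counters]
  rw [e] at h3
  refine h3.congr ?_ rfl (Nat.le_refl _)
  cases s
  simp_all [Mem.counters]

/-- The comparison consumes the column payload, so the cells of a `tie` row must not need it. -/
theorem innerCode_ne_scalar_of_tie (k k' : Kind) (y' : ColType) (ρ : Rel) (b : Bool) :
    innerCode k .tie k' y' ρ b ≠ .scalar := by
  cases k <;> cases k' <;> cases y' <;> cases ρ <;> cases b <;> simp [innerCode]

theorem codeData_congr {d : Code} (hd : d ≠ .scalar) (x y : List (SystemSymbol Γ)) :
    codeData zs os x d = codeData zs os y d := by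
  cases d <;> first | rfl | exact absurd rfl hd

variable (enc : Computability.Encoding R Γ)

theorem innerCode_of_ne_tie (k : Kind) {y : RowType} (hy : y ≠ .tie) (k' : Kind) (y' : ColType)
    (ρ : Rel) (b : Bool) : innerCode k y k' y' ρ false = innerCode k y k' y' ρ b := by
  cases b
  · rfl
  · cases k <;> cases y <;> cases k' <;> cases y' <;> cases ρ <;>
      first | rfl | exact absurd rfl hy

theorem cellCost_ge : 20 * X + 20 ≤ cellCost zs os X := by
  rw [cellCost, Nat.mul_add]
  have : 20 * X ≤ (2 * (zs.length + os.length) + 20) * X := Nat.mul_le_mul_right _ (by omega)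
  omega

/-- Relative positions matter for the rows of tokens only; for a row of the block `ρ` is arbitrary.
-/
theorem emits_tokenCells (r : Row R) (t' : Token R) (m : ℕ) (ρ : Rel)
    (hρ : ∀ t n y, r = .tok t n y → ρ = relation n m) (ht : ∀ t y, r = .tok t m y → t = t')
    (htmp : s.tmp = []) (haux : s.aux = []) (hdiff : s.diff = [])
    (hr : s.rowPay = r.payload enc) (hc : s.colPay = t'.payload enc)
    (hM : M ≤ X) (hrX : s.rowPay.length ≤ X) (hcX : s.colPay.length ≤ X)
    (hzs : zs = entryString enc 0) (hos : os = entryString enc 1) :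
    Emits .poly zs os M (tokenCells zs os r.head t'.kind ρ) s { s with colPay := [] }
      [cellData enc r (.tok t' m .fac), cellData enc r (.tok t' m .state)]
      (3 * cellCost zs os X) := by
  have hcost := cellCost_ge (zs := zs) (os := os) (X := X)
  have hrc : ∀ z t₁ t₂ n y y', r = .tok t₁ n y → Col.tok t' m z = .tok t₂ n y' → t₁ = t₂ := by
    intro z t₁ t₂ n y y' h₁ h₂
    cases h₂
    exact ht t₁ y h₁
  rw [cellData_eq enc (hrc .fac), cellData_eq enc (hrc .state), ← hzs, ← hos]
  simp only [Col.payload, ← hc]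
  clear hrc
  cases r with
  | base l => exact (emits_cellPair htmp hM hcX).mono (by omega)
  | tok t n y =>
    obtain rfl := hρ t n y rfl
    by_cases hy : y = .tie
    · subst hy
      obtain ⟨d, h1, h2, h3⟩ := emits_compare (zs := zs) (os := os) (M := M) haux hdiff
      rw [hr, hc] at h2
      simp only [cellCode, codeData_congr (innerCode_ne_scalar_of_tie _ _ _ _ _) s.colPay []]
      cases d with
      | nil =>
        have hb := innerCode_compare enc (b := true) (t := t) (t' := t')
          ⟨fun _ => h2.1 rfl, fun _ => rfl⟩
        simp only [← hb]
        have h4 := emits_cellPair (zs := zs) (os := os) (M := M) (X := X)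
          (s := { s with colPay := [], diff := [] })
          (d := innerCode t.kind .tie t'.kind .fac (relation n m) true)
          (d' := innerCode t.kind .tie t'.kind .state (relation n m) true) htmp hM (Nat.zero_le _)
        have h5 := h1.quiet_seq (Emits.popNil (w := .diff) (f := fun _ => .seq (clear .diff)
          (cellPair zs os (innerCode t.kind .tie t'.kind .fac (relation n m) false)
            (innerCode t.kind .tie t'.kind .state (relation n m) false))) rfl rfl h4)
        refine h5.congr ?_ rfl (by omega)
        cases s
        simp_all
      | cons x d =>
        have hb := innerCode_compare enc (b := false) (t := t) (t' := t')
          ⟨fun h => absurd h Bool.false_ne_true,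
            fun h => absurd (h2.2 h) (List.cons_ne_nil _ _)⟩
        simp only [← hb]
        have h4 := emits_cellPair (zs := zs) (os := os) (M := M) (X := X)
          (s := { s with colPay := [], diff := [] })
          (d := innerCode t.kind .tie t'.kind .fac (relation n m) false)
          (d' := innerCode t.kind .tie t'.kind .state (relation n m) false) htmp hM (Nat.zero_le _)
        have h5 : Emits .poly zs os M (clear .diff) { s with colPay := [], diff := d }
          { s with colPay := [], diff := [] } [] (2 * d.length + 1) := Emits.clear rfl
        have h6 := h1.quiet_seq (Emits.popCons (w := .diff)
          (p := cellPair zs os (innerCode t.kind .tie t'.kind .fac (relation n m) true)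
            (innerCode t.kind .tie t'.kind .state (relation n m) true))
          (f := fun _ => .seq (clear .diff)
            (cellPair zs os (innerCode t.kind .tie t'.kind .fac (relation n m) false)
            (innerCode t.kind .tie t'.kind .state (relation n m) false))) rfl rfl
          (h5.quiet_seq h4))
        rw [List.length_cons] at h3
        refine h6.congr ?_ rfl (by omega)
        cases s
        simp_all
    · have h := emits_cellPair (zs := zs) (os := os) (M := M) (X := X) (s := s)
        (d := innerCode t.kind y t'.kind .fac (relation n m) false)
        (d' := innerCode t.kind y t'.kind .state (relation n m) false) htmp hM hcX
      simp only [cellCode, ← innerCode_of_ne_tie t.kind hy t'.kind _ _ (t.sameVar t')]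
      cases y with
      | tie => exact absurd rfl hy
      | mul => exact h.mono (by omega)
      | out => exact h.mono (by omega)
      | sum => exact h.mono (by omega)

end RowPrograms

end TensorRankReduction

namespace TensorRankReduction

/-! ### Writing all rows -/

section Rows

variable {R : Type u} {Γ : Type} (enc : Computability.Encoding R Γ)
  {zs os : List (InstanceSymbol Γ)} {M X : ℕ} {s s₁ s₂ : Mem (SystemSymbol Γ)}

/-- Stacks hold the system from right to left, so a payload is met before its marker. Collecting it
on `pay` restores its order, and the marker then triggers the program for the token. -/
theorem emits_forTokens_payload {w pay : Stk} (hw : w.quiet = true) (hpay : pay.quiet = true)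
    (hne : w ≠ pay) {f : Kind → Prog Stk (SystemSymbol Γ) (InstanceSymbol Γ)}
    {rest : List (SystemSymbol Γ)} {cells : List (Bool × List (InstanceSymbol Γ))} {k : ℕ}
    (p c : List (SystemSymbol Γ)) (hp : ∀ x ∈ p, x.isMarker = false)
    (h : Emits .poly zs os M (forTokens w pay f) ((s.set w rest).set pay (p.reverse ++ c)) s₁
      cells k) :
    Emits .poly zs os M (forTokens w pay f) ((s.set w (p ++ rest)).set pay c) s₁ cells
      (k + 2 * p.length) := by
  induction p generalizing c with
  | nil => exact h
  | cons x p ih =>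
    rw [List.reverse_cons, List.append_assoc] at h
    have h1 := ih (x :: c) (fun y hy => hp y (List.mem_cons_of_mem _ hy)) h
    have hx := hp x List.mem_cons_self
    have e1 : ((s.set w (x :: p ++ rest)).set pay c).get w = x :: (p ++ rest) := by
      rw [Mem.get_set_of_ne _ _ hne, Mem.get_set_self, List.cons_append]
    have e2 : ((s.set w (x :: p ++ rest)).set pay c).set w (p ++ rest) =
        (s.set w (p ++ rest)).set pay c := by
      rw [Mem.set_comm _ _ _ hne.symm, Mem.set_set]
    have h2 : Emits .poly zs os M (.push pay x) ((s.set w (p ++ rest)).set pay c)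
        ((s.set w (p ++ rest)).set pay (x :: c)) [] 1 := by
      have := Emits.push (zs := zs) (os := os) (M := M) (a := SystemSymbol.poly)
        (s := (s.set w (p ++ rest)).set pay c) hpay x
      rwa [Mem.get_set_self, Mem.set_set] at this
    rw [← e2] at h2
    cases x with
    | poly => cases hx
    | mono => cases hx
    | var => cases hx
    | bit b =>
      have h3 : Emits .poly zs os M (forTokens w pay f) _ s₁ (cells ++ []) _ :=
        Emits.loopCons hw e1 h2 h1
      refine h3.congr rfl (List.append_nil _) ?_
      rw [List.length_cons]
      omega
    | letter γ =>
      have h3 : Emits .poly zs os M (forTokens w pay f) _ s₁ (cells ++ []) _ :=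
        Emits.loopCons hw e1 h2 h1
      refine h3.congr rfl (List.append_nil _) ?_
      rw [List.length_cons]
      omega

theorem emits_forTokens_token {w pay : Stk} (hw : w.quiet = true) (hpay : pay.quiet = true)
    (hne : w ≠ pay) {f : Kind → Prog Stk (SystemSymbol Γ) (InstanceSymbol Γ)} {t : Token R}
    {rest : List (SystemSymbol Γ)} {cells cells' : List (Bool × List (InstanceSymbol Γ))} {j k : ℕ}
    (hs : s.get w = (t.payload enc).reverse ++ t.kind.marker :: rest) (hs' : s.get pay = [])
    (h : Emits .poly zs os M (f t.kind) ((s.set w rest).set pay (t.payload enc)) s₁ cells j)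
    (h' : Emits .poly zs os M (forTokens w pay f) s₁ s₂ cells' k) :
    Emits .poly zs os M (forTokens w pay f) s s₂ (cells' ++ cells)
      (j + k + 1 + 2 * (t.payload enc).length) := by
  have e1 : ((s.set w (t.kind.marker :: rest)).set pay (t.payload enc)).get w =
      t.kind.marker :: rest := by
    rw [Mem.get_set_of_ne _ _ hne, Mem.get_set_self]
  have e2 : ((s.set w (t.kind.marker :: rest)).set pay (t.payload enc)).set w rest =
      (s.set w rest).set pay (t.payload enc) := by
    rw [Mem.set_comm _ _ _ hne.symm, Mem.set_set]
  rw [← e2] at h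
  have h2 : Emits .poly zs os M (forTokens w pay f)
      ((s.set w (t.kind.marker :: rest)).set pay ((t.payload enc).reverse.reverse ++ [])) s₂
      (cells' ++ cells) (j + k + 1) := by
    rw [List.reverse_reverse, List.append_nil]
    cases t with
    | poly => exact Emits.loopCons hw e1 h h'
    | mono x => exact Emits.loopCons hw e1 h h'
    | var i => exact Emits.loopCons hw e1 h h'
  have h3 := emits_forTokens_payload hw hpay hne (t.payload enc).reverse []
    (fun x hx => not_isMarker_of_mem_payload enc (List.mem_reverse.1 hx)) h2
  rwa [← hs, Mem.set_get, ← hs', Mem.set_get, List.length_reverse] at h3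

variable [CommRing R]

/-- The relative positions on the stack are those of the tokens to the token of the row. -/
def RelsCorrect (r : Row R) (l : List (Token R)) (ρ : List (SystemSymbol Γ)) : Prop :=
  ∀ t n y, r = .tok t n y → ∀ m < l.length, symbolRel ρ[l.length - 1 - m]? = relation n m

/-- The cells of a row in the columns of the tokens. -/
def tokenColumns (r : Row R) (l : List (Token R)) : List (Bool × List (InstanceSymbol Γ)) :=
  l.zipIdx.flatMap fun t => [cellData enc r (.tok t.1 t.2 .fac), cellData enc r (.tok t.1 t.2 .state)]

/-- Induction from the right end of the list, the order in which tokens are met. Each token consumes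
one letter of `rels`; once `rels` is exhausted, the missing letter means `far`. -/
theorem emits_scan (r : Row R) (hzs : zs = entryString enc 0) (hos : os = entryString enc 1)
    (hM : M ≤ X) (hrX : s.rowPay.length ≤ X) (htmp : s.tmp = []) (haux : s.aux = [])
    (hdiff : s.diff = []) (hr : s.rowPay = r.payload enc) (l : List (Token R))
    (hlX : ∀ t ∈ l, (t.payload enc).length ≤ X) (ρ : List (SystemSymbol Γ))
    (hρ : RelsCorrect r l ρ) (ht : ∀ t n y, r = .tok t n y → ∀ t', l[n]? = some t' → t = t') :
    Emits .poly zs os M (forTokens .scan .colPay (tokenStep zs os r.head))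
      { s with scan := (tokenString enc l).reverse, colPay := [], rels := ρ }
      { s with scan := [], colPay := [], rels := ρ.drop l.length }
      (tokenColumns enc r l)
      (l.length * (3 * cellCost zs os X + 1) + 2 * (tokenString enc l).length + 1) := by
  induction l using List.reverseRecOn generalizing ρ with
  | nil => exact (Emits.loopNil rfl rfl).mono (by simp)
  | append_singleton l t ih =>
    have hcells : tokenColumns enc r (l ++ [t]) = tokenColumns enc r l ++
        [cellData enc r (.tok t l.length .fac), cellData enc r (.tok t l.length .state)] := by
      simp [tokenColumns, List.zipIdx_append]
    have hrel : ∀ t' n y, r = .tok t' n y → symbolRel ρ[0]? = relation n l.length := by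
      intro t' n y hr'
      have := hρ t' n y hr' l.length (by simp)
      simpa using this
    have htail : RelsCorrect r l ρ.tail := by
      intro t' n y hr' m hm
      have := hρ t' n y hr' m (by simp; omega)
      rw [List.length_append, List.length_singleton] at this
      have e : l.length + 1 - 1 - m = (l.length - 1 - m) + 1 := by omega
      rw [e] at this
      rw [List.getElem?_tail]
      exact this
    have ih' := ih (fun t' h' => hlX t' (List.mem_append_left _ h')) ρ.tail htail
      (fun t₁ n y h₁ t₂ h₂ => ht t₁ n y h₁ t₂ (by
        rw [List.getElem?_append_left (List.getElem?_eq_some_iff.1 h₂).1]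
        exact h₂))
    have hcur := fun ρ' hρ' => emits_tokenCells (zs := zs) (os := os) (M := M) (X := X) enc r t
      l.length ρ' hρ' (fun t₁ y h₁ => ht t₁ l.length y h₁ t (by simp))
      (s := { s with
        scan := (tokenString enc l).reverse, colPay := t.payload enc, rels := ρ.tail })
      htmp haux hdiff hr rfl hM hrX (hlX t (by simp)) hzs hos
    have hstep : Emits .poly zs os M (tokenStep zs os r.head t.kind)
        { s with scan := (tokenString enc l).reverse, colPay := t.payload enc, rels := ρ }
        { s with scan := (tokenString enc l).reverse, colPay := [], rels := ρ.tail }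
        [cellData enc r (.tok t l.length .fac), cellData enc r (.tok t l.length .state)]
        (3 * cellCost zs os X + 1) := by
      cases ρ with
      | nil => exact Emits.popNil rfl rfl (hcur _ hrel)
      | cons x ρ => exact Emits.popCons rfl rfl (hcur _ hrel)
    have hmain := emits_forTokens_token enc (w := .scan) (pay := .colPay) rfl rfl (by decide)
      (s := { s with
        scan := (tokenString enc (l ++ [t])).reverse, colPay := [], rels := ρ })
      (tokenString_reverse_append enc l t) rfl hstep ih'
    refine hmain.congr ?_ hcells.symm ?_
    · rw [List.length_append, List.length_singleton, List.drop_tail, Nat.add_comm]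
    · rw [tokenString_length_append, List.length_append, List.length_singleton, Nat.add_mul]
      omega

theorem cols_eq (r : Row R) (l : List (Token R)) : (cols l).map (cellData enc r) =
    [cellData enc r (.base .mul), cellData enc r (.base .tie), cellData enc r (.base .cur),
      cellData enc r (.base .acc)] ++ tokenColumns enc r l := by
  rw [cols, List.map_append, List.map_flatMap]
  rfl

theorem cellData_base (r : Row R) (x : Lab) : cellData enc r (.base x) =
    codeData (entryString enc 0) (entryString enc 1) [] (baseCode r.head x) := by
  rw [cellData_eq enc (fun t t' n y y' _ h => by cases h)]
  cases r <;> rfl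

theorem emits_writeRow (r : Row R) (hzs : zs = entryString enc 0) (hos : os = entryString enc 1)
    (hM : M ≤ X) (l : List (Token R)) (hscan : s.scan = []) (htmp : s.tmp = []) (hcol : s.colPay = [])
    (haux : s.aux = []) (hdiff : s.diff = []) (hrels : s.rels = [])
    (hr : s.rowPay = r.payload enc) (hrX : s.rowPay.length ≤ X)
    (hfull : s.full = (tokenString enc l).reverse) (hlX : (tokenString enc l).length ≤ X)
    (hρ : RelsCorrect r l s.script) (hρX : s.script.length ≤ X)
    (ht : ∀ t n y, r = .tok t n y → ∀ t', l[n]? = some t' → t = t') :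
    Emits .poly zs os M (writeRow zs os r.head) s s ((cols l).map (cellData enc r))
      (rowCost zs os X) := by
  have h1 : Emits .poly zs os M (copy .full .scan) s { s with scan := (tokenString enc l).reverse }
      [] (5 * X + 2) := by
    refine (Emits.copy (w := .full) (w' := .scan) rfl rfl (by decide) (by decide)
      (by decide) htmp).congr ?_ rfl ?_
    · change ({ s with scan := s.full ++ s.scan } : Mem (SystemSymbol Γ)) = _
      rw [hscan, List.append_nil, hfull]
    · change 5 * s.full.length + 2 ≤ _
      rw [hfull, List.length_reverse]
      omega
  have h2 : Emits .poly zs os M (copy .script .rels)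
      { s with scan := (tokenString enc l).reverse }
      { s with scan := (tokenString enc l).reverse, colPay := [], rels := s.script } []
      (5 * X + 2) := by
    refine (Emits.copy (w := .script) (w' := .rels)
      (s := { s with scan := (tokenString enc l).reverse }) rfl rfl (by decide) (by decide)
      (by decide) htmp).congr ?_ rfl ?_
    · change ({ s with
        scan := (tokenString enc l).reverse, rels := s.script ++ s.rels } : Mem (SystemSymbol Γ)) = _
      rw [hrels, List.append_nil, ← hcol]
    · change 5 * s.script.length + 2 ≤ _
      omega
  have h3 := emits_scan enc r hzs hos hM hrX htmp haux hdiff hr l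
    (fun t h => (payload_length_le enc h).trans hlX) s.script hρ ht
  have h4 : Emits .poly zs os M (clear .rels)
      { s with scan := [], colPay := [], rels := s.script.drop l.length } s [] (2 * X + 1) := by
    refine (Emits.clear (w := .rels)
      (s := { s with scan := [], colPay := [], rels := s.script.drop l.length }) rfl).congr ?_ rfl ?_
    · cases s
      simp_all [Mem.set]
    · change 2 * (s.script.drop l.length).length + 1 ≤ _
      rw [List.length_drop]
      omega
  have h5 := fun d => emits_emitCell (zs := zs) (os := os) (s := s) d htmp hM (by simp [hcol])
  have h6 := h1.quiet_seq (h2.quiet_seq (h3.seq (h4.quiet_seq ((h5 (baseCode r.head .acc)).seq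
    ((h5 (baseCode r.head .cur)).seq ((h5 (baseCode r.head .tie)).seq
      (h5 (baseCode r.head .mul))))))))
  refine h6.congr rfl ?_ ?_
  · rw [cols_eq, cellData_base, cellData_base, cellData_base, cellData_base, hcol, ← hzs, ← hos]
    rfl
  · have hcost := cellCost_ge (zs := zs) (os := os) (X := X)
    have hl : l.length ≤ X := (length_le_tokenString enc l).trans hlX
    have hl' : l.length * (3 * cellCost zs os X + 1) ≤ X * (3 * cellCost zs os X + 1) :=
      Nat.mul_le_mul_right _ hl
    have e : 5 * cellCost zs os X * (X + 1) = X * (3 * cellCost zs os X + 1) +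
        2 * (cellCost zs os X * X) + 5 * cellCost zs os X - X := by
      have : X * (3 * cellCost zs os X + 1) = 3 * (cellCost zs os X * X) + X := by ring
      have : 5 * cellCost zs os X * (X + 1) = 5 * (cellCost zs os X * X) + 5 * cellCost zs os X := by
        ring
      omega
    rw [rowCost, e]
    omega

end Rows

end TensorRankReduction

namespace TensorRankReduction

section AllRows

variable {R : Type u} [CommRing R] {Γ : Type} (enc : Computability.Encoding R Γ)
  {zs os : List (InstanceSymbol Γ)} {M X : ℕ} {s : Mem (SystemSymbol Γ)}

/-- Write the rows of a token. -/
noncomputable def tokenRows (zs os : List (InstanceSymbol Γ)) (k : Kind) :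
    Prog Stk (SystemSymbol Γ) (InstanceSymbol Γ) :=
  .seq (writeRow zs os (.tok k .sum)) <| .seq (writeRow zs os (.tok k .out)) <|
  .seq (writeRow zs os (.tok k .mul)) <| .seq (writeRow zs os (.tok k .tie)) <|
  -- The next row token is one place further to the left, so one more token follows it.
  .seq (clear .rowPay) (.push .script .poly)

/-- Write all rows. -/
noncomputable def writeRows (zs os : List (InstanceSymbol Γ)) :
    Prog Stk (SystemSymbol Γ) (InstanceSymbol Γ) :=
  .seq (forTokens .todo .rowPay (tokenRows zs os)) <|
  .seq (writeRow zs os (.base .acc)) <| .seq (writeRow zs os (.base .cur)) <|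
  .seq (writeRow zs os (.base .tie)) (writeRow zs os (.base .mul))

/-- The relative positions of all tokens to a token that is followed by `n` tokens. -/
def relScript (n : ℕ) : List (SystemSymbol Γ) := List.replicate n .poly ++ [.mono, .var]

theorem length_relScript (n : ℕ) : (relScript n : List (SystemSymbol Γ)).length = n + 2 := by
  simp [relScript]

/-- From the last token downwards, the tokens after number `n` are `far`, then comes `n` itself,
then its predecessor. For the rest the stack is exhausted, and `symbolRel` defaults to `far`. -/
theorem symbolRel_relScript {N n m : ℕ} (hn : n < N) (hm : m < N) :
    symbolRel (relScript (N - 1 - n) : List (SystemSymbol Γ))[N - 1 - m]? = relation n m := by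
  rw [relation, relScript]
  by_cases h1 : m = n
  · rw [if_pos h1, h1, List.getElem?_append_right (by simp)]
    simp [symbolRel]
  · rw [if_neg h1]
    by_cases h2 : m + 1 = n
    · rw [if_pos h2, List.getElem?_append_right (by simp; omega), List.length_replicate]
      have e : N - 1 - m - (N - 1 - n) = 1 := by omega
      rw [e]
      rfl
    · rw [if_neg h2]
      by_cases h3 : n < m
      · rw [List.getElem?_append_left (by simp; omega), List.getElem?_replicate, if_pos (by omega)]
        rfl
      · rw [List.getElem?_append_right (by simp; omega), List.length_replicate,
          List.getElem?_eq_none (by simp; omega)]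
        rfl

/-- The cells of some rows. -/
def rowCells (l : List (Token R)) (rs : List (Row R)) : List (Bool × List (InstanceSymbol Γ)) :=
  rs.flatMap fun r => (cols l).map (cellData enc r)

theorem emits_tokenRows (hzs : zs = entryString enc 0) (hos : os = entryString enc 1) (hM : M ≤ X)
    (l l₁ l₂ : List (Token R)) (t : Token R) (hl : l = l₁ ++ t :: l₂) (hscan : s.scan = [])
    (htmp : s.tmp = []) (hcol : s.colPay = []) (haux : s.aux = []) (hdiff : s.diff = [])
    (hrels : s.rels = []) (hr : s.rowPay = t.payload enc)
    (hfull : s.full = (tokenString enc l).reverse) (hX : (tokenString enc l).length + 2 ≤ X)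
    (hscript : s.script = relScript l₂.length) :
    Emits .poly zs os M (tokenRows zs os t.kind) s
      { s with rowPay := [], script := relScript (l₂.length + 1) }
      (rowCells enc l [.tok t l₁.length .tie, .tok t l₁.length .mul, .tok t l₁.length .out,
        .tok t l₁.length .sum]) (4 * rowCost zs os X + 2 * X + 2) := by
  have hlen : l.length = l₁.length + 1 + l₂.length := by
    rw [hl, List.length_append, List.length_cons]
    omega
  have hlX := length_le_tokenString enc l
  have htX : (t.payload enc).length ≤ (tokenString enc l).length :=
    payload_length_le enc (by simp [hl])
  have hrow := fun y => emits_writeRow (M := M) (X := X) enc (.tok t l₁.length y) hzs hos hM l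
    hscan htmp hcol haux hdiff hrels hr (by rw [hr]; omega) hfull (by omega)
    (by
      intro t' n y' h m hm
      cases h
      have e : l₂.length = l.length - 1 - l₁.length := by omega
      rw [hscript, e]
      exact symbolRel_relScript (by omega) hm)
    (by rw [hscript, length_relScript]; omega)
    (by
      intro t₁ n y' h t₂ h₂
      cases h
      rw [hl] at h₂
      simpa using h₂)
  have h1 : Emits .poly zs os M (clear .rowPay) s { s with rowPay := [] } [] (2 * X + 1) := by
    refine (Emits.clear (w := .rowPay) rfl).mono ?_
    change 2 * s.rowPay.length + 1 ≤ _
    rw [hr]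
    omega
  have h2 : Emits .poly zs os M (.push .script .poly) { s with rowPay := [] }
      { s with rowPay := [], script := relScript (l₂.length + 1) } [] 1 := by
    refine (Emits.push (w := .script) (s := { s with rowPay := [] }) rfl _).congr ?_ rfl
      (Nat.le_refl _)
    change ({ s with rowPay := [], script := SystemSymbol.poly :: s.script } :
      Mem (SystemSymbol Γ)) = _
    rw [hscript]
    rfl
  refine ((hrow .sum).seq ((hrow .out).seq ((hrow .mul).seq ((hrow .tie).seq_quiet
    (h1.quiet_seq h2))))).congr rfl ?_ (by omega)
  simp [rowCells]

/-- Induction on the tokens `l₁` whose rows are still missing, from the right; `script` keeps step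
with the tokens `l₂` already treated. -/
theorem emits_forTokens_tokenRows (hzs : zs = entryString enc 0) (hos : os = entryString enc 1)
    (hM : M ≤ X) (l l₁ l₂ : List (Token R)) (hl : l = l₁ ++ l₂) (hscan : s.scan = [])
    (htmp : s.tmp = []) (hcol : s.colPay = []) (haux : s.aux = []) (hdiff : s.diff = [])
    (hrels : s.rels = []) (hfull : s.full = (tokenString enc l).reverse)
    (hX : (tokenString enc l).length + 2 ≤ X) :
    Emits .poly zs os M (forTokens .todo .rowPay (tokenRows zs os))
      { s with
        todo := (tokenString enc l₁).reverse, rowPay := [], script := relScript l₂.length }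
      { s with todo := [], rowPay := [], script := relScript l.length }
      (rowCells enc l (l₁.zipIdx.flatMap fun t =>
        [.tok t.1 t.2 .tie, .tok t.1 t.2 .mul, .tok t.1 t.2 .out, .tok t.1 t.2 .sum]))
      (l₁.length * (4 * rowCost zs os X + 2 * X + 3) + 2 * (tokenString enc l₁).length + 1) := by
  induction l₁ using List.reverseRecOn generalizing l₂ with
  | nil =>
    obtain rfl : l = l₂ := hl
    exact (Emits.loopNil rfl rfl).mono (by simp)
  | append_singleton l₁ t ih =>
    have hl' : l = l₁ ++ t :: l₂ := by simp [hl]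
    have h1 := emits_tokenRows enc hzs hos hM l l₁ l₂ t hl'
      (s := { s with
        todo := (tokenString enc l₁).reverse
        rowPay := t.payload enc
        script := relScript l₂.length }) hscan htmp hcol haux hdiff hrels rfl hfull hX rfl
    have h2 := emits_forTokens_token enc (w := .todo) (pay := .rowPay) rfl rfl (by decide)
      (s := { s with
        todo := (tokenString enc (l₁ ++ [t])).reverse
        rowPay := []
        script := relScript l₂.length })
      (tokenString_reverse_append enc l₁ t) rfl h1 (ih (t :: l₂) hl')
    refine h2.congr rfl ?_ ?_
    · simp [rowCells, List.zipIdx_append]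
    · rw [tokenString_length_append, List.length_append, List.length_singleton, Nat.add_mul]
      omega

/-- A bound for the time to write all rows. -/
def rowsCost (zs os : List (InstanceSymbol Γ)) (X : ℕ) : ℕ := 5 * rowCost zs os X * (X + 1)

theorem rowCost_ge : 100 * X + 100 ≤ rowCost zs os X := by
  have h := cellCost_ge (zs := zs) (os := os) (X := X)
  have h' : cellCost zs os X ≤ cellCost zs os X * (X + 1) := Nat.le_mul_of_pos_right _ (by omega)
  rw [rowCost, Nat.mul_assoc]
  omega

theorem emits_writeRows (hzs : zs = entryString enc 0) (hos : os = entryString enc 1)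
    (hM : M ≤ X) (l : List (Token R)) (hscan : s.scan = []) (htmp : s.tmp = [])
    (hcol : s.colPay = []) (haux : s.aux = []) (hdiff : s.diff = []) (hrels : s.rels = [])
    (hfull : s.full = (tokenString enc l).reverse) (hX : (tokenString enc l).length + 2 ≤ X)
    (htodo : s.todo = (tokenString enc l).reverse) (hrow : s.rowPay = [])
    (hscript : s.script = relScript 0) :
    Emits .poly zs os M (writeRows zs os) s { s with todo := [], script := relScript l.length }
      (allCells enc l) (rowsCost zs os X) := by
  have h1 := emits_forTokens_tokenRows enc hzs hos hM l l [] (List.append_nil _).symm hscan htmp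
    hcol haux hdiff hrels hfull hX
  have e : ({ s with
      todo := (tokenString enc l).reverse
      rowPay := []
      script := relScript ([] : List (Token R)).length } : Mem (SystemSymbol Γ)) = s := by
    cases s
    simp_all
  rw [e] at h1
  have e' : ({ s with todo := [], rowPay := [], script := relScript l.length } :
      Mem (SystemSymbol Γ)) = { s with todo := [], script := relScript l.length } := by
    rw [← hrow]
  replace h1 := h1.congr e' rfl (Nat.le_refl _)
  have hlX := length_le_tokenString enc l
  have h2 := fun x => emits_writeRow (M := M) (X := X) enc (.base x) hzs hos hM l
    (s := { s with todo := [], script := relScript l.length })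
    hscan htmp hcol haux hdiff hrels hrow (by simp [hrow]) hfull (by omega)
    (fun t n y h => by cases h) (by rw [length_relScript]; omega) (fun t n y h => by cases h)
  refine (h1.seq ((h2 .acc).seq ((h2 .cur).seq ((h2 .tie).seq (h2 .mul))))).congr rfl ?_ ?_
  · simp [allCells, rowCells, rows]
  · have h3 := rowCost_ge (zs := zs) (os := os) (X := X)
    have h4 : l.length * (4 * rowCost zs os X + 2 * X + 3) ≤
        X * (4 * rowCost zs os X + 2 * X + 3) := Nat.mul_le_mul_right _ (by omega)
    have h5 : X * (4 * rowCost zs os X + 2 * X + 3) ≤ X * (5 * rowCost zs os X) :=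
      Nat.mul_le_mul_left _ (by omega)
    have h6 : rowsCost zs os X = X * (5 * rowCost zs os X) + 5 * rowCost zs os X := by
      rw [rowsCost]
      ring
    omega

end AllRows

/-! ### The whole program -/

section Main

variable {Γ : Type}

namespace Mem

/-- All stacks are empty. -/
def empty {A : Type} : Mem A := ⟨[], [], [], [], [], [], [], [], [], [], [], [], [], [], []⟩

theorem get_empty {A : Type} : (empty : Mem A).get = fun _ => [] := by
  funext w
  cases w <;> rfl

end Mem

/-- Push several copies of a letter. -/
def pushMany (w : Stk) : ℕ → Prog Stk (SystemSymbol Γ) (InstanceSymbol Γ)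
  | 0 => .skip
  | n + 1 => .seq (pushMany w n) (.push w .poly)

variable {s : Mem (SystemSymbol Γ)} {o : List (InstanceSymbol Γ)}

theorem exec_pushMany (w : Stk) (n : ℕ) : Exec (pushMany w n) s o
    (s.set w (List.replicate n .poly ++ s.get w)) o (n + 1) := by
  induction n with
  | zero => exact Exec.skip.congr (s.set_get w).symm rfl (Nat.le_refl _)
  | succ n ih =>
    refine (ih.seq (Exec.push _)).congr ?_ rfl (Nat.le_refl _)
    rw [Mem.set_set, Mem.get_set_self]
    rfl

/-- Count the rows and columns of a token. -/
def countToken : Prog Stk (SystemSymbol Γ) (InstanceSymbol Γ) :=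
  .seq (pushMany .numRows 4) (pushMany .numCols 2)

/-- Read the input, and count the rows and columns. -/
def readInput : Prog Stk (SystemSymbol Γ) (InstanceSymbol Γ) :=
  .loop .todo fun x => .seq (.push .full x) (if x.isMarker then countToken else .skip)

theorem exec_countToken (a b : ℕ) : Exec countToken
    { s with numRows := List.replicate a .poly, numCols := List.replicate b .poly } o
    { s with numRows := List.replicate (a + 4) .poly, numCols := List.replicate (b + 2) .poly } o
    8 := by
  refine ((exec_pushMany .numRows 4).seq (exec_pushMany .numCols 2)).congr ?_ rfl (Nat.le_refl _)
  rw [Nat.add_comm a, Nat.add_comm b, List.replicate_add, List.replicate_add]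
  rfl

theorem exec_readInput (x f : List (SystemSymbol Γ)) (a b : ℕ) : Exec readInput
    { s with
      todo := x
      full := f
      numRows := List.replicate a .poly
      numCols := List.replicate b .poly } o
    { s with
      todo := []
      full := x.reverse ++ f
      numRows := List.replicate (a + 4 * x.countP SystemSymbol.isMarker) .poly
      numCols := List.replicate (b + 2 * x.countP SystemSymbol.isMarker) .poly } o
    (10 * x.length + 1) := by
  induction x generalizing f a b with
  | nil => exact Exec.loopNil rfl
  | cons y x ih =>
    have hstep : Exec (if y.isMarker then countToken else .skip)
        { s with
          todo := x
          full := y :: f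
          numRows := List.replicate a .poly
          numCols := List.replicate b .poly } o
        { s with
          todo := x
          full := y :: f
          numRows := List.replicate (a + 4 * [y].countP SystemSymbol.isMarker) .poly
          numCols := List.replicate (b + 2 * [y].countP SystemSymbol.isMarker) .poly } o 8 := by
      by_cases hy : y.isMarker = true
      · rw [if_pos hy, List.countP_singleton, if_pos hy]
        exact exec_countToken (s := { s with todo := x, full := y :: f }) a b
      · rw [if_neg hy, List.countP_singleton, if_neg hy]
        exact Exec.skip.mono (by omega)
    have e : (y :: x).countP SystemSymbol.isMarker =
        [y].countP SystemSymbol.isMarker + x.countP SystemSymbol.isMarker := by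
      rw [← List.countP_append]
      rfl
    refine (Exec.loopCons rfl ((Exec.push y).seq hstep) (ih (y :: f) _ _)).congr ?_ rfl ?_
    · rw [e, List.reverse_cons, List.append_assoc, Nat.mul_add, Nat.mul_add, Nat.add_assoc,
        Nat.add_assoc]
      rfl
    · rw [List.length_cons]
      omega

/-- Compute the number of cells. -/
def countCells : Prog Stk (SystemSymbol Γ) (InstanceSymbol Γ) :=
  .seq (.loop .numRows fun x => .seq (.push .aux x) (copy .numCols .before)) (move .aux .numRows)

theorem exec_countCells_loop (a b c d : ℕ) (htmp : s.tmp = []) :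
    Exec (.loop .numRows fun x => .seq (.push .aux x) (copy .numCols .before))
    { s with
      aux := List.replicate c .poly
      before := List.replicate d .poly
      numRows := List.replicate a .poly
      numCols := List.replicate b .poly } o
    { s with
      aux := List.replicate (c + a) .poly
      before := List.replicate (d + a * b) .poly
      numRows := []
      numCols := List.replicate b .poly } o (a * (5 * b + 4) + 1) := by
  induction a generalizing c d with
  | zero =>
    rw [Nat.zero_mul, Nat.zero_mul]
    exact Exec.loopNil rfl
  | succ a ih =>
    have h := exec_copy (B := InstanceSymbol Γ) (w := .numCols) (w' := .before) (o := o)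
      (s := { s with
        aux := List.replicate (c + 1) .poly
        before := List.replicate d .poly
        numRows := List.replicate a .poly
        numCols := List.replicate b .poly }) (by decide) (by decide) (by decide) htmp
    have e : ({ s with
        aux := List.replicate (c + 1) .poly
        before := List.replicate b .poly ++ List.replicate d .poly
        numRows := List.replicate a .poly
        numCols := List.replicate b .poly } : Mem (SystemSymbol Γ)) =
      { s with
        aux := List.replicate (c + 1) .poly
        before := List.replicate (d + b) .poly
        numRows := List.replicate a .poly
        numCols := List.replicate b .poly } := by
      rw [List.replicate_append_replicate, Nat.add_comm b]
    have h' := h.congr e rfl (Nat.le_refl _)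
    refine (Exec.loopCons rfl ((Exec.push _).seq h') (ih (c + 1) (d + b))).congr ?_ rfl ?_
    · have e1 : c + 1 + a = c + (a + 1) := by omega
      have e2 : d + b + a * b = d + (a + 1) * b := by rw [Nat.add_mul]; omega
      rw [e1, e2]
    · change 1 + (5 * (List.replicate b SystemSymbol.poly).length + 2) + _ + 1 ≤ _
      rw [List.length_replicate, Nat.add_mul]
      omega

theorem exec_countCells (a b : ℕ) (htmp : s.tmp = []) (haux : s.aux = []) (hbefore : s.before = []) :
    Exec countCells
    { s with numRows := List.replicate a .poly, numCols := List.replicate b .poly } o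
    { s with
      before := List.replicate (a * b) .poly
      numRows := List.replicate a .poly
      numCols := List.replicate b .poly } o (a * (5 * b + 6) + 2) := by
  have h1 := exec_countCells_loop (o := o) a b 0 0 htmp
  have h2 := exec_move (B := InstanceSymbol Γ) (w := .aux) (w' := .numRows) (o := o)
    (s := { s with
      aux := List.replicate a .poly
      before := List.replicate (a * b) .poly
      numRows := []
      numCols := List.replicate b .poly }) (by decide)
  rw [Nat.zero_add, Nat.zero_add] at h1
  have e : ({ s with
      aux := List.replicate 0 .poly
      before := List.replicate 0 .poly
      numRows := List.replicate a .poly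
      numCols := List.replicate b .poly } : Mem (SystemSymbol Γ)) =
      { s with numRows := List.replicate a .poly, numCols := List.replicate b .poly } := by
    cases s
    simp_all
  rw [e] at h1
  refine (h1.seq h2).congr ?_ rfl ?_
  · change ({ s with
      aux := []
      before := List.replicate (a * b) .poly
      numRows := (List.replicate a SystemSymbol.poly).reverse ++ []
      numCols := List.replicate b .poly } : Mem (SystemSymbol Γ)) = _
    rw [List.reverse_replicate, List.append_nil, ← haux]
  · change _ + (2 * (List.replicate a SystemSymbol.poly).length + 1) ≤ _
    rw [List.length_replicate, Nat.mul_add, Nat.mul_add]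
    omega

/-- Write a number in unary: the length of a stack, which is consumed, plus a constant. -/
def emitUnary (w : Stk) (k : ℕ) : Prog Stk (SystemSymbol Γ) (InstanceSymbol Γ) :=
  .seq (.emit .endNum) <| .seq (emitMany w .tmp [.one]) <| .seq (clear .tmp)
    (emitList (List.replicate k .one))

theorem exec_emitUnary {w : Stk} (hw : w ≠ .tmp) {n : ℕ} (k : ℕ) (htmp : s.get .tmp = [])
    (hn : (s.get w).length = n) :
    Exec (emitUnary w k) s o (s.set w []) (encodeUnary (n + k) ++ o) (6 * n + k + 4) := by
  subst hn
  have h1 := exec_emitMany (s := s) (o := .endNum :: o) hw [InstanceSymbol.one]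
  have h2 := exec_clear (B := InstanceSymbol Γ)
    (s := (s.set .tmp ((s.get w).reverse ++ s.get .tmp)).set w [])
    (o := (List.replicate (s.get w).length [InstanceSymbol.one]).flatten ++ .endNum :: o) .tmp
  refine ((Exec.emit _).seq (h1.seq (h2.seq (exec_emitList _)))).congr ?_ ?_ ?_
  · rw [Mem.set_comm _ _ _ hw, Mem.set_set, ← htmp, Mem.set_get]
  · have e : (List.replicate (s.get w).length [(InstanceSymbol.one : InstanceSymbol Γ)]).flatten =
        List.replicate (s.get w).length .one := by
      simp [List.flatten_replicate_singleton]
    rw [e, encodeUnary, Nat.add_comm _ k, List.replicate_add]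
    simp only [List.append_assoc, List.singleton_append]
  · rw [Mem.get_set_of_ne _ _ hw.symm, Mem.get_set_self, htmp, List.append_nil,
      List.length_reverse, List.length_replicate, List.length_singleton]
    omega

end Main

end TensorRankReduction

namespace TensorRankReduction

/-! ### The complete program and its running time. -/

section Construct

variable {R : Type u} {Γ : Type} (enc : Computability.Encoding R Γ)

theorem tokenString_append (l l' : List (Token R)) :
    tokenString enc (l ++ l') = tokenString enc l ++ tokenString enc l' := List.flatMap_append

theorem tokenString_vars (vars : List ℕ) :
    tokenString enc (vars.map Token.var) = vars.flatMap encodeVar := by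
  rw [tokenString, List.flatMap_map]
  rfl

theorem tokenString_monoTokens (m : Mono R) :
    tokenString enc (monoTokens m) = encodeMono enc m := by
  rw [encodeMono, ← tokenString_vars enc]
  rfl

theorem tokenString_polyTokens (f : Poly R) :
    tokenString enc (polyTokens f) = encodePoly enc f := by
  change SystemSymbol.poly :: tokenString enc (f.flatMap monoTokens) = _
  rw [encodePoly, tokenString, List.flatMap_assoc]
  congr 2
  funext m
  exact tokenString_monoTokens enc m

/-- The closing token is the one symbol that the program itself adds to the input. -/
theorem tokenString_systemTokens (F : List (Poly R)) :
    tokenString enc (systemTokens F) = encodeSystem enc F ++ [.poly] := by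
  rw [systemTokens, tokenString_append, encodeSystem]
  congr 1
  rw [tokenString, List.flatMap_assoc]
  congr 1
  funext f
  exact tokenString_polyTokens enc f

theorem countP_tokenString (l : List (Token R)) :
    (tokenString enc l).countP SystemSymbol.isMarker = l.length := by
  induction l with
  | nil => rfl
  | cons t l ih =>
    have h : (t.payload enc).countP SystemSymbol.isMarker = 0 :=
      List.countP_eq_zero.2 fun x hx => by simp [not_isMarker_of_mem_payload enc hx]
    have h' : (t.kind.marker : SystemSymbol Γ).isMarker = true := by cases t <;> rfl
    change (t.kind.marker :: (t.payload enc) ++ tokenString enc l).countP _ = _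
    rw [List.cons_append, List.countP_cons_of_pos h', List.countP_append, h, ih, List.length_cons]
    omega

theorem length_rows (l : List (Token R)) : (rows l).length = 4 + 4 * l.length := by
  simp [rows, List.length_flatMap]
  omega

theorem length_cols (l : List (Token R)) : (cols l).length = 4 + 2 * l.length := by
  simp [cols, List.length_flatMap]
  omega

theorem exec_output {t sc : List (SystemSymbol Γ)} {a b c n : ℕ}
    {o : List (InstanceSymbol Γ)} : Exec
      (.seq (emitUnary .free 4) <| .seq (emitUnary .after 1) <|
        .seq (emitUnary .numCols 0) <| .seq (emitUnary .numRows 0) <|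
        .seq (clear .full) (clear .script))
      { (Mem.empty : Mem (SystemSymbol Γ)) with
        full := t
        script := sc
        after := List.replicate n .poly
        free := List.replicate c .poly
        numRows := List.replicate a .poly
        numCols := List.replicate b .poly } o Mem.empty
      (encodeUnary a ++ (encodeUnary b ++ (encodeUnary (n + 1) ++ (encodeUnary (4 + c) ++ o))))
      (6 * (c + n + b + a) + 2 * (t.length + sc.length) + 30) := by
  have h1 := exec_emitUnary (w := .free) (by decide) 4 (o := o)
    (s := { (Mem.empty : Mem (SystemSymbol Γ)) with
      full := t
      script := sc
      after := List.replicate n .poly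
      free := List.replicate c .poly
      numRows := List.replicate a .poly
      numCols := List.replicate b .poly }) rfl List.length_replicate
  have h2 := exec_emitUnary (w := .after) (by decide) 1 (o := encodeUnary (c + 4) ++ o)
    (s := { (Mem.empty : Mem (SystemSymbol Γ)) with
      full := t
      script := sc
      after := List.replicate n .poly
      numRows := List.replicate a .poly
      numCols := List.replicate b .poly }) rfl List.length_replicate
  have h3 := exec_emitUnary (w := .numCols) (by decide) 0
    (o := encodeUnary (n + 1) ++ (encodeUnary (c + 4) ++ o))
    (s := { (Mem.empty : Mem (SystemSymbol Γ)) with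
      full := t
      script := sc
      numRows := List.replicate a .poly
      numCols := List.replicate b .poly }) rfl List.length_replicate
  have h4 := exec_emitUnary (w := .numRows) (by decide) 0
    (o := encodeUnary (b + 0) ++ (encodeUnary (n + 1) ++ (encodeUnary (c + 4) ++ o)))
    (s := { (Mem.empty : Mem (SystemSymbol Γ)) with
      full := t
      script := sc
      numRows := List.replicate a .poly }) rfl List.length_replicate
  have h5 : Exec (clear .full) { (Mem.empty : Mem (SystemSymbol Γ)) with full := t, script := sc }
      (encodeUnary (a + 0) ++
        (encodeUnary (b + 0) ++ (encodeUnary (n + 1) ++ (encodeUnary (c + 4) ++ o))))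
      { (Mem.empty : Mem (SystemSymbol Γ)) with script := sc } _ (2 * t.length + 1) :=
    exec_clear .full
  have h6 : Exec (clear .script) { (Mem.empty : Mem (SystemSymbol Γ)) with script := sc }
      (encodeUnary (a + 0) ++
        (encodeUnary (b + 0) ++ (encodeUnary (n + 1) ++ (encodeUnary (c + 4) ++ o))))
      Mem.empty _ (2 * sc.length + 1) :=
    exec_clear .script
  refine (h1.seq (h2.seq (h3.seq (h4.seq (h5.seq h6))))).congr rfl ?_ ?_
  · rw [Nat.add_comm c 4]
    rfl
  · omega

/-- The rest of the program is a parameter `q`, which separates counting the rows, columns and cells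
from writing them. -/
theorem exec_preparation (F : List (Poly R)) {q : Prog Stk (SystemSymbol Γ) (InstanceSymbol Γ)}
    {s : Mem (SystemSymbol Γ)} {o : List (InstanceSymbol Γ)} {k a b : ℕ}
    (ha : a = (rows (systemTokens F)).length) (hb : b = (cols (systemTokens F)).length)
    (h : Exec q { (Mem.empty : Mem (SystemSymbol Γ)) with
      todo := (tokenString enc (systemTokens F)).reverse
      full := (tokenString enc (systemTokens F)).reverse
      script := relScript 0
      before := List.replicate (a * b) .poly
      numRows := List.replicate a .poly
      numCols := List.replicate b .poly } [] s o k) :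
    Exec (.seq readInput <| .seq (.push .full .poly) <| .seq countToken <|
      .seq (pushMany .numRows 4) <| .seq (pushMany .numCols 4) <|
      .seq countCells <| .seq (copy .full .todo) <|
      .seq (.push .script .var) <| .seq (.push .script .mono) q)
      { (Mem.empty : Mem (SystemSymbol Γ)) with todo := encodeSystem enc F } [] s o
      (k + 15 * (encodeSystem enc F).length + a * (5 * b + 6) + 50) := by
  have hlen : (tokenString enc (systemTokens F)).length = (encodeSystem enc F).length + 1 := by
    rw [tokenString_systemTokens]
    simp
  generalize hc : (encodeSystem enc F).countP SystemSymbol.isMarker = c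
  have hcount : (systemTokens F).length = c + 1 := by
    rw [← countP_tokenString enc, tokenString_systemTokens, List.countP_append, hc]
    rfl
  -- Four rows for each of the `c` markers of the input, four for the added token, and four for the
  -- identity block.
  have ha' : a = 4 + (0 + 4 * c + 4) := by rw [ha, length_rows, hcount]; omega
  have hb' : b = 4 + (0 + 2 * c + 2) := by rw [hb, length_cols, hcount]; omega
  have h1 := exec_readInput (s := Mem.empty) (o := []) (encodeSystem enc F) [] 0 0
  rw [hc, List.append_nil] at h1
  have h2 : Exec (.push .full .poly)
      { (Mem.empty : Mem (SystemSymbol Γ)) with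
        full := (encodeSystem enc F).reverse
        numRows := List.replicate (0 + 4 * c) .poly
        numCols := List.replicate (0 + 2 * c) .poly } ([] : List (InstanceSymbol Γ))
      { (Mem.empty : Mem (SystemSymbol Γ)) with
        full := (tokenString enc (systemTokens F)).reverse
        numRows := List.replicate (0 + 4 * c) .poly
        numCols := List.replicate (0 + 2 * c) .poly } [] 1 := by
    rw [tokenString_systemTokens, List.reverse_append]
    exact Exec.push _
  have h3 := exec_countToken (o := []) (0 + 4 * c) (0 + 2 * c)
    (s := { (Mem.empty : Mem (SystemSymbol Γ)) with
      full := (tokenString enc (systemTokens F)).reverse })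
  have h4 : Exec (pushMany .numRows 4)
      { (Mem.empty : Mem (SystemSymbol Γ)) with
        full := (tokenString enc (systemTokens F)).reverse
        numRows := List.replicate (0 + 4 * c + 4) .poly
        numCols := List.replicate (0 + 2 * c + 2) .poly } ([] : List (InstanceSymbol Γ))
      { (Mem.empty : Mem (SystemSymbol Γ)) with
        full := (tokenString enc (systemTokens F)).reverse
        numRows := List.replicate a .poly
        numCols := List.replicate (0 + 2 * c + 2) .poly } [] 5 := by
    rw [ha', ← List.replicate_append_replicate (n := 4)]
    exact exec_pushMany _ _
  have h5 : Exec (pushMany .numCols 4)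
      { (Mem.empty : Mem (SystemSymbol Γ)) with
        full := (tokenString enc (systemTokens F)).reverse
        numRows := List.replicate a .poly
        numCols := List.replicate (0 + 2 * c + 2) .poly } ([] : List (InstanceSymbol Γ))
      { (Mem.empty : Mem (SystemSymbol Γ)) with
        full := (tokenString enc (systemTokens F)).reverse
        numRows := List.replicate a .poly
        numCols := List.replicate b .poly } [] 5 := by
    rw [hb', ← List.replicate_append_replicate (n := 4)]
    exact exec_pushMany _ _
  have h6 := exec_countCells (o := []) a b
    (s := { (Mem.empty : Mem (SystemSymbol Γ)) with
      full := (tokenString enc (systemTokens F)).reverse }) rfl rfl rfl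
  have h7 : Exec (copy .full .todo)
      { (Mem.empty : Mem (SystemSymbol Γ)) with
        full := (tokenString enc (systemTokens F)).reverse
        before := List.replicate (a * b) .poly
        numRows := List.replicate a .poly
        numCols := List.replicate b .poly } ([] : List (InstanceSymbol Γ))
      { (Mem.empty : Mem (SystemSymbol Γ)) with
        todo := (tokenString enc (systemTokens F)).reverse
        full := (tokenString enc (systemTokens F)).reverse
        before := List.replicate (a * b) .poly
        numRows := List.replicate a .poly
        numCols := List.replicate b .poly } []
      (5 * (tokenString enc (systemTokens F)).reverse.length + 2) := by
    refine (exec_copy (w := .full) (w' := .todo) (by decide) (by decide) (by decide) rfl).congr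
      ?_ rfl (Nat.le_refl _)
    change ({ (Mem.empty : Mem (SystemSymbol Γ)) with
      todo := (tokenString enc (systemTokens F)).reverse ++ []
      full := (tokenString enc (systemTokens F)).reverse
      before := List.replicate (a * b) .poly
      numRows := List.replicate a .poly
      numCols := List.replicate b .poly } : Mem (SystemSymbol Γ)) = _
    rw [List.append_nil]
  rw [List.length_reverse, hlen] at h7
  have h8 : Exec (.seq (.push .script .var) <| .seq (.push .script .mono) q)
      { (Mem.empty : Mem (SystemSymbol Γ)) with
        todo := (tokenString enc (systemTokens F)).reverse
        full := (tokenString enc (systemTokens F)).reverse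
        before := List.replicate (a * b) .poly
        numRows := List.replicate a .poly
        numCols := List.replicate b .poly } [] s o (1 + (1 + k)) :=
    (Exec.push (w := .script) SystemSymbol.var).seq
      (Exec.seq (s₁ := { (Mem.empty : Mem (SystemSymbol Γ)) with
        todo := (tokenString enc (systemTokens F)).reverse
        full := (tokenString enc (systemTokens F)).reverse
        script := relScript 0
        before := List.replicate (a * b) .poly
        numRows := List.replicate a .poly
        numCols := List.replicate b .poly }) (Exec.push (w := .script) SystemSymbol.mono) h)
  exact (h1.seq (h2.seq (h3.seq (h4.seq (h5.seq (h6.seq (h7.seq h8))))))).mono (by omega)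

variable [CommRing R]

theorem length_allCells (l : List (Token R)) :
    (allCells enc l).length = (rows l).length * (cols l).length := by
  simp [allCells, List.length_flatMap]

/-- The program that constructs the tensor and the number. -/
noncomputable def construct (zs os : List (InstanceSymbol Γ)) :
    Prog Stk (SystemSymbol Γ) (InstanceSymbol Γ) :=
  .seq readInput <| .seq (.push .full .poly) <| .seq countToken <|
  .seq (pushMany .numRows 4) <| .seq (pushMany .numCols 4) <|
  .seq countCells <| .seq (copy .full .todo) <|
  .seq (.push .script .var) <| .seq (.push .script .mono) <|
  .seq (writeRows zs os) <|
  .seq (emitUnary .free 4) <| .seq (emitUnary .after 1) <|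
  .seq (emitUnary .numCols 0) <| .seq (emitUnary .numRows 0) <|
  .seq (clear .full) (clear .script)

/-- A bound for the number of cells, for an input of length `n`. -/
def sizeBound (n : ℕ) : ℕ := (4 * n + 8) * (2 * n + 6)

/-- The unary numbers stand in front of the entries but are written last, when the counters contain
the numbers of cells and of free cells. -/
theorem exec_construct (F : List (Poly R)) :
    Exec (construct (entryString enc 0) (entryString enc 1))
      { (Mem.empty : Mem (SystemSymbol Γ)) with todo := encodeSystem enc F } [] Mem.empty
      (encodeInstance enc (reduction F))
      (2 * rowsCost (entryString enc 0) (entryString enc 1)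
        (sizeBound (encodeSystem enc F).length)) := by
  have hlen : (tokenString enc (systemTokens F)).length = (encodeSystem enc F).length + 1 := by
    rw [tokenString_systemTokens]
    simp
  have hN := length_le_tokenString enc (systemTokens F)
  have ha := length_rows (systemTokens F)
  have hb := length_cols (systemTokens F)
  have hcells := length_allCells enc (systemTokens F)
  generalize hℓ : (encodeSystem enc F).length = ℓ at hlen
  generalize hX : sizeBound ℓ = X
  rw [sizeBound] at hX
  generalize hM : (rows (systemTokens F)).length * (cols (systemTokens F)).length = M at hcells
  -- There are at most `ℓ + 1` tokens, hence at most `4 * ℓ + 8` rows and `2 * ℓ + 6` columns.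
  have hMX : M ≤ X := by
    rw [← hM, ← hX]
    exact Nat.mul_le_mul (by omega) (by omega)
  have hX1 : (4 * ℓ + 8) * 6 ≤ X := by
    rw [← hX]
    exact Nat.mul_le_mul_left _ (by omega)
  have hrows := emits_writeRows enc rfl rfl hMX (systemTokens F)
    (s := { (Mem.empty : Mem (SystemSymbol Γ)) with
      todo := (tokenString enc (systemTokens F)).reverse
      full := (tokenString enc (systemTokens F)).reverse
      script := relScript 0
      numRows := List.replicate (rows (systemTokens F)).length .poly
      numCols := List.replicate (cols (systemTokens F)).length .poly })
    rfl rfl rfl rfl rfl rfl rfl (by omega) rfl rfl rfl 0 0 0 [] (by omega)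
  have hout := exec_output (t := (tokenString enc (systemTokens F)).reverse)
    (sc := relScript (systemTokens F).length) (a := (rows (systemTokens F)).length)
    (b := (cols (systemTokens F)).length)
    (c := 0 + (allCells enc (systemTokens F)).countP Prod.fst)
    (n := 0 + (allCells enc (systemTokens F)).length)
    (o := blockStrings (entryString enc 0) (entryString enc 1) 0 0
      (allCells enc (systemTokens F)) ++ [])
  have hbefore : 0 + (allCells enc (systemTokens F)).length =
      (rows (systemTokens F)).length * (cols (systemTokens F)).length := by omega
  have h1 := hrows.seq hout
  rw [hbefore] at h1
  have h2 := exec_preparation enc F rfl rfl h1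
  refine h2.congr rfl ?_ ?_
  · rw [reduction, encodeInstance_patternTensor, card_freePositions enc, Nat.zero_add,
      List.append_nil]
  · have hcount : (allCells enc (systemTokens F)).countP Prod.fst ≤ M := by
      rw [← hcells]
      exact List.countP_le_length
    have hcost : 100 * X + 100 ≤
        rowCost (entryString enc 0) (entryString enc 1) X := rowCost_ge
    -- Everything except writing the rows takes time linear in `X`, and is covered by the second
    -- copy of `rowsCost`.
    have hcost' : 5 * (100 * X + 100) ≤
        rowsCost (entryString enc 0) (entryString enc 1) X := by
      rw [rowsCost]
      exact (Nat.mul_le_mul_left 5 hcost).trans (Nat.le_mul_of_pos_right _ (Nat.succ_pos X))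
    have hab : (rows (systemTokens F)).length * (5 * (cols (systemTokens F)).length + 6) =
        5 * M + 6 * (rows (systemTokens F)).length := by
      rw [← hM]
      ring
    rw [hM, hab, length_relScript, List.length_reverse, hlen, hℓ]
    omega

end Construct

instance : Finite Kind :=
  Finite.of_surjective (fun x : Fin 3 => match x with
    | 0 => Kind.poly
    | 1 => Kind.mono
    | 2 => Kind.var)
    fun x => match x with
      | .poly => ⟨0, rfl⟩
      | .mono => ⟨1, rfl⟩
      | .var => ⟨2, rfl⟩

instance {Γ : Type} [Finite Γ] : Finite (SystemSymbol Γ) :=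
  Finite.of_surjective (α := Kind ⊕ Bool ⊕ Γ)
    (fun x => match x with
      | .inl k => k.marker
      | .inr (.inl b) => .bit b
      | .inr (.inr γ) => .letter γ)
    fun x => match x with
      | .poly => ⟨.inl .poly, rfl⟩
      | .mono => ⟨.inl .mono, rfl⟩
      | .var => ⟨.inl .var, rfl⟩
      | .bit b => ⟨.inr (.inl b), rfl⟩
      | .letter γ => ⟨.inr (.inr γ), rfl⟩

/-- The strings of `0` and `1` are built into the program as constants, and the strings of all other
entries are copied from the input. -/
theorem polyTimeComputable_reduction {R : Type u} [CommRing R] {Γ : Type} [Finite Γ]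
    (enc : Computability.Encoding R Γ) :
    PolyTimeComputable (encodeSystem enc) (encodeInstance enc) (reduction (R := R)) := by
  have : Fintype (SystemSymbol Γ) := Fintype.ofFinite _
  let z := 2 * ((entryString enc (0 : R)).length + (entryString enc (1 : R)).length) + 20
  -- This evaluates to `sizeBound` plus one, the factor that each level of the cost bounds
  -- contributes.
  let X : Polynomial ℕ := (4 * Polynomial.X + 8) * (2 * Polynomial.X + 6) + 1
  refine .of_runs (construct (entryString enc 0) (entryString enc 1)) .todo
    (2 * (5 * (5 * (Polynomial.C z * X) * X) * X)) fun F => ?_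
  have h := exec_construct enc F
  have e : ({ (Mem.empty : Mem (SystemSymbol Γ)) with todo := encodeSystem enc F }).get =
      Function.update (fun _ => []) Stk.todo (encodeSystem enc F) := by
    rw [← Mem.get_empty]
    exact Mem.get_set Mem.empty .todo (encodeSystem enc F)
  rw [Exec, e, Mem.get_empty] at h
  refine h.mono (le_of_eq ?_)
  simp only [rowsCost, rowCost, cellCost, sizeBound, z, X, Polynomial.eval_mul,
    Polynomial.eval_add, Polynomial.eval_C, Polynomial.eval_X, Polynomial.eval_ofNat,
    Polynomial.eval_one]

end TensorRankReduction

theorem theorem2p1 {R : Type u} [CommRing R] [IsDomain R] {Γ : Type} [Fintype Γ]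
    (enc : Computability.Encoding R Γ)
    (hadd : TensorRankReduction.PolyTimeComputable
      (Computability.encodingProd enc enc).encode enc.encode (fun x : R × R => x.1 + x.2))
    (hmul : TensorRankReduction.PolyTimeComputable
      (Computability.encodingProd enc enc).encode enc.encode (fun x : R × R => x.1 * x.2)) :
    ∃ construct : List (TensorRankReduction.Poly R) → TensorRankReduction.Tensor3 R × ℕ,
      TensorRankReduction.PolyTimeComputable (TensorRankReduction.encodeSystem enc)
        (TensorRankReduction.encodeInstance enc) construct ∧
      ∀ (F : List (TensorRankReduction.Poly R)) (S : Type v) [CommRing S] [IsDomain S]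
        [Algebra R S], Function.Injective (algebraMap R S) →
        (TensorRankReduction.HasCommonZero F S ↔
          (construct F).1.rank S ≤ (construct F).2) :=
  ⟨TensorRankReduction.reduction, TensorRankReduction.polyTimeComputable_reduction enc,
    fun F _ _ _ _ hinj => TensorRankReduction.reduction_correct F hinj⟩
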